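/- \textbf{Definitions.} Simple graphs are finite. The local complementation $\tau_v(G)$ of a graph $G$ at a vertex $v$ replaces the subgraph induced on the neighbourhood of $v$ by its complement. A graph $H$ on a subset of $V(G)$ is a \emph{vertex-minor} of $G$, written $H<G$, if it is obtained from $G$ by a finite sequence of local complementations and vertex deletions. A \emph{star graph} is a graph in which one vertex is adjacent to all the others and there are no other edges; the graph without vertices is counted as the star graph on $0$ vertices. A \emph{double-occurrence word} is a word in which each letter of an alphabet $V$ occurs exactly twice; its \emph{alternance graph} $\mathcal A(\boldsymbol X)$ has vertex set $V$, and distinct $u,v$ are adjacent iff some cyclic permutation of $\boldsymbol X$ or of its mirror image has the form $\dots u\dots v\dots u\dots v\dots$. A \emph{circle graph} is an alternance graph of a double-occurrence word. Let $F$ be a $4$-regular multigraph (loops and multiple edges are allowed, a loop contributes $2$ to the degree). An \emph{Eulerian tour} $U=x_0e_0x_1\cdots x_{l-1}e_{l-1}x_0$ of $F$ is a closed walk that traverses each edge exactly once; its induced word is $m(U)=x_1x_2\cdots x_{l-1}x_0$, and $\mathcal A(U)=\mathcal A(m(U))$. The tour $U$ is a \emph{Soet} with respect to $V'\subseteq V(F)$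 if the subword of $m(U)$ formed by the letters in $V'$ is $\boldsymbol s\boldsymbol s$ for a word $\boldsymbol s$ in which each element of $V'$ occurs exactly once. \textbf{Problems.} \begin{itemize} \item ISO-SOET: given a $4$-regular multigraph $F$ and an integer $0\le k\le |V(F)|$, decide whether there are $V'\subseteq V(F)$ with $|V'|=k$ and a Soet of $F$ with respect to $V'$. \item ISO-STARVERTEXMINOR: given a graph $G$ and an integer $k\ge 0$, decide whether there are $V'\subseteq V(G)$ with $|V'|=k$ and a star graph $S_{V'}$ on $V'$ with $S_{V'}<G$. \item ISO-VERTEXMINOR: given graphs $G$ and $H$, decide whether some graph isomorphic to $H$ is a vertex-minor of $G$. \end{itemize} Instances are graphs with vertices $0,\dots,n-1$, given by adjacency matrices (multigraphs: by the list of the end points of the edges), with all integers in unary. A reduction is a polynomial-time many-one (Karp) reduction. \textbf{Theorem.} \begin{enumerate} \item There is a polynomial-time many-one reduction from ISO-SOET to ISO-STARVERTEXMINOR which maps every instance $(F,k)$ with $F$ connected to $(\mathcal A(U),k)$ for some Eulerian tour $U$ of $F$. \item There is a polynomial-time many-one reduction from ISO-SOET to the restriction of ISO-VERTEXMINOR to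 pairs $(G,H)$ with $G$ a circle graph and $H$ a star graph, which maps every instance $(F,k)$ with $F$ connected to $(\mathcal A(U),S_k)$, where $U$ is an Eulerian tour of $F$ and $S_k$ is the star graph on $k$ vertices. \item ISO-SOET reduces in polynomial time to ISO-VERTEXMINOR. \item Consequently, if ISO-SOET is NP-hard, then so are ISO-STARVERTEXMINOR, ISO-VERTEXMINOR restricted to circle graphs $G$ and star graphs $H$, and ISO-VERTEXMINOR. \end{enumerate} -/

import Mathlib

/-! ### Local complementation and vertex-minors -/

/-- Local complementation `τ_v(G)`: the subgraph induced on the neighbourhood of `v` is replaced by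
its complement. -/
def SimpleGraph.localComp {V : Type*} (G : SimpleGraph V) (v : V) : SimpleGraph V where
  Adj x y := x ≠ y ∧ Xor (G.Adj x y) (G.Adj v x ∧ G.Adj v y)
  symm := ⟨fun x y h => by simpa only [G.adj_comm y x, and_comm, ne_comm] using h⟩
  loopless := ⟨fun _ h => h.1 rfl⟩

/-- `VertexMinor G W H`: the graph `H`, whose vertex set is the subset `W` of the vertex set of `G`,
is obtained from `G` by a finite sequence of local complementations and vertex deletions. -/
inductive VertexMinor {V : Type*} (G : SimpleGraph V) : (W : Set V) → SimpleGraph W → Prop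
  | refl : VertexMinor G Set.univ (G.induce Set.univ)
  | localComp {W : Set V} {H : SimpleGraph W} (v : W) :
      VertexMinor G W H → VertexMinor G W (H.localComp v)
  | delete {W : Set V} {H : SimpleGraph W} (v : W) :
      VertexMinor G W H →
        VertexMinor G (W \ {(v : V)}) (H.comap fun x => (⟨x.1, x.2.1⟩ : W))

/-- A star graph: one vertex is adjacent to all the others, and there are no other edges. The graph
without vertices is counted as the star graph on `0` vertices. -/
def IsStar {V : Type*} (G : SimpleGraph V) : Prop :=
  (∃ r, G = SimpleGraph.starGraph r) ∨ IsEmpty V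

/-- The standard star graph on `k` vertices. -/
def starOn : (k : ℕ) → SimpleGraph (Fin k)
  | 0 => ⊥
  | _ + 1 => SimpleGraph.starGraph 0

/-! ### Double-occurrence words and circle graphs -/

/-- A word in which every element of the alphabet `V` occurs exactly twice. -/
def IsDoubleOccurrence {V : Type*} [DecidableEq V] (X : List V) : Prop :=
  ∀ v, X.count v = 2

/-- `Y ∼ X`: the word `Y` is a cyclic permutation of `X` or of the mirror of `X`. -/
def WordEquiv {V : Type*} (Y X : List V) : Prop :=
  Y ~r X ∨ Y ~r X.reverse

theorem WordEquiv.reverse {V : Type*} {Y X : List V} (h : WordEquiv Y X) :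
    WordEquiv Y.reverse X := by
  rcases h with h | h
  · exact Or.inr h.reverse
  · exact Or.inl (by simpa using h.reverse)

/-- `(u, v)` is an alternance of the class of `X`: a word of the form `…u…v…u…v…` is equivalent
to `X`. -/
def IsAlternance {V : Type*} (X : List V) (u v : V) : Prop :=
  u ≠ v ∧ ∃ Y, WordEquiv Y X ∧ [u, v, u, v].Sublist Y

/-- The alternance graph `𝒜(X)` of a word `X`. -/
def alternanceGraph {V : Type*} (X : List V) : SimpleGraph V where
  Adj u v := IsAlternance X u v
  symm := ⟨fun _ _ ⟨hne, Y, hY, hs⟩ => ⟨hne.symm, Y.reverse, hY.reverse, by simpa using hs.reverse⟩⟩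
  loopless := ⟨fun _ h => h.1 rfl⟩

/-- A circle graph is the alternance graph of a double-occurrence word on its vertex set. -/
def IsCircleGraph {V : Type*} [DecidableEq V] (G : SimpleGraph V) : Prop :=
  ∃ X : List V, IsDoubleOccurrence X ∧ G = alternanceGraph X

/-! ### Multigraphs, Eulerian tours and Soets -/

/-- A multigraph with vertex set `V` and edge set `E`: each edge has an unordered pair of (possibly
equal) end points, and several edges may have the same end points. -/
structure MultiGraph (V E : Type*) where
  ends : E → Sym2 V

namespace MultiGraph

/-- The degree of a vertex; a loop at `v` contributes `2`. -/
def degree {V E : Type*} [DecidableEq V] [Fintype E] (F : MultiGraph V E) (v : V) : ℕ :=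
  (Finset.univ.filter fun e => v ∈ F.ends e).card +
    (Finset.univ.filter fun e => F.ends e = s(v, v)).card

/-- Every vertex has degree `d`. -/
def IsRegular {V E : Type*} [DecidableEq V] [Fintype E] (F : MultiGraph V E) (d : ℕ) : Prop :=
  ∀ v, F.degree v = d

/-- A multigraph is connected if its underlying simple graph is. -/
def Connected {V E : Type*} (F : MultiGraph V E) : Prop :=
  (SimpleGraph.fromRel fun u v => ∃ e, F.ends e = s(u, v)).Connected

end MultiGraph

/-- An Eulerian tour `U = x₀ e₀ x₁ e₁ … x_{l-1} e_{l-1} x_l` with `x_l = x₀`: a closed walk that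
traverses every edge exactly once. -/
structure EulerianTour {V E : Type*} (F : MultiGraph V E) where
  length : ℕ
  vert : Fin (length + 1) → V
  edge : Fin length → E
  ends_edge : ∀ i, F.ends (edge i) = s(vert i.castSucc, vert i.succ)
  closed : vert (Fin.last length) = vert 0
  edge_bijective : Function.Bijective edge

namespace EulerianTour

/-- The induced word `m(U) = x₁ x₂ … x_l`. -/
def word {V E : Type*} {F : MultiGraph V E} (U : EulerianTour F) : List V :=
  List.ofFn fun i : Fin U.length => U.vert i.succ

/-- `U` is a semi-ordered Eulerian tour with respect to `V'`: the subword `m(U)[V']` is `s s`, where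
every element of `V'` occurs exactly once in `s`. -/
def IsSoet {V E : Type*} [DecidableEq V] {F : MultiGraph V E} (U : EulerianTour F)
    (V' : Finset V) : Prop :=
  ∃ s : List V, s.Nodup ∧ (∀ v, v ∈ s ↔ v ∈ V') ∧ U.word.filter (· ∈ V') = s ++ s

end EulerianTour

/-! ### Decision problems and polynomial-time many-one reductions -/

/-- A decision problem: a type of instances, encoded as binary strings, with the set of the
`yes`-instances. -/
structure DecisionProblem where
  Instance : Type
  encode : Instance → List Bool
  encode_injective : Function.Injective encode
  yes : Instance → Prop

namespace DecisionProblem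

/-- The function `f` between instances is a polynomial-time many-one (Karp) reduction. -/
def IsReduction (P Q : DecisionProblem) (f : P.Instance → Q.Instance) : Prop :=
  Nonempty (Turing.TM2ComputableInPolyTime P.encode Q.encode f) ∧ ∀ x, P.yes x ↔ Q.yes (f x)

/-- The restriction of a problem to the instances with a given property. -/
def restrict (P : DecisionProblem) (p : P.Instance → Prop) : DecisionProblem where
  Instance := {x : P.Instance // p x}
  encode x := P.encode x.1
  encode_injective := P.encode_injective.comp Subtype.val_injective
  yes x := P.yes x.1

/-- The membership problem of a language. -/
def ofLanguage (L : Language Bool) : DecisionProblem where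
  Instance := List Bool
  encode x := x
  encode_injective := Function.injective_id
  yes x := x ∈ L

end DecisionProblem

/-- Encoding of a pair of binary strings: the two strings are written one after the other, over
disjoint copies of the binary alphabet. -/
def encodeStringPair (x : List Bool × List Bool) : List (Bool ⊕ Bool) :=
  x.1.map Sum.inl ++ x.2.map Sum.inr

/-- The class NP: membership has certificates of polynomial length that can be verified in
polynomial time. -/
def InNP (L : Language Bool) : Prop :=
  ∃ (R : List Bool × List Bool → Bool) (p : Polynomial ℕ),
    Nonempty (Turing.TM2ComputableInPolyTime encodeStringPair Computability.encodeBool R) ∧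
      ∀ x, x ∈ L ↔ ∃ y : List Bool, y.length ≤ p.eval x.length ∧ R (x, y) = true

/-- NP-hardness under polynomial-time many-one reductions. -/
def NPHard (Q : DecisionProblem) : Prop :=
  ∀ L : Language Bool, InNP L → ∃ f, (DecisionProblem.ofLanguage L).IsReduction Q f

/-! ### Encodings of graphs -/

/-- A list of natural numbers as a binary string: each number in unary, followed by a separator. -/
def encodeNats (l : List ℕ) : List Bool :=
  l.flatMap fun a => List.replicate a true ++ [false]

theorem encodeNats_injective : Function.Injective encodeNats := by
  have key : ∀ (a b : ℕ) (s t : List Bool),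
      List.replicate a true ++ false :: s = List.replicate b true ++ false :: t →
        a = b ∧ s = t := by
    intro a
    induction a with
    | zero => intro b s t h; cases b <;> simp_all [List.replicate_succ]
    | succ a ih =>
      intro b s t h
      cases b with
      | zero => simp [List.replicate_succ] at h
      | succ b =>
        simp only [List.replicate_succ, List.cons_append, List.cons.injEq, true_and] at h
        exact ⟨congrArg _ (ih b s t h).1, (ih b s t h).2⟩
  intro l
  induction l with
  | nil => intro l' h; cases l' <;> simp_all [encodeNats]
  | cons a l ih =>
    intro l' h
    cases l' with
    | nil => simp [encodeNats] at h
    | cons b l' =>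
      simp only [encodeNats, List.flatMap_cons, List.append_assoc, List.cons_append,
        List.nil_append] at h
      obtain ⟨rfl, h2⟩ := key _ _ _ _ h
      rw [ih h2]

theorem flatMap_append_inj {α β : Type*} {f g : α → List β} (hl : ∀ a, (f a).length = (g a).length)
    {l : List α} {s t : List β} (h : l.flatMap f ++ s = l.flatMap g ++ t) :
    (∀ a ∈ l, f a = g a) ∧ s = t := by
  induction l with
  | nil => simpa using h
  | cons a l ih =>
    simp only [List.flatMap_cons, List.append_assoc] at h
    obtain ⟨h1, h2⟩ := List.append_inj h (hl a)
    obtain ⟨h3, h4⟩ := ih h2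
    exact ⟨by simpa using ⟨h1, h3⟩, h4⟩

/-- The adjacency matrix of a graph, row by row. -/
noncomputable def adjacencyList {n : ℕ} (G : SimpleGraph (Fin n)) : List ℕ :=
  open Classical in
  (List.finRange n).flatMap fun i => (List.finRange n).map fun j => if G.Adj i j then 1 else 0

theorem adjacencyList_append_inj {n : ℕ} {G H : SimpleGraph (Fin n)} {s t : List ℕ}
    (h : adjacencyList G ++ s = adjacencyList H ++ t) : G = H ∧ s = t := by
  obtain ⟨h1, h2⟩ := flatMap_append_inj (by simp) h
  refine ⟨?_, h2⟩
  ext i j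
  have := (List.map_inj_left.1 (h1 i (List.mem_finRange i))) j (List.mem_finRange j)
  by_cases hG : G.Adj i j <;> by_cases hH : H.Adj i j <;> simp_all

/-- The edges of a multigraph, listed by their two end points. -/
def edgeList {n m : ℕ} (F : MultiGraph (Fin n) (Fin m)) : List ℕ :=
  (List.finRange m).flatMap fun e => [((F.ends e).inf : ℕ), ((F.ends e).sup : ℕ)]

theorem edgeList_injective {n m : ℕ} :
    Function.Injective (edgeList : MultiGraph (Fin n) (Fin m) → List ℕ) := by
  rintro ⟨f⟩ ⟨g⟩ h
  have h' := (flatMap_append_inj (by simp) (congrArg (· ++ []) h)).1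
  congr 1
  funext e
  have he := h' e (List.mem_finRange e)
  simp only [List.cons.injEq, and_true, Fin.val_inj] at he
  generalize f e = a at he
  generalize g e = b at he
  exact Sym2.inf_eq_inf_and_sup_eq_sup.1 he

/-! ### The decision problems -/

/-- An instance of ISO-SOET: a `4`-regular multigraph and an integer `k` that is at most the number
of vertices. -/
structure SoetInstance where
  n : ℕ
  m : ℕ
  F : MultiGraph (Fin n) (Fin m)
  regular : F.IsRegular 4
  k : ℕ
  k_le : k ≤ n

/-- An instance of ISO-STARVERTEXMINOR: a graph and an integer. -/
structure StarInstance where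
  n : ℕ
  G : SimpleGraph (Fin n)
  k : ℕ

/-- An instance of ISO-VERTEXMINOR: a pair of graphs. -/
structure VertexMinorInstance where
  n : ℕ
  G : SimpleGraph (Fin n)
  k : ℕ
  H : SimpleGraph (Fin k)

/-- ISO-SOET: is there a set `V'` of `k` vertices such that `F` has a Soet with respect to `V'`? -/
def isoSoet : DecisionProblem where
  Instance := SoetInstance
  encode x := encodeNats ([x.n, x.m, x.k] ++ edgeList x.F)
  encode_injective := by
    rintro ⟨n, m, F, hF, k, hk⟩ ⟨n', m', F', hF', k', hk'⟩ h
    replace h := encodeNats_injective h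
    simp only [List.cons_append, List.nil_append, List.cons.injEq] at h
    obtain ⟨rfl, rfl, rfl, h1⟩ := h
    obtain rfl := edgeList_injective h1
    rfl
  yes x := ∃ V' : Finset (Fin x.n), V'.card = x.k ∧ ∃ U : EulerianTour x.F, U.IsSoet V'

/-- ISO-STARVERTEXMINOR: is some star graph on a set of `k` vertices of `G` a vertex-minor
of `G`? -/
noncomputable def isoStarVertexMinor : DecisionProblem where
  Instance := StarInstance
  encode x := encodeNats ([x.n, x.k] ++ adjacencyList x.G)
  encode_injective := by
    rintro ⟨n, G, k⟩ ⟨n', G', k'⟩ h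
    replace h := encodeNats_injective h
    simp only [List.cons_append, List.nil_append, List.cons.injEq] at h
    obtain ⟨rfl, rfl, h1⟩ := h
    obtain rfl := (adjacencyList_append_inj (congrArg (· ++ []) h1)).1
    rfl
  yes x := ∃ V' : Finset (Fin x.n), V'.card = x.k ∧
    ∃ S : SimpleGraph (V' : Set (Fin x.n)), IsStar S ∧ VertexMinor x.G (V' : Set (Fin x.n)) S

/-- ISO-VERTEXMINOR: is some graph isomorphic to `H` a vertex-minor of `G`? -/
noncomputable def isoVertexMinor : DecisionProblem where
  Instance := VertexMinorInstance
  encode x := encodeNats ([x.n, x.k] ++ (adjacencyList x.G ++ adjacencyList x.H))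
  encode_injective := by
    rintro ⟨n, G, k, H⟩ ⟨n', G', k', H'⟩ h
    replace h := encodeNats_injective h
    simp only [List.cons_append, List.nil_append, List.cons.injEq] at h
    obtain ⟨rfl, rfl, h1⟩ := h
    obtain ⟨rfl, h2⟩ := adjacencyList_append_inj h1
    obtain rfl := (adjacencyList_append_inj (congrArg (· ++ []) h2)).1
    rfl
  yes x := ∃ (W : Set (Fin x.n)) (H' : SimpleGraph W), Nonempty (x.H ≃g H') ∧ VertexMinor x.G W H'

/-- ISO-VERTEXMINOR restricted to circle graphs `G` and star graphs `H`. -/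
noncomputable def isoVertexMinorCircleStar : DecisionProblem :=
  isoVertexMinor.restrict fun x : VertexMinorInstance => IsCircleGraph x.G ∧ IsStar x.H

/-!
Let `X` be the word of an Eulerian tour `U` of a connected `4`-regular multigraph `F`. Every
letter occurs twice in `X`, and the reductions map `(F, k)` to the alternance graph of `X`, with
`k` or with the star on `k` vertices. Two things have to be shown: that this map preserves the
answers, and that it can be computed in polynomial time by a Turing machine with several stacks.

*Correctness.* A star on `W` is a vertex-minor of `G` if and only if some graph locally equivalent
to `G` is complete on `W`, since deletions can be postponed and since a local complementation at
the centre exchanges stars and complete graphs (`exists_star_vertexMinor_iff`). A local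
complementation of `𝒜(X)` at `v` reverses the part of `X` between the two occurrences of `v`
(`alternanceGraph_reverse_between`), hence replaces the tour by another one. Conversely, by
Kotzig's theorem any two tours are related by reversals of closed segments
(`reflTransGen_segRev_of_perm`), so that the graphs locally equivalent to `𝒜(X)` are exactly the
alternance graphs of the Eulerian tours of `F` (`IsTourWord.locEquiv_iff`). Finally, a tour is a
Soet with respect to `W` if and only if any two letters in `W` alternate, that is, if its
alternance graph is complete on `W` (`EulerianTour.isSoet_iff`).

*Computability.* `StackMachine.Prog` is a small programming language for registers that hold lists
of natural numbers. Its only loop repeats a program as many times as the input is long, and each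
execution of a basic command lengthens the registers by at most one entry, and the entries by at
most one. So all programs run in polynomial time, and they are compiled to stack machines
(`StackMachine.Prog.polyTime`). The program `StackMachine.Prog.tour` is Hierholzer's algorithm: it
extends a walk as long as possible, which closes it because all degrees are even, and then inserts
further closed walks at each of its vertices. If edges are left over in the end, then the
multigraph is disconnected and has no Eulerian tour; such instances, and the one without vertices,
are mapped to a fixed `no`-instance. Finally, polynomial-time computable functions can be composed
(`StackMachine.polyTime_comp`), which transfers NP-hardness along the reductions.
-/

/-! ### Local equivalence and vertex-minors -/

namespace SimpleGraph

variable {V : Type*}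

/-- Two graphs are locally equivalent if a sequence of local complementations transforms one into
the other. -/
def LocEquiv : SimpleGraph V → SimpleGraph V → Prop :=
  Relation.ReflTransGen fun G H => ∃ v, H = G.localComp v

theorem localComp_adj {G : SimpleGraph V} {v x y : V} :
    (G.localComp v).Adj x y ↔ x ≠ y ∧ Xor (G.Adj x y) (G.Adj v x ∧ G.Adj v y) :=
  Iff.rfl

theorem induce_localComp (G : SimpleGraph V) (W : Set V) (v : W) :
    (G.induce W).localComp v = (G.localComp v).induce W := by
  ext x y
  simp [localComp_adj, Subtype.ext_iff]

/-- A star and a complete graph arise from each other by a local complementation at the centre. -/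
theorem starGraph_localComp (r : V) : (starGraph r).localComp r = ⊤ := by
  ext x y
  simp only [localComp_adj, starGraph_adj, top_adj, xor_def]
  grind

theorem top_localComp (r : V) : (⊤ : SimpleGraph V).localComp r = starGraph r := by
  ext x y
  simp only [localComp_adj, starGraph_adj, top_adj, xor_def]
  grind

end SimpleGraph

/-- Vertex deletions can be postponed: a vertex-minor is an induced subgraph of a locally equivalent
graph. -/
theorem VertexMinor.exists_locEquiv {V : Type*} {G : SimpleGraph V} {W : Set V}
    {H : SimpleGraph W} (h : VertexMinor G W H) :
    ∃ G' : SimpleGraph V, G.LocEquiv G' ∧ H = G'.induce W := by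
  induction h with
  | refl => exact ⟨G, .refl, rfl⟩
  | localComp v _ ih =>
    obtain ⟨G', h, rfl⟩ := ih
    exact ⟨G'.localComp v, h.tail ⟨v, rfl⟩, SimpleGraph.induce_localComp _ _ _⟩
  | delete v _ ih =>
    obtain ⟨G', h, rfl⟩ := ih
    exact ⟨G', h, rfl⟩

theorem SimpleGraph.LocEquiv.vertexMinor {V : Type*} [Finite V] {G G' : SimpleGraph V}
    (h : G.LocEquiv G') (W : Set V) : VertexMinor G W (G'.induce W) := by
  have huniv : VertexMinor G Set.univ (G'.induce Set.univ) := by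
    induction h with
    | refl => exact .refl
    | tail _ h ih =>
      obtain ⟨v, rfl⟩ := h
      have := ih.localComp ⟨v, Set.mem_univ v⟩
      rwa [SimpleGraph.induce_localComp] at this
  have key : ∀ D : Set V, D.Finite → ∀ W, W = Dᶜ → VertexMinor G W (G'.induce W) := by
    intro D hD
    induction D, hD using Set.Finite.induction_on with
    | empty =>
      rintro W rfl
      rwa [Set.compl_empty]
    | @insert a D ha _ ih =>
      rintro W rfl
      have h1 : (insert a D)ᶜ = Dᶜ \ {a} := by
        ext x; simp [not_or, and_comm]
      rw [h1]
      exact (ih _ rfl).delete ⟨a, ha⟩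
  exact key Wᶜ (Set.toFinite _) W (compl_compl W).symm

theorem VertexMinor.exists_induce_eq_top {V : Type*} {G : SimpleGraph V} {W : Set V}
    {H : SimpleGraph W} (h : VertexMinor G W H) (hH : IsStar H) :
    ∃ G' : SimpleGraph V, G.LocEquiv G' ∧ G'.induce W = ⊤ := by
  rcases hH with ⟨r, rfl⟩ | hW
  · obtain ⟨G', h, e⟩ := (h.localComp r).exists_locEquiv
    exact ⟨G', h, by rw [← e, SimpleGraph.starGraph_localComp]⟩
  · obtain ⟨G', h, e⟩ := h.exists_locEquiv
    exact ⟨G', h, by ext x; exact hW.elim x⟩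

/-- A star on `W` is a vertex-minor if and only if the complete graph on `W` is. -/
theorem exists_star_vertexMinor_iff {V : Type*} [Finite V] {G : SimpleGraph V} {W : Set V} :
    (∃ S : SimpleGraph W, IsStar S ∧ VertexMinor G W S) ↔
      ∃ G' : SimpleGraph V, G.LocEquiv G' ∧ G'.induce W = ⊤ := by
  constructor
  · rintro ⟨S, hS, h⟩
    exact h.exists_induce_eq_top hS
  · rintro ⟨G', h, e⟩
    have hm := h.vertexMinor W
    rw [e] at hm
    rcases isEmpty_or_nonempty W with hW | ⟨⟨r⟩⟩
    · exact ⟨⊤, .inr hW, hm⟩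
    · exact ⟨_, .inl ⟨r, SimpleGraph.top_localComp r⟩, hm.localComp r⟩

/-! ### Alternances -/

section Words

variable {V : Type*}

theorem List.IsRotated.exists_append {l l' : List V} (h : l ~r l') :
    ∃ a b, l = a ++ b ∧ l' = b ++ a := by
  obtain ⟨n, rfl⟩ := h
  exact ⟨l.take (n % l.length), l.drop (n % l.length), (List.take_append_drop _ _).symm,
    List.rotate_eq_drop_append_take_mod⟩

theorem WordEquiv.refl (X : List V) : WordEquiv X X := .inl (.refl X)

theorem WordEquiv.symm {X Y : List V} (h : WordEquiv X Y) : WordEquiv Y X := by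
  rcases h with h | h
  · exact .inl h.symm
  · exact .inr (by simpa using h.symm.reverse)

theorem WordEquiv.trans {X Y Z : List V} (h : WordEquiv X Y) (h' : WordEquiv Y Z) :
    WordEquiv X Z := by
  rcases h with h | h <;> rcases h' with h' | h'
  · exact .inl (h.trans h')
  · exact .inr (h.trans h')
  · exact .inr (h.trans h'.reverse)
  · exact .inl (h.trans (by simpa using h'.reverse))

theorem WordEquiv.perm {X Y : List V} (h : WordEquiv X Y) : X.Perm Y := by
  rcases h with h | h
  · exact h.perm
  · exact h.perm.trans Y.reverse_perm

/-- The alternance graph depends only on the class of a word. -/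
theorem WordEquiv.alternanceGraph_eq {X Y : List V} (h : WordEquiv X Y) :
    alternanceGraph X = alternanceGraph Y := by
  ext u v
  exact and_congr_right fun _ => ⟨fun ⟨Z, hZ, hs⟩ => ⟨Z, hZ.trans h, hs⟩,
    fun ⟨Z, hZ, hs⟩ => ⟨Z, hZ.trans h.symm, hs⟩⟩

variable [DecidableEq V]

theorem length_filter_pair {u v : V} (huv : u ≠ v) (X : List V) :
    (X.filter fun x => x = u ∨ x = v).length = X.count u + X.count v := by
  induction X with
  | nil => simp
  | cons a X ih =>
    simp only [List.filter_cons, List.count_cons, Bool.decide_or] at ih ⊢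
    by_cases h1 : a = u
    · subst h1; simp [huv, ih]; omega
    · by_cases h2 : a = v
      · subst h2; simp [h1, ih]; omega
      · simp [h1, h2, ih]

/-- In terms of the subword formed by two letters, an alternance is one of two patterns. -/
theorem isAlternance_iff {X : List V} {u v : V} (hu : X.count u = 2) (hv : X.count v = 2) :
    IsAlternance X u v ↔ u ≠ v ∧
      ((X.filter fun x => x = u ∨ x = v) = [u, v, u, v] ∨
        (X.filter fun x => x = u ∨ x = v) = [v, u, v, u]) := by
  refine and_congr_right fun huv => ⟨?_, ?_⟩
  · rintro ⟨Y, hY, hs⟩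
    have h1 := hs.filter (fun x => decide (x = u ∨ x = v))
    have h2 : [u, v, u, v].filter (fun x => decide (x = u ∨ x = v)) = [u, v, u, v] := by simp
    rw [h2] at h1
    have h3 : (Y.filter fun x => x = u ∨ x = v) = [u, v, u, v] := by
      refine (h1.eq_of_length ?_).symm
      rw [length_filter_pair huv, hY.perm.count_eq, hY.perm.count_eq, hu, hv]
      rfl
    have h4 : ∀ Z : List V, Y ~r Z → (Z.filter fun x => x = u ∨ x = v) = [u, v, u, v] ∨
        (Z.filter fun x => x = u ∨ x = v) = [v, u, v, u] := by
      intro Z hZ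
      obtain ⟨a, b, rfl, rfl⟩ := hZ.exists_append
      rw [List.filter_append] at h3 ⊢
      generalize a.filter (fun x => decide (x = u ∨ x = v)) = a' at h3 ⊢
      generalize b.filter (fun x => decide (x = u ∨ x = v)) = b' at h3 ⊢
      rcases a' with _ | ⟨a1, _ | ⟨a2, _ | ⟨a3, _ | ⟨a4, _ | ⟨a5, a'⟩⟩⟩⟩⟩ <;>
        simp only [List.nil_append, List.cons_append, List.cons.injEq, reduceCtorEq,
          and_false] at h3
      all_goals aesop
    rcases hY with hY | hY
    · exact h4 _ hY
    · have := h4 _ hY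
      rw [List.filter_reverse] at this
      rcases this with h | h
      · exact .inr (by simpa using congrArg List.reverse h)
      · exact .inl (by simpa using congrArg List.reverse h)
  · rintro (h | h)
    · exact ⟨X, .refl X, h ▸ List.filter_sublist⟩
    · refine ⟨X.reverse, .inr (.refl _), ?_⟩
      have := (h ▸ List.filter_sublist : [v, u, v, u].Sublist X).reverse
      simpa using this

/-- The subword of `X` formed by the letters `x` and `y`, with `true` for `x` and `false`
for `y`. -/
def pattern (x y : V) (X : List V) : List Bool :=
  (X.filter fun z => z = x ∨ z = y).map fun z => decide (z = x)

theorem pattern_append (x y : V) (X Y : List V) :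
    pattern x y (X ++ Y) = pattern x y X ++ pattern x y Y := by
  simp [pattern]

theorem pattern_reverse (x y : V) (X : List V) :
    pattern x y X.reverse = (pattern x y X).reverse := by
  simp [pattern]

theorem count_true_pattern (x y : V) (X : List V) : (pattern x y X).count true = X.count x := by
  induction X with
  | nil => rfl
  | cons a X ih =>
    simp only [pattern, List.filter_cons, List.count_cons, Bool.decide_or] at ih ⊢
    by_cases h1 : a = x
    · simp [h1, ih]
    · by_cases h2 : a = y
      · simp [h2]; grind
      · simp [h1, h2, ih]

theorem count_false_pattern {x y : V} (hxy : x ≠ y) (X : List V) :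
    (pattern x y X).count false = X.count y := by
  induction X with
  | nil => rfl
  | cons a X ih =>
    simp only [pattern, List.filter_cons, List.count_cons, Bool.decide_or] at ih ⊢
    by_cases h1 : a = x
    · simp [h1, hxy, ih]
    · by_cases h2 : a = y
      · simp [h2, ih, hxy.symm]
      · simp [h1, h2, ih]

theorem isAlternance_iff_pattern {X : List V} {u v : V} (hu : X.count u = 2) (hv : X.count v = 2) :
    IsAlternance X u v ↔ u ≠ v ∧ (pattern u v X = [true, false, true, false] ∨
      pattern u v X = [false, true, false, true]) := by
  rw [isAlternance_iff hu hv]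
  refine and_congr_right fun huv => ?_
  unfold pattern
  have hmem : ∀ x ∈ X.filter (fun x => decide (x = u ∨ x = v)), x = u ∨ x = v := by simp
  generalize X.filter (fun x => decide (x = u ∨ x = v)) = Y at hmem
  rcases Y with _ | ⟨a1, _ | ⟨a2, _ | ⟨a3, _ | ⟨a4, _ | ⟨a5, Y⟩⟩⟩⟩⟩ <;> simp at hmem ⊢
  grind

/-- The effect of a reversal between two occurrences of a letter on the pattern formed by two other
letters, with the pattern `a` between these occurrences and the pattern `b` outside. -/
theorem xor_pattern (a b : List Bool) (h₁ : a.count true + b.count true = 2)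
    (h₂ : a.count false + b.count false = 2) :
    (a.reverse ++ b = [true, false, true, false] ∨ a.reverse ++ b = [false, true, false, true]) ↔
      Xor (a ++ b = [true, false, true, false] ∨ a ++ b = [false, true, false, true])
        (a.count true = 1 ∧ a.count false = 1) := by
  have h : a.length + b.length = 4 := by
    have := List.count_true_add_count_false a
    have := List.count_true_add_count_false b
    omega
  obtain ⟨l, hl⟩ : ∃ l, l = a ++ b := ⟨_, rfl⟩
  have ha : a = l.take a.length := by simp [hl]
  have hb : b = l.drop a.length := by simp [hl]
  have hl4 : l.length = 4 := by simp [hl, h]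
  obtain ⟨j, hj⟩ : ∃ j : Fin 5, a.length = j := ⟨⟨a.length, by omega⟩, rfl⟩
  rw [hj] at ha hb
  clear hl hj h
  subst ha hb
  match l, hl4 with
  | [c₁, c₂, c₃, c₄], _ => revert c₁ c₂ c₃ c₄ j; unfold Xor; decide

end Words

/-! ### Local complementation on words -/

section LocalCompWords

variable {V : Type*} [DecidableEq V]

/-- The letters adjacent to `v` are those that occur once between the two occurrences of `v`. -/
theorem adj_iff_count_eq_one {v x : V} {q r : List V} (hvx : v ≠ x)
    (hX : IsDoubleOccurrence (v :: q ++ v :: r)) :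
    (alternanceGraph (v :: q ++ v :: r)).Adj v x ↔ q.count x = 1 := by
  have hv : v ∉ q ∧ v ∉ r := by
    have := hX v
    simp at this
    simp only [← List.count_eq_zero]
    omega
  have hx := hX x
  have hp : ∀ l : List V, v ∉ l → pattern v x l = List.replicate (l.count x) false := by
    intro l hl
    rw [List.eq_replicate_iff]
    have h1 := count_true_pattern v x l
    rw [List.count_eq_zero_of_not_mem hl] at h1
    refine ⟨?_, ?_⟩
    · have := count_false_pattern hvx l
      have h3 := List.count_true_add_count_false (pattern v x l)
      omega
    · intro b hb
      rw [List.count_eq_zero] at h1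
      cases b <;> simp_all
  have hpv : ∀ l, pattern v x (v :: l) = true :: pattern v x l := by
    intro l; simp [pattern]
  refine (isAlternance_iff_pattern (hX v) (hX x)).trans ?_
  rw [pattern_append, hpv, hpv, hp q hv.1, hp r hv.2]
  simp only [List.cons_append, List.count_cons, List.count_append, beq_iff_eq, if_neg hvx] at hx
  generalize q.count x = m at hx ⊢
  generalize r.count x = k at hx ⊢
  obtain rfl : k = 2 - m := by omega
  have : m ≤ 2 := by omega
  interval_cases m <;> simp [List.replicate_succ, hvx]

/-- Reversing the part of a double-occurrence word between the two occurrences of `v` amounts to a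
local complementation at `v`. -/
theorem alternanceGraph_reverse_between {v : V} {q r : List V}
    (hX : IsDoubleOccurrence (v :: q ++ v :: r)) :
    alternanceGraph (v :: q.reverse ++ v :: r) =
      (alternanceGraph (v :: q ++ v :: r)).localComp v := by
  have hX' : IsDoubleOccurrence (v :: q.reverse ++ v :: r) := by
    intro x
    have := hX x
    simp_all [List.count_cons]
  have hv : ∀ x, v ≠ x → ((alternanceGraph (v :: q.reverse ++ v :: r)).Adj v x ↔
      (alternanceGraph (v :: q ++ v :: r)).Adj v x) := by
    intro x hx
    rw [adj_iff_count_eq_one hx hX, adj_iff_count_eq_one hx hX', List.count_reverse]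
  ext x y
  rw [SimpleGraph.localComp_adj]
  by_cases hxy : x = y
  · simp [hxy]
  by_cases hx : v = x
  · subst hx
    rw [hv y hxy]
    simp [hxy, Xor]
  by_cases hy : v = y
  · subst hy
    rw [SimpleGraph.adj_comm, hv x hx, SimpleGraph.adj_comm]
    simp [hxy, Xor]
  rw [adj_iff_count_eq_one hx hX, adj_iff_count_eq_one hy hX]
  have hpv : ∀ l, pattern x y (v :: l) = pattern x y l := by
    intro l; simp [pattern, hx, hy]
  refine (isAlternance_iff_pattern (hX' x) (hX' y)).trans ?_
  refine (and_congr_right fun hne => ?_)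
  have h : (alternanceGraph (v :: q ++ v :: r)).Adj x y ↔ _ :=
    isAlternance_iff_pattern (hX x) (hX y)
  rw [h, ← count_true_pattern x y q, ← count_false_pattern hxy q]
  simp only [pattern_append, hpv, pattern_reverse, hne, ne_eq, not_false_eq_true, true_and]
  refine xor_pattern _ _ ?_ ?_
  · have := hX x
    rw [count_true_pattern, count_true_pattern]
    simpa [List.count_cons, hx] using this
  · have := hX y
    rw [count_false_pattern hxy, count_false_pattern hxy]
    simpa [List.count_cons, hy] using this

end LocalCompWords

/-! ### Walks given by their words -/

section Walks

variable {V : Type*}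

/-- The edges, as pairs of end points, of the walk that starts at `a` and visits the letters of a
word in turn. -/
def steps (a : V) : List V → List (Sym2 V)
  | [] => []
  | x :: X => s(a, x) :: steps x X

/-- The last vertex of the walk that starts at `a` and visits the letters of a word in turn. -/
def endpt (a : V) : List V → V
  | [] => a
  | x :: X => endpt x X

/-- The word of the reverse of the walk that starts at `u` and visits the letters of `B`; the
reversed walk starts at `endpt u B`. -/
def rv (u : V) (B : List V) : List V := (u :: B).reverse.tail

@[simp] theorem steps_nil (a : V) : steps a [] = [] := rfl
@[simp] theorem steps_cons (a x : V) (X : List V) : steps a (x :: X) = s(a, x) :: steps x X := rfl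
@[simp] theorem endpt_nil (a : V) : endpt a [] = a := rfl
@[simp] theorem endpt_cons (a x : V) (X : List V) : endpt a (x :: X) = endpt x X := rfl
@[simp] theorem rv_nil (a : V) : rv a [] = [] := rfl

@[simp] theorem steps_append (a : V) (X Y : List V) :
    steps a (X ++ Y) = steps a X ++ steps (endpt a X) Y := by
  induction X generalizing a with
  | nil => rfl
  | cons x X ih => simp [ih]

@[simp] theorem endpt_append (a : V) (X Y : List V) :
    endpt a (X ++ Y) = endpt (endpt a X) Y := by
  induction X generalizing a with
  | nil => rfl
  | cons x X ih => simp [ih]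

theorem length_steps (a : V) (X : List V) : (steps a X).length = X.length := by
  induction X generalizing a with
  | nil => rfl
  | cons x X ih => simp [ih]

theorem rv_cons (u x : V) (B : List V) : rv u (x :: B) = rv x B ++ [u] := by
  unfold rv
  rw [List.reverse_cons, List.tail_append_of_ne_nil (by simp)]

theorem rv_append (u : V) (B C : List V) : rv u (B ++ C) = rv (endpt u B) C ++ rv u B := by
  induction B generalizing u with
  | nil => simp
  | cons b B ih => simp [rv_cons, ih]

theorem endpt_rv (u : V) (B : List V) : endpt (endpt u B) (rv u B) = u := by
  cases B with
  | nil => rfl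
  | cons b B => simp [rv_cons]

theorem steps_rv (u : V) (B : List V) :
    steps (endpt u B) (rv u B) = (steps u B).reverse := by
  induction B generalizing u with
  | nil => rfl
  | cons b B ih => simp [rv_cons, ih, endpt_rv, Sym2.eq_swap]

theorem rv_rv (u : V) (B : List V) : rv (endpt u B) (rv u B) = B := by
  induction B generalizing u with
  | nil => rfl
  | cons b B ih => simp [rv_cons, rv_append, ih, endpt_rv]

theorem exists_append_of_mem_steps {a x y : V} {X : List V} (h : s(x, y) ∈ steps a X) :
    ∃ P Q, (endpt a P = x ∧ X = P ++ y :: Q) ∨ (endpt a P = y ∧ X = P ++ x :: Q) := by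
  induction X generalizing a with
  | nil => simp at h
  | cons b X ih =>
    rw [steps_cons, List.mem_cons] at h
    rcases h with h | h
    · rw [Sym2.eq_iff] at h
      refine ⟨[], X, ?_⟩
      rcases h with ⟨rfl, rfl⟩ | ⟨rfl, rfl⟩ <;> simp
    · obtain ⟨P, Q, h⟩ := ih h
      refine ⟨b :: P, Q, ?_⟩
      simpa using h

theorem exists_append_of_mem {a w : V} {X : List V} (h : w ∈ a :: X) :
    ∃ P Q, X = P ++ Q ∧ endpt a P = w := by
  induction X generalizing a with
  | nil => exact ⟨[], [], rfl, by simpa [eq_comm] using h⟩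
  | cons b X ih =>
    rw [List.mem_cons] at h
    rcases h with rfl | h
    · exact ⟨[], _, rfl, rfl⟩
    · obtain ⟨P, Q, rfl, hP⟩ := ih h
      exact ⟨b :: P, Q, rfl, hP⟩

theorem mem_of_mem_steps {a x : V} {X : List V} {e : Sym2 V} (h : e ∈ steps a X) (hx : x ∈ e) :
    x ∈ a :: X := by
  induction X generalizing a with
  | nil => simp at h
  | cons b X ih =>
    rw [steps_cons, List.mem_cons] at h
    rcases h with rfl | h
    · rw [Sym2.mem_iff] at hx
      rcases hx with rfl | rfl <;> simp
    · exact List.mem_cons_of_mem _ (ih h)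

theorem exists_mem_steps {a x : V} {X : List V} (hX : X ≠ []) (h : x ∈ a :: X) :
    ∃ e ∈ steps a X, x ∈ e := by
  induction X generalizing a with
  | nil => exact absurd rfl hX
  | cons b X ih =>
    rw [List.mem_cons] at h
    rcases h with rfl | h
    · exact ⟨s(x, b), by simp⟩
    · rcases eq_or_ne X [] with rfl | hX'
      · exact ⟨s(a, b), by simp, by simp_all⟩
      · obtain ⟨e, he, hxe⟩ := ih hX' h
        exact ⟨e, by simp [he], hxe⟩

end Walks

/-! ### Reversing closed segments of a walk -/

section Kotzig

variable {V : Type*}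

/-- The walk `Y` arises from the walk `X`, both starting at `a`, by reversing a closed segment. -/
inductive SegRev (a : V) : List V → List V → Prop
  | intro (A B C : List V) (h : endpt (endpt a A) B = endpt a A) :
      SegRev a (A ++ (B ++ C)) (A ++ (rv (endpt a A) B ++ C))

theorem endpt_rv_of_closed {u : V} {B : List V} (h : endpt u B = u) : endpt u (rv u B) = u := by
  have := endpt_rv u B
  rwa [h] at this

theorem steps_rv_of_closed {u : V} {B : List V} (h : endpt u B = u) :
    steps u (rv u B) = (steps u B).reverse := by
  have := steps_rv u B
  rwa [h] at this

theorem SegRev.steps_perm {a : V} {X Y : List V} (h : SegRev a X Y) :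
    (steps a X).Perm (steps a Y) := by
  cases h with
  | intro A B C h =>
    simp only [steps_append, h, endpt_rv_of_closed h, steps_rv_of_closed h]
    exact (((List.reverse_perm _).symm).append_right _).append_left _

theorem SegRev.endpt_eq {a : V} {X Y : List V} (h : SegRev a X Y) : endpt a X = endpt a Y := by
  cases h with
  | intro A B C h => simp [h, endpt_rv_of_closed h]

theorem SegRev.reflTransGen_steps_perm {a : V} {X Y : List V}
    (h : Relation.ReflTransGen (SegRev a) X Y) : (steps a X).Perm (steps a Y) := by
  induction h with
  | refl => exact .refl _
  | tail _ h ih => exact ih.trans h.steps_perm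

/-- A walk that starts in `S`, and none of whose edges leaves `S`, stays in `S`. -/
theorem mem_of_mem_walk (S : Set V) {a : V} {X : List V} (ha : a ∈ S)
    (h : ∀ e ∈ steps a X, ∀ x ∈ e, x ∈ S → ∀ z ∈ e, z ∈ S) : ∀ z ∈ a :: X, z ∈ S := by
  induction X generalizing a with
  | nil => simpa using ha
  | cons b X ih =>
    have hb : b ∈ S := h s(a, b) (by simp) a (by simp) ha b (by simp)
    intro z hz
    rw [List.mem_cons] at hz
    rcases hz with rfl | hz
    · exact ha
    · exact ih hb (fun e he => h e (by simp [he])) z hz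

/-- By reversals of closed segments behind an initial part `D`, a walk can be made to continue `D`
with any edge that is the first one of another walk with the same remaining edges. -/
theorem exists_segRev_cons {a v y : V} {D X Y : List V} (hD : endpt a D = v)
    (h : (steps v X).Perm (s(v, y) :: steps y Y)) :
    ∃ Q, Relation.ReflTransGen (SegRev a) (D ++ X) (D ++ y :: Q) := by
  have hmem : s(v, y) ∈ steps v X := h.mem_iff.2 (by simp)
  obtain ⟨P, Q, ⟨hP, rfl⟩ | ⟨hP, rfl⟩⟩ := exists_append_of_mem_steps hmem
  · rcases eq_or_ne P [] with rfl | hPne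
    · exact ⟨Q, .refl⟩
    -- The edges of the closed segment `P` are reached from `y`, so `P` meets the rest of the walk.
    have hw : ∃ w ∈ v :: P, w ∈ y :: Q := by
      by_contra! hcon
      have h' : (steps v P ++ steps y Q).Perm (steps y Y) := by
        rw [steps_append, hP, steps_cons] at h
        exact (List.perm_cons _).1 (List.perm_middle.symm.trans h)
      have hS := mem_of_mem_walk {w | w ∈ y :: Q} (a := y) (X := Y) (by simp) (by
        intro e he x hx hxS z hz
        rcases List.mem_append.1 (h'.mem_iff.2 he) with he | he
        · exact absurd hxS (hcon x (mem_of_mem_steps he hx))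
        · exact mem_of_mem_steps he hz)
      obtain ⟨e, he, hve⟩ := exists_mem_steps hPne (List.mem_cons_self (a := v))
      exact hcon v (by simp)
        (hS v (mem_of_mem_steps (h'.mem_iff.1 (List.mem_append_left _ he)) hve))
    obtain ⟨w, hwP, hwQ⟩ := hw
    obtain ⟨P₁, P₂, rfl, h₁⟩ := exists_append_of_mem hwP
    obtain ⟨Q₁, Q₂, rfl, h₂⟩ := exists_append_of_mem hwQ
    rw [endpt_append, h₁] at hP
    -- Splitting at `w`, the walk is `P₁ P₂ (y Q₁) Q₂`. Reversing first `P₂ (y Q₁)`, which is closed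
    -- at `w`, and then `P₁` with the reverse of `y Q₁`, which is closed at `v`, puts `y Q₁` in front.
    have step₁ : SegRev a ((D ++ P₁) ++ ((P₂ ++ y :: Q₁) ++ Q₂))
        ((D ++ P₁) ++ (rv (endpt a (D ++ P₁)) (P₂ ++ y :: Q₁) ++ Q₂)) :=
      .intro _ _ _ (by simp [hD, h₁, h₂])
    have step₂ : SegRev a (D ++ ((P₁ ++ rv v (y :: Q₁)) ++ (rv w P₂ ++ Q₂)))
        (D ++ (rv (endpt a D) (P₁ ++ rv v (y :: Q₁)) ++ (rv w P₂ ++ Q₂))) :=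
      .intro _ _ _ (by
        have := endpt_rv v (y :: Q₁)
        rw [endpt_cons, h₂] at this
        rw [hD, endpt_append, h₁, this])
    have e₁ : rv (endpt a (D ++ P₁)) (P₂ ++ y :: Q₁) = rv v (y :: Q₁) ++ rv w P₂ := by
      rw [rv_append, endpt_append, hD, h₁, hP]
    have e₂ : rv (endpt a D) (P₁ ++ rv v (y :: Q₁)) = y :: Q₁ ++ rv v P₁ := by
      have := rv_rv v (y :: Q₁)
      rw [endpt_cons, h₂] at this
      rw [rv_append, hD, h₁, this]
    rw [e₁] at step₁
    rw [e₂] at step₂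
    simp only [List.append_assoc, List.cons_append] at step₁ step₂ ⊢
    exact ⟨_, (Relation.ReflTransGen.single step₁).tail step₂⟩
  · refine ⟨rv v P ++ Q, .single ?_⟩
    have step : SegRev a (D ++ ((P ++ [v]) ++ Q)) (D ++ (rv (endpt a D) (P ++ [v]) ++ Q)) :=
      .intro _ _ _ (by simp [hD])
    rw [hD, rv_append, hP] at step
    simpa [rv_cons] using step

/-- Kotzig's theorem: two walks with the same start and the same edges are related by reversals of
closed segments. -/
theorem reflTransGen_segRev_of_perm {a v : V} {D X Y : List V} (hD : endpt a D = v)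
    (h : (steps v X).Perm (steps v Y)) :
    Relation.ReflTransGen (SegRev a) (D ++ X) (D ++ Y) := by
  induction Y generalizing v D X with
  | nil =>
    have := h.length_eq
    rw [length_steps, steps_nil, List.length_nil, List.length_eq_zero_iff] at this
    rw [this]
  | cons y Y ih =>
    obtain ⟨Q, hQ⟩ := exists_segRev_cons hD h
    have h1 := SegRev.reflTransGen_steps_perm hQ
    rw [steps_append, steps_append, hD, List.perm_append_left_iff] at h1
    have h2 : (steps y Q).Perm (steps y Y) := (List.perm_cons _).1 (h1.symm.trans h)
    have := ih (D := D ++ [y]) (by simp) h2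
    simp only [List.append_assoc, List.cons_append, List.nil_append] at this
    exact hQ.trans this

end Kotzig

/-! ### Tours and local equivalence -/

section Tours

variable {V : Type*}

/-- The word `X` is that of a closed walk whose edges, as pairs of end points, are those in `E`. -/
def IsTourWord (E : List (Sym2 V)) (X : List V) : Prop :=
  ∃ a, endpt a X = a ∧ (steps a X).Perm E

theorem exists_append_singleton_of_endpt {a v : V} {X : List V} (h : endpt a X = v) (hX : X ≠ []) :
    ∃ X', X = X' ++ [v] := by
  induction X generalizing a with
  | nil => exact absurd rfl hX
  | cons x X ih =>
    rcases eq_or_ne X [] with rfl | hX'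
    · exact ⟨[], by simpa using h⟩
    · obtain ⟨X', rfl⟩ := ih h hX'
      exact ⟨x :: X', rfl⟩

theorem rv_append_singleton (v : V) (b : List V) : rv v (b ++ [v]) = b.reverse ++ [v] := by
  cases b <;> simp [rv]

/-- A closed walk can be made to start at any of its vertices. -/
theorem exists_rotation {a b : V} {X : List V} (h : endpt a X = a) (hb : b ∈ a :: X) :
    ∃ Y, Y ~r X ∧ endpt b Y = b ∧ (steps b Y).Perm (steps a X) := by
  obtain ⟨P, Q, rfl, rfl⟩ := exists_append_of_mem hb
  rw [endpt_append] at h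
  refine ⟨Q ++ P, List.isRotated_append, by simp [h], ?_⟩
  rw [steps_append, steps_append, h]
  exact List.perm_append_comm

theorem SegRev.perm {a : V} {X Y : List V} (h : SegRev a X Y) : X.Perm Y := by
  cases h with
  | intro A B C h =>
    rcases eq_or_ne B [] with rfl | hB
    · simp
    obtain ⟨b, rfl⟩ := exists_append_singleton_of_endpt h hB
    rw [rv_append_singleton]
    exact ((((b.reverse_perm).symm).append_right _).append_right _).append_left _

variable [DecidableEq V]

theorem IsDoubleOccurrence.perm {X Y : List V} (hX : IsDoubleOccurrence X) (h : X.Perm Y) :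
    IsDoubleOccurrence Y := fun v => by rw [← h.count_eq, hX v]

/-- Reversing a closed segment from `v` to `v` in a tour that visits `v` twice is a local
complementation at `v`; if the segment is the whole tour, then nothing changes. -/
theorem SegRev.localComp {a : V} {X Y : List V} (h : SegRev a X Y) (ha : endpt a X = a)
    (hX : IsDoubleOccurrence X) :
    alternanceGraph Y = alternanceGraph X ∨
      ∃ v, alternanceGraph Y = (alternanceGraph X).localComp v := by
  cases h with
  | intro A B C h =>
    rcases eq_or_ne B [] with rfl | hB
    · simp
    obtain ⟨v, hv⟩ : ∃ v, endpt a A = v := ⟨_, rfl⟩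
    rw [hv] at h ⊢
    obtain ⟨b, rfl⟩ := exists_append_singleton_of_endpt h hB
    rw [rv_append_singleton]
    -- If a second occurrence of `v` can be put in front of the segment, then reversing it is a
    -- local complementation at `v`.
    have key : ∀ r, A ++ (b ++ [v] ++ C) ~r v :: b ++ v :: r →
        A ++ (b.reverse ++ [v] ++ C) ~r v :: b.reverse ++ v :: r →
        ∃ w, alternanceGraph (A ++ (b.reverse ++ [v] ++ C)) =
          (alternanceGraph (A ++ (b ++ [v] ++ C))).localComp w := by
      intro r h1 h2
      refine ⟨v, ?_⟩
      rw [WordEquiv.alternanceGraph_eq (.inl h1), WordEquiv.alternanceGraph_eq (.inl h2)]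
      exact alternanceGraph_reverse_between (hX.perm h1.perm)
    rcases eq_or_ne A [] with rfl | hA
    · obtain rfl : a = v := hv
      rcases eq_or_ne C [] with rfl | hC
      · left
        refine WordEquiv.alternanceGraph_eq (.inr ?_)
        simpa using List.isRotated_append (l := b.reverse) (l' := [a])
      · obtain ⟨c, rfl⟩ := exists_append_singleton_of_endpt (a := a) (v := a) (X := C)
          (by simpa using ha) hC
        right
        refine key c ?_ ?_
        · simpa using List.isRotated_append (l := b ++ a :: c) (l' := [a])
        · simpa using List.isRotated_append (l := b.reverse ++ a :: c) (l' := [a])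
    · obtain ⟨A, rfl⟩ := exists_append_singleton_of_endpt hv hA
      right
      refine key (C ++ A) ?_ ?_
      · simpa using List.isRotated_append (l := A) (l' := v :: b ++ v :: C)
      · simpa using List.isRotated_append (l := A) (l' := v :: b.reverse ++ v :: C)

theorem locEquiv_of_segRev {a : V} {X Y : List V} (h : Relation.ReflTransGen (SegRev a) X Y)
    (ha : endpt a X = a) (hX : IsDoubleOccurrence X) :
    (alternanceGraph X).LocEquiv (alternanceGraph Y) := by
  suffices endpt a Y = a ∧ IsDoubleOccurrence Y ∧
    (alternanceGraph X).LocEquiv (alternanceGraph Y) from this.2.2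
  induction h with
  | refl => exact ⟨ha, hX, .refl⟩
  | tail _ h ih =>
    refine ⟨h.endpt_eq ▸ ih.1, ih.2.1.perm h.perm, ?_⟩
    rcases h.localComp ih.1 ih.2.1 with e | e
    · rw [e]; exact ih.2.2
    · exact ih.2.2.tail e

/-- All tours of a `4`-regular multigraph have locally equivalent alternance graphs. -/
theorem IsTourWord.locEquiv {E : List (Sym2 V)} {X Y : List V} (hX : IsTourWord E X)
    (hY : IsTourWord E Y) (hd : IsDoubleOccurrence X) :
    (alternanceGraph X).LocEquiv (alternanceGraph Y) := by
  obtain ⟨a, ha, hX⟩ := hX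
  obtain ⟨b, hb, hY⟩ := hY
  have hXY := hX.trans hY.symm
  rcases eq_or_ne Y [] with rfl | hne
  · have := hXY.length_eq
    rw [length_steps, steps_nil, List.length_nil, List.length_eq_zero_iff] at this
    rw [this]
    exact .refl
  obtain ⟨e, he, hbe⟩ := exists_mem_steps hne (List.mem_cons_self (a := b))
  obtain ⟨X', hr, hX', hs⟩ := exists_rotation ha (mem_of_mem_steps (hXY.mem_iff.2 he) hbe)
  rw [← WordEquiv.alternanceGraph_eq (.inl hr)]
  exact locEquiv_of_segRev (reflTransGen_segRev_of_perm (D := []) rfl (hs.trans hXY)) hX'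
    (hd.perm hr.symm.perm)

/-- The local complements of the alternance graph of a tour are alternance graphs of tours. -/
theorem IsTourWord.exists_localComp {E : List (Sym2 V)} {X : List V} (hX : IsTourWord E X)
    (hd : IsDoubleOccurrence X) (v : V) :
    ∃ Y, IsTourWord E Y ∧ X.Perm Y ∧
      alternanceGraph Y = (alternanceGraph X).localComp v := by
  obtain ⟨a, ha, hE⟩ := hX
  have hv : v ∈ X := List.count_pos_iff.1 (by rw [hd v]; omega)
  obtain ⟨X', hr, hX', hs⟩ := exists_rotation ha (List.mem_cons_of_mem a hv)
  have hd' := hd.perm hr.symm.perm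
  obtain ⟨Z, rfl⟩ := exists_append_singleton_of_endpt hX'
    (by rintro rfl; simpa using hd' v)
  have hvZ : v ∈ Z := List.count_pos_iff.1 (by
    have := hd' v
    simp at this
    omega)
  obtain ⟨q, r, rfl⟩ := List.append_of_mem hvZ
  have step : SegRev v ([] ++ ((q ++ [v]) ++ (r ++ [v])))
      ([] ++ (rv (endpt v []) (q ++ [v]) ++ (r ++ [v]))) := .intro _ _ _ (by simp)
  rw [endpt_nil, rv_append_singleton] at step
  simp only [List.nil_append, List.append_assoc, List.cons_append] at step hs hX' hr hd'
  refine ⟨_, ⟨v, step.endpt_eq ▸ hX', step.steps_perm.symm.trans (hs.trans hE)⟩,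
    hr.symm.perm.trans step.perm, ?_⟩
  have h1 : ∀ p : List V, p ++ v :: (r ++ [v]) ~r v :: p ++ v :: r := by
    intro p
    simpa using List.isRotated_append (l := p ++ v :: r) (l' := [v])
  rw [WordEquiv.alternanceGraph_eq (.inl (h1 _)), ← WordEquiv.alternanceGraph_eq (.inl hr),
    WordEquiv.alternanceGraph_eq (.inl (h1 _))]
  exact alternanceGraph_reverse_between (hd'.perm (h1 _).perm)

/-- The graphs locally equivalent to the alternance graph of a tour are the alternance graphs of
the tours. -/
theorem IsTourWord.locEquiv_iff {E : List (Sym2 V)} {X : List V} (hX : IsTourWord E X)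
    (hd : IsDoubleOccurrence X) {G : SimpleGraph V} :
    (alternanceGraph X).LocEquiv G ↔
      ∃ Y, IsTourWord E Y ∧ IsDoubleOccurrence Y ∧ G = alternanceGraph Y := by
  constructor
  · intro h
    induction h with
    | refl => exact ⟨X, hX, hd, rfl⟩
    | tail _ h ih =>
      obtain ⟨Y, hY, hdY, rfl⟩ := ih
      obtain ⟨v, rfl⟩ := h
      obtain ⟨Z, hZ, hp, e⟩ := hY.exists_localComp hdY v
      exact ⟨Z, hZ, hdY.perm hp, e.symm⟩
  · rintro ⟨Y, hY, -, rfl⟩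
    exact hX.locEquiv hY hd

end Tours

/-! ### Eulerian tours and their words -/

namespace MultiGraph

/-- The end points of the edges of a multigraph, as a list. -/
def endsList {V : Type*} {m : ℕ} (F : MultiGraph V (Fin m)) : List (Sym2 V) :=
  (List.finRange m).map F.ends

theorem length_endsList {V : Type*} {m : ℕ} (F : MultiGraph V (Fin m)) :
    F.endsList.length = m := by
  simp [endsList]

end MultiGraph

section Incidence

variable {V : Type*} [DecidableEq V]

/-- The contribution of an edge with the given end points to the degree of `v`. -/
def incidence (v : V) (e : Sym2 V) : ℕ :=
  (if v ∈ e then 1 else 0) + if e = s(v, v) then 1 else 0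

theorem incidence_mk (v x y : V) :
    incidence v s(x, y) = (if x = v then 1 else 0) + if y = v then 1 else 0 := by
  unfold incidence
  simp only [Sym2.mem_iff, Sym2.eq_iff]
  grind

theorem MultiGraph.degree_eq_sum {m : ℕ} (F : MultiGraph V (Fin m)) (v : V) :
    F.degree v = (F.endsList.map (incidence v)).sum := by
  rw [MultiGraph.degree, Finset.card_filter, Finset.card_filter, ← Finset.sum_add_distrib,
    Fin.sum_univ_def, MultiGraph.endsList, List.map_map]
  rfl

/-- Every visit of a walk to `v` accounts for two edge ends at `v`. -/
theorem sum_incidence_steps (v a : V) (X : List V) :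
    ((steps a X).map (incidence v)).sum + (if endpt a X = v then 1 else 0) =
      (if a = v then 1 else 0) + 2 * X.count v := by
  induction X generalizing a with
  | nil =>
    rw [endpt_nil]
    simp
  | cons x X ih =>
    have := ih x
    rw [endpt_cons]
    simp only [steps_cons, List.map_cons, List.sum_cons, incidence_mk, List.count_cons,
      beq_iff_eq]
    omega

theorem IsTourWord.sum_incidence {E : List (Sym2 V)} {X : List V} (h : IsTourWord E X) (v : V) :
    (E.map (incidence v)).sum = 2 * X.count v := by
  obtain ⟨a, ha, hE⟩ := h
  have := sum_incidence_steps v a X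
  rw [ha] at this
  rw [← (hE.map _).sum_eq]
  omega

/-- A tour of a `4`-regular multigraph visits every vertex twice. -/
theorem MultiGraph.IsRegular.isDoubleOccurrence {m : ℕ} {F : MultiGraph V (Fin m)}
    (hF : F.IsRegular 4) {X : List V} (h : IsTourWord F.endsList X) : IsDoubleOccurrence X := by
  intro v
  have h1 := h.sum_incidence v
  rw [← F.degree_eq_sum, hF v] at h1
  omega

end Incidence

section TourWords

variable {V : Type*}

theorem steps_ofFn {l : ℕ} (f : Fin (l + 1) → V) :
    steps (f 0) (List.ofFn fun i : Fin l => f i.succ) =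
      List.ofFn fun i : Fin l => s(f i.castSucc, f i.succ) := by
  induction l with
  | zero => simp
  | succ l ih =>
    rw [List.ofFn_succ, List.ofFn_succ, steps_cons]
    congr 1
    exact ih fun i => f i.succ

theorem endpt_ofFn {l : ℕ} (f : Fin (l + 1) → V) :
    endpt (f 0) (List.ofFn fun i : Fin l => f i.succ) = f (Fin.last l) := by
  induction l with
  | zero => simp
  | succ l ih =>
    rw [List.ofFn_succ, endpt_cons]
    exact ih fun i => f i.succ

theorem EulerianTour.isTourWord {m : ℕ} {F : MultiGraph V (Fin m)} (U : EulerianTour F) :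
    IsTourWord F.endsList U.word := by
  refine ⟨U.vert 0, (endpt_ofFn U.vert).trans U.closed, ?_⟩
  have h : (List.ofFn U.edge).Perm (List.finRange m) := by
    refine (List.perm_ext_iff_of_nodup ?_ (List.nodup_finRange m)).2 fun e => ?_
    · exact List.nodup_ofFn.2 U.edge_bijective.1
    · simpa [List.mem_ofFn] using U.edge_bijective.2 e
  have h2 := h.map F.ends
  rw [List.map_ofFn] at h2
  refine (List.Perm.of_eq ?_).trans h2
  rw [EulerianTour.word, steps_ofFn U.vert]
  congr 1
  funext i
  exact (U.ends_edge i).symm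

theorem getElem_steps {a : V} {X : List V} {i : ℕ} (h : i < X.length) :
    (steps a X)[i]'(by rwa [length_steps]) =
      s((a :: X)[i]'(by simp; omega), (a :: X)[i + 1]'(by simpa using h)) := by
  induction X generalizing a i with
  | nil => simp at h
  | cons x X ih =>
    cases i with
    | zero => simp
    | succ i =>
      have := ih (a := x) (i := i) (by simpa using h)
      simpa using this

theorem endpt_eq_getElem (a : V) (X : List V) : endpt a X = (a :: X)[X.length] := by
  induction X generalizing a with
  | nil => rfl
  | cons x X ih => simpa using ih x

/-- Walks whose edges agree with those of `F` as pairs of end points come from Eulerian tours;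
parallel edges may be used in any order. -/
theorem IsTourWord.exists_eulerianTour {m : ℕ} {F : MultiGraph V (Fin m)} {X : List V}
    (h : IsTourWord F.endsList X) : ∃ U : EulerianTour F, U.word = X := by
  obtain ⟨a, ha, hE⟩ := h
  obtain ⟨es, hs, hes⟩ : Relation.Comp (· = List.map F.ends ·) List.Perm (steps a X)
      (List.finRange m) := by
    rw [List.eq_map_comp_perm]
    exact hE
  have hl : es.length = X.length := by
    rw [← length_steps a X, hs, List.length_map]
  refine ⟨⟨X.length, fun i => (a :: X)[i.1]'(by simp; omega), fun i => es[i.1]'(by omega),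
    ?_, ?_, ?_⟩, ?_⟩
  · intro i
    have := getElem_steps (a := a) (X := X) i.2
    simp only [hs, List.getElem_map] at this
    exact this
  · exact (endpt_eq_getElem a X).symm.trans ha
  · have hn : es.Nodup := hes.nodup_iff.2 (List.nodup_finRange m)
    refine ⟨fun i j hij => Fin.ext ((hn.getElem_inj_iff).1 hij), fun e => ?_⟩
    have he : e ∈ es := hes.mem_iff.2 (List.mem_finRange e)
    obtain ⟨i, hi, rfl⟩ := List.getElem_of_mem he
    exact ⟨⟨i, by omega⟩, rfl⟩
  · refine List.ext_getElem (by simp [EulerianTour.word]) fun i h1 h2 => ?_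
    simp [EulerianTour.word]

end TourWords

/-! ### Soets and complete subgraphs of alternance graphs -/

section Soets

variable {V : Type*} [DecidableEq V]

/-- A word is determined by its subwords formed by two letters. -/
theorem eq_of_filter_pair_eq {P Q : List V}
    (h : ∀ x y, (P.filter fun z => z = x ∨ z = y) = Q.filter fun z => z = x ∨ z = y) : P = Q := by
  induction P generalizing Q with
  | nil =>
    cases Q with
    | nil => rfl
    | cons q Q => simpa using h q q
  | cons p P ih =>
    cases Q with
    | nil => simpa using h p p
    | cons q Q =>
      obtain rfl : p = q := by
        have := h p q
        rw [List.filter_cons_of_pos (by simp), List.filter_cons_of_pos (by simp)] at this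
        exact (List.cons.inj this).1
      congr 1
      refine ih fun x y => ?_
      have := h x y
      by_cases hp : p = x ∨ p = y
      · rw [List.filter_cons_of_pos (by simpa using hp),
          List.filter_cons_of_pos (by simpa using hp)] at this
        exact (List.cons.inj this).2
      · rwa [List.filter_cons_of_neg (by simpa using hp),
          List.filter_cons_of_neg (by simpa using hp)] at this

theorem filter_pair_eq_replicate {P : List V} {x y : V} (h : x = y ∨ P.count x = 0) :
    (P.filter fun z => z = x ∨ z = y) = List.replicate (P.count y) y := by
  rw [← List.filter_eq]
  refine List.filter_congr fun z hz => ?_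
  rcases h with rfl | h
  · simp [eq_comm]
  · have : z ≠ x := by
      rintro rfl
      exact List.count_eq_zero.1 h hz
    simp [this, eq_comm]

theorem alternance_of_filter_eq_append {X s : List V} {W : Finset V} (hs : ∀ v, v ∈ s ↔ v ∈ W)
    (hX : X.filter (· ∈ W) = s ++ s) {u v : V} (hu : u ∈ W) (hv : v ∈ W) (huv : u ≠ v) :
    (alternanceGraph X).Adj u v := by
  have key : ∀ u v : V, u ≠ v → [u, v].Sublist s → (alternanceGraph X).Adj u v :=
    fun u v huv h => ⟨huv, X, .refl X,
      (hX ▸ h.append h : [u, v, u, v].Sublist (X.filter (· ∈ W))).trans List.filter_sublist⟩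
  obtain ⟨p, q, rfl⟩ := List.append_of_mem ((hs u).2 hu)
  rcases List.mem_append.1 ((hs v).2 hv) with h | h
  · refine (key v u huv.symm ?_).symm
    exact (List.singleton_sublist.2 h).append (List.singleton_sublist.2 (by simp) : [u].Sublist _)
  · refine key u v huv ?_
    have h' : v ∈ q := by simpa [huv.symm] using h
    exact ((List.singleton_sublist.2 h').cons_cons u).trans (List.sublist_append_right p _)

/-- If any two letters in `W` alternate, then the subword formed by these letters is a square. -/
theorem exists_filter_eq_append {X : List V} (hd : IsDoubleOccurrence X) {W : Finset V}
    (h : ∀ u ∈ W, ∀ v ∈ W, u ≠ v → (alternanceGraph X).Adj u v) :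
    ∃ s : List V, s.Nodup ∧ (∀ v, v ∈ s ↔ v ∈ W) ∧ X.filter (· ∈ W) = s ++ s := by
  have hmem : ∀ v, v ∈ X.filter (· ∈ W) ↔ v ∈ W := by
    intro v
    have : v ∈ X := List.count_pos_iff.1 (by rw [hd v]; omega)
    simp [this]
  have hcount : ∀ v ∈ W, (X.filter (· ∈ W)).count v = 2 := by
    intro v hv
    rw [List.count_filter (by simpa using hv), hd v]
  have hpair : ∀ u ∈ W, ∀ v ∈ W, u ≠ v →
      (((X.filter (· ∈ W)).filter fun x => x = u ∨ x = v) = [u, v, u, v] ∨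
        ((X.filter (· ∈ W)).filter fun x => x = u ∨ x = v) = [v, u, v, u]) := by
    intro u hu v hv huv
    have := ((isAlternance_iff (hd u) (hd v)).1 (h u hu v hv huv)).2
    have e : ((X.filter (· ∈ W)).filter fun x => x = u ∨ x = v) =
        X.filter fun x => x = u ∨ x = v := by
      rw [List.filter_filter]
      refine List.filter_congr fun x _ => ?_
      by_cases hx : x = u ∨ x = v
      · rcases hx with rfl | rfl <;> simp [hu, hv]
      · simp [hx]
    rwa [e]
  generalize X.filter (· ∈ W) = Y at hmem hcount hpair ⊢
  cases Y with
  | nil => exact ⟨[], by simp, by simpa using hmem, rfl⟩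
  | cons a Y =>
    have ha : a ∈ W := (hmem a).1 (by simp)
    have haY : a ∈ Y := by
      have := hcount a ha
      rw [List.count_cons_self] at this
      exact List.count_pos_iff.1 (by omega)
    obtain ⟨P, Q, rfl⟩ := List.append_of_mem haY
    have haPQ : P.count a = 0 ∧ Q.count a = 0 := by
      have := hcount a ha
      simp only [List.count_cons_self, List.count_append] at this
      omega
    -- The two parts between the occurrences of `a` contain every other letter once.
    have hone : ∀ x ∈ W, x ≠ a → P.count x = 1 ∧ Q.count x = 1 := by
      intro x hx hxa
      have hf := hpair a ha x hx hxa.symm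
      rw [List.filter_cons_of_pos (by simp), List.filter_append,
        List.filter_cons_of_pos (by simp)] at hf
      have h1 : a ∉ P.filter fun z => z = a ∨ z = x := fun h =>
        List.count_eq_zero.1 haPQ.1 (List.mem_filter.1 h).1
      rw [← List.count_filter (l := P) (p := fun z => z = a ∨ z = x) (by simp),
        ← List.count_filter (l := Q) (p := fun z => z = a ∨ z = x) (by simp)]
      generalize P.filter (fun z => decide (z = a ∨ z = x)) = P' at hf h1 ⊢
      generalize Q.filter (fun z => decide (z = a ∨ z = x)) = Q' at hf ⊢
      have hxa' := hxa.symm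
      rcases P' with _ | ⟨p₁, _ | ⟨p₂, P'⟩⟩
      · simp [hxa'] at hf
      · simp only [List.cons_append, List.nil_append, List.cons.injEq, true_and, hxa',
          false_and, or_false] at hf
        simp [hf.1, hf.2]
      · simp [hxa'] at hf h1
        grind
    have hzero : ∀ x ∉ W, P.count x = 0 ∧ Q.count x = 0 := by
      intro x hx
      have := mt (hmem x).1 hx
      simp only [List.mem_cons, List.mem_append, not_or] at this
      exact ⟨List.count_eq_zero.2 this.2.1, List.count_eq_zero.2 this.2.2.2⟩
    have hcnt : ∀ x, P.count x = Q.count x ∧ P.count x ≤ 1 := by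
      intro x
      by_cases hx : x ∈ W
      · by_cases hxa : x = a
        · subst hxa; omega
        · have := hone x hx hxa; omega
      · have := hzero x hx; omega
    have hPQ : P = Q := by
      refine eq_of_filter_pair_eq fun x y => ?_
      have hcomm : ∀ l : List V, (l.filter fun z => z = x ∨ z = y) =
          l.filter fun z => z = y ∨ z = x := by simp only [or_comm, implies_true]
      have hgood : ∀ z, P.count z ≠ 0 → z ∈ W ∧ z ≠ a := fun z hz =>
        ⟨by_contra fun h => hz (hzero z h).1, by rintro rfl; exact hz haPQ.1⟩
      by_cases h₁ : x = y ∨ P.count x = 0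
      · rw [filter_pair_eq_replicate h₁, filter_pair_eq_replicate (by rwa [← (hcnt x).1]),
          (hcnt y).1]
      by_cases h₂ : P.count y = 0
      · rw [hcomm, hcomm, filter_pair_eq_replicate (.inr h₂),
          filter_pair_eq_replicate (.inr (by rwa [← (hcnt y).1])), (hcnt x).1]
      push Not at h₁
      obtain ⟨hx, hxa⟩ := hgood x h₁.2
      obtain ⟨hy, hya⟩ := hgood y h₂
      have hf := hpair x hx y hy h₁.1
      rw [List.filter_cons_of_neg (by simp [hxa.symm, hya.symm]), List.filter_append,
        List.filter_cons_of_neg (by simp [hxa.symm, hya.symm])] at hf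
      have hl := length_filter_pair h₁.1 P
      rw [(hone x hx hxa).1, (hone y hy hya).1] at hl
      rcases hf with hf | hf
      · obtain ⟨h1, h2⟩ := List.append_inj (s₂ := [x, y]) (t₂ := [x, y]) hf hl
        rw [h1, h2]
      · obtain ⟨h1, h2⟩ := List.append_inj (s₂ := [y, x]) (t₂ := [y, x]) hf hl
        rw [h1, h2]
    subst hPQ
    refine ⟨a :: P, ?_, ?_, rfl⟩
    · rw [List.nodup_cons]
      exact ⟨List.count_eq_zero.1 haPQ.1, List.nodup_iff_count_le_one.2 fun x => (hcnt x).2⟩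
    · intro v
      rw [← hmem v]
      simp only [List.mem_cons, List.mem_append]
      tauto

theorem EulerianTour.isSoet_iff {m : ℕ} {F : MultiGraph V (Fin m)} (hF : F.IsRegular 4)
    (U : EulerianTour F) (W : Finset V) :
    U.IsSoet W ↔ (alternanceGraph U.word).induce (W : Set V) = ⊤ := by
  have hd := hF.isDoubleOccurrence U.isTourWord
  constructor
  · rintro ⟨s, -, hs, hX⟩
    ext ⟨u, hu⟩ ⟨v, hv⟩
    simp only [SimpleGraph.comap_adj, Function.Embedding.subtype_apply, SimpleGraph.top_adj, ne_eq,
      Subtype.mk.injEq]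
    exact ⟨fun h => h.ne, fun h => alternance_of_filter_eq_append hs hX hu hv h⟩
  · intro h
    refine exists_filter_eq_append hd fun u hu v hv huv => ?_
    have : ((alternanceGraph U.word).induce (W : Set V)).Adj ⟨u, hu⟩ ⟨v, hv⟩ := by
      rw [h]
      simpa using huv
    exact this

/-- The multigraph `F` has a Soet with respect to `W` if and only if the alternance graph of one of
its tours has a star on `W` as a vertex-minor. -/
theorem exists_isSoet_iff [Finite V] {m : ℕ} {F : MultiGraph V (Fin m)} (hF : F.IsRegular 4)
    (T : EulerianTour F) (W : Finset V) :
    (∃ U : EulerianTour F, U.IsSoet W) ↔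
      ∃ S : SimpleGraph (W : Set V), IsStar S ∧
        VertexMinor (alternanceGraph T.word) (W : Set V) S := by
  rw [exists_star_vertexMinor_iff]
  constructor
  · rintro ⟨U, hU⟩
    exact ⟨_, T.isTourWord.locEquiv U.isTourWord (hF.isDoubleOccurrence T.isTourWord),
      (U.isSoet_iff hF W).1 hU⟩
  · rintro ⟨G, hG, e⟩
    obtain ⟨Y, hY, -, rfl⟩ :=
      (T.isTourWord.locEquiv_iff (hF.isDoubleOccurrence T.isTourWord)).1 hG
    obtain ⟨U, rfl⟩ := hY.exists_eulerianTour
    exact ⟨U, (U.isSoet_iff hF W).2 e⟩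

end Soets

/-! ### Stars -/

theorem isStar_starOn (k : ℕ) : IsStar (starOn k) := by
  cases k with
  | zero => exact .inr inferInstance
  | succ k => exact .inl ⟨0, rfl⟩

theorem nonempty_iso_starOn_iff {V : Type*} {k : ℕ} [Finite V] (S : SimpleGraph V) :
    Nonempty (starOn k ≃g S) ↔ IsStar S ∧ Nat.card V = k := by
  constructor
  · rintro ⟨e⟩
    refine ⟨?_, by simpa using (Nat.card_congr e.toEquiv).symm⟩
    cases k with
    | zero => exact .inr (e.toEquiv.symm.isEmpty)
    | succ k =>
      refine .inl ⟨e 0, ?_⟩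
      ext x y
      obtain ⟨x, rfl⟩ := e.surjective x
      obtain ⟨y, rfl⟩ := e.surjective y
      rw [e.map_adj_iff]
      have he : Function.Injective e := e.injective
      simp only [starOn, SimpleGraph.starGraph_adj]
      exact he.ne_iff.symm.and (he.eq_iff.symm.or he.eq_iff.symm)
  · rintro ⟨hS, hk⟩
    have e := Finite.equivFinOfCardEq hk
    cases k with
    | zero =>
      have := e.isEmpty
      exact ⟨e.symm, fun {x} => x.elim0⟩
    | succ k =>
      rcases hS with ⟨r, rfl⟩ | hV
      · classical
        obtain ⟨g, rfl⟩ : ∃ g : Fin (k + 1) ≃ V, g 0 = r :=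
          ⟨e.symm.trans (Equiv.swap (e.symm 0) r), by simp⟩
        exact ⟨g, fun {x y} => by
          simp only [starOn, SimpleGraph.starGraph_adj, ne_eq, Equiv.apply_eq_iff_eq]⟩
      · exact hV.elim (e.symm 0)

theorem exists_iso_starOn_vertexMinor_iff {V : Type*} [Finite V] (G : SimpleGraph V) (k : ℕ) :
    (∃ (W : Set V) (H : SimpleGraph W), Nonempty (starOn k ≃g H) ∧ VertexMinor G W H) ↔
      ∃ W : Finset V, W.card = k ∧
        ∃ S : SimpleGraph (W : Set V), IsStar S ∧ VertexMinor G (W : Set V) S := by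
  constructor
  · rintro ⟨W, H, hH, h⟩
    obtain ⟨W, rfl⟩ : ∃ W' : Finset V, (W' : Set V) = W := (Set.toFinite W).exists_finset_coe
    obtain ⟨h1, h2⟩ := (nonempty_iso_starOn_iff H).1 hH
    exact ⟨W, by simpa using h2, H, h1, h⟩
  · rintro ⟨W, hW, S, hS, h⟩
    exact ⟨W, S, (nonempty_iso_starOn_iff S).2 ⟨hS, by simpa using hW⟩, h⟩

namespace StackMachine

open Turing TM2

/-! ### Running time of stack machines -/

/-- The partial map `f`, iterated at most `t` times, leads from `a` to `b`. -/
def Reach {C : Type*} (f : C → Option C) (a b : C) (t : ℕ) : Prop :=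
  ∃ n ≤ t, (flip bind f)^[n] (some a) = some b

theorem Reach.trans {C : Type*} {f : C → Option C} {a b c : C} {s t : ℕ}
    (h₁ : Reach f a b s) (h₂ : Reach f b c t) : Reach f a c (s + t) := by
  obtain ⟨m, hm, h₁⟩ := h₁
  obtain ⟨n, hn, h₂⟩ := h₂
  exact ⟨n + m, by omega, by rw [Function.iterate_add_apply, h₁, h₂]⟩

theorem Reach.mono {C : Type*} {f : C → Option C} {a b : C} {s t : ℕ}
    (h : Reach f a b s) (hst : s ≤ t) : Reach f a b t := by
  obtain ⟨m, hm, h⟩ := h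
  exact ⟨m, hm.trans hst, h⟩

theorem Reach.single {C : Type*} {f : C → Option C} {a b : C} (h : f a = some b) :
    Reach f a b 1 := ⟨1, le_rfl, h⟩

theorem Reach.head {C : Type*} {f : C → Option C} {a b c : C} {t : ℕ} (h : f a = some b)
    (h' : Reach f b c t) : Reach f a c (t + 1) :=
  ((Reach.single h).trans h').mono (by omega)

/-! ### Embedding one stack machine into another -/

section Lift

variable {K K' : Type} {Γ' : K' → Type} {Λ Λ' σ σ' : Type}

/-- A statement of a machine whose stacks are embedded by `ι`, whose states are embedded by `put`
with retraction `get`, and whose labels are mapped by `lab`, as a statement of the larger machine.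
Halting is replaced by a jump to `exit`, or kept if `exit` is `none`. -/
def liftStmt (ι : K → K') (get : σ' → σ) (put : σ → σ') (lab : Λ → Λ') (exit : Option Λ') :
    Stmt (fun k => Γ' (ι k)) Λ σ → Stmt Γ' Λ' σ'
  | .push k f q => .push (ι k) (fun v => f (get v)) (liftStmt ι get put lab exit q)
  | .peek k f q => .peek (ι k) (fun v a => put (f (get v) a)) (liftStmt ι get put lab exit q)
  | .pop k f q => .pop (ι k) (fun v a => put (f (get v) a)) (liftStmt ι get put lab exit q)
  | .load f q => .load (fun v => put (f (get v))) (liftStmt ι get put lab exit q)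
  | .branch f p q => .branch (fun v => f (get v)) (liftStmt ι get put lab exit p)
      (liftStmt ι get put lab exit q)
  | .goto f => .goto fun v => lab (f (get v))
  | .halt => match exit with
    | some l => .goto fun _ => l
    | none => .halt

/-- The configuration `c'` of the larger machine represents the configuration `c`; the stacks that
are not in the range of `ι` hold the contents prescribed by `S₀`. -/
structure LiftRel (ι : K → K') (put : σ → σ') (lab : Λ → Λ') (exit : Option Λ')
    (S₀ : ∀ k, List (Γ' k)) (c : Cfg (fun k => Γ' (ι k)) Λ σ) (c' : Cfg Γ' Λ' σ') : Prop where
  label : c'.l = (c.l.map lab).or exit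
  var : c'.var = put c.var
  stk : ∀ k, c'.stk (ι k) = c.stk k
  off : ∀ k, k ∉ Set.range ι → c'.stk k = S₀ k

variable [DecidableEq K] [DecidableEq K'] {ι : K → K'} {get : σ' → σ} {put : σ → σ'}
  {lab : Λ → Λ'} {exit : Option Λ'} {S₀ : ∀ k, List (Γ' k)}

theorem liftRel_stepAux (hι : Function.Injective ι) (hget : ∀ v, get (put v) = v)
    (q : Stmt (fun k => Γ' (ι k)) Λ σ) : ∀ (v : σ) (S : ∀ k, List (Γ' (ι k)))
    (S' : ∀ k, List (Γ' k)), (∀ k, S' (ι k) = S k) → (∀ k, k ∉ Set.range ι → S' k = S₀ k) →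
      LiftRel ι put lab exit S₀ (stepAux q v S)
        (stepAux (liftStmt ι get put lab exit q) (put v) S') := by
  have key : ∀ (k : K) (x : List (Γ' (ι k))) (S : ∀ k, List (Γ' (ι k)))
      (S' : ∀ k, List (Γ' k)), (∀ k, S' (ι k) = S k) → (∀ k, k ∉ Set.range ι → S' k = S₀ k) →
      (∀ j, Function.update S' (ι k) x (ι j) = Function.update S k x j) ∧
      (∀ j, j ∉ Set.range ι → Function.update S' (ι k) x j = S₀ j) := by
    intro k x S S' hS hoff
    constructor
    · intro j
      by_cases h : j = k
      · subst h; simp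
      · rw [Function.update_of_ne h, Function.update_of_ne (hι.ne h), hS]
    · intro j hj
      rw [Function.update_of_ne, hoff j hj]
      rintro rfl
      exact hj ⟨k, rfl⟩
  induction q with
  | push k f q ih =>
    intro v S S' hS hoff
    obtain ⟨h1, h2⟩ := key k (f v :: S k) S S' hS hoff
    simp only [liftStmt, stepAux, hget, hS]
    exact ih _ _ _ h1 h2
  | peek k f q ih =>
    intro v S S' hS hoff
    simp only [liftStmt, stepAux, hget, hS]
    exact ih _ _ _ hS hoff
  | pop k f q ih =>
    intro v S S' hS hoff
    obtain ⟨h1, h2⟩ := key k (S k).tail S S' hS hoff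
    simp only [liftStmt, stepAux, hget, hS]
    exact ih _ _ _ h1 h2
  | load f q ih =>
    intro v S S' hS hoff
    simp only [liftStmt, stepAux, hget]
    exact ih _ _ _ hS hoff
  | branch f p q ihp ihq =>
    intro v S S' hS hoff
    simp only [liftStmt, stepAux, hget]
    cases f v
    · exact ihq _ _ _ hS hoff
    · exact ihp _ _ _ hS hoff
  | goto f =>
    intro v S S' hS hoff
    simp only [liftStmt, stepAux, hget]
    exact ⟨rfl, rfl, hS, hoff⟩
  | halt =>
    intro v S S' hS hoff
    cases exit <;> exact ⟨rfl, rfl, hS, hoff⟩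

theorem iterate_bind_none {C : Type*} (f : C → Option C) (n : ℕ) :
    (flip bind f)^[n] none = none := by
  induction n with
  | zero => rfl
  | succ n ih => rw [Function.iterate_succ_apply]; exact ih

/-- A halting run of a machine is a run, of the same length, of a larger machine that contains the
code of the first one. -/
theorem Reach.lift {M : Λ → Stmt (fun k => Γ' (ι k)) Λ σ} {M' : Λ' → Stmt Γ' Λ' σ'}
    (hι : Function.Injective ι) (hget : ∀ v, get (put v) = v)
    (hM : ∀ l, M' (lab l) = liftStmt ι get put lab exit (M l)) {l : Λ} {v w : σ}
    {S T : ∀ k, List (Γ' (ι k))} {S' T' : ∀ k, List (Γ' k)} {t : ℕ}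
    (h : Reach (step M) ⟨some l, v, S⟩ ⟨none, w, T⟩ t)
    (hS : ∀ k, S' (ι k) = S k) (hT : ∀ k, T' (ι k) = T k)
    (hoff : ∀ k, k ∉ Set.range ι → T' k = S' k) :
    Reach (step M') ⟨some (lab l), put v, S'⟩ ⟨exit, put w, T'⟩ t := by
  obtain ⟨n, hn, h⟩ := h
  refine ⟨n, hn, ?_⟩
  have key : ∀ (n : ℕ) (c d : Cfg (fun k => Γ' (ι k)) Λ σ) (c' : Cfg Γ' Λ' σ'),
      (flip bind (step M))^[n] (some c) = some d → LiftRel ι put lab exit S' c c' →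
      ∃ d', (flip bind (step M'))^[n] (some c') = some d' ∧
        LiftRel ι put lab exit S' d d' := by
    intro n
    induction n with
    | zero =>
      intro c d c' h hr
      obtain rfl : c = d := by simpa using h
      exact ⟨c', rfl, hr⟩
    | succ n ih =>
      rintro ⟨_ | l, v, S⟩ d ⟨l', v', R'⟩ h ⟨h1, h2, h3, h4⟩
      · rw [Function.iterate_succ_apply] at h
        change (flip bind (step M))^[n] none = some d at h
        rw [iterate_bind_none] at h
        exact absurd h (by simp)
      · simp only [Option.map_some, Option.some_or] at h1 h2 h3 h4
        subst h1 h2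
        have := liftRel_stepAux (lab := lab) (exit := exit) hι hget (M l) v S R' h3 h4
        rw [← hM] at this
        obtain ⟨d', hd, hr⟩ := ih _ d _ h this
        exact ⟨d', hd, hr⟩
  obtain ⟨⟨l', v', R'⟩, hd, h1, h2, h3, h4⟩ := key n _ _ ⟨some (lab l), put v, S'⟩ h
    ⟨rfl, rfl, hS, fun _ _ => rfl⟩
  rw [hd]
  simp only [Option.map_none, Option.none_or] at h1 h2 h3 h4
  subst h1 h2
  congr 2
  funext k
  by_cases hk : k ∈ Set.range ι
  · obtain ⟨k, rfl⟩ := hk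
    rw [h3, hT]
  · rw [h4 k hk, hoff k hk]

end Lift

/-! ### Composition of polynomial-time machines -/

/-- The number of `push` instructions in a statement. -/
def pushCount {K : Type} {Γ : K → Type} {Λ σ : Type} : Stmt Γ Λ σ → ℕ
  | .push _ _ q => pushCount q + 1
  | .peek _ _ q => pushCount q
  | .pop _ _ q => pushCount q
  | .load _ q => pushCount q
  | .branch _ p q => pushCount p + pushCount q
  | .goto _ => 0
  | .halt => 0

theorem length_stepAux_le {K : Type} [DecidableEq K] {Γ : K → Type} {Λ σ : Type}
    (q : Stmt Γ Λ σ) (k : K) : ∀ (v : σ) (S : ∀ k, List (Γ k)),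
      ((stepAux q v S).stk k).length ≤ (S k).length + pushCount q := by
  induction q with
  | push j f q ih =>
    intro v S
    refine (ih _ _).trans ?_
    by_cases h : k = j
    · subst h; simp [pushCount, Nat.add_assoc, Nat.add_comm]
    · simp [pushCount, Function.update_of_ne h, ← Nat.add_assoc]
  | pop j f q ih =>
    intro v S
    refine (ih _ _).trans ?_
    by_cases h : k = j
    · subst h; simp [pushCount]
    · simp [pushCount, Function.update_of_ne h]
  | peek j f q ih => intro v S; exact ih _ _
  | load f q ih => intro v S; exact ih _ _
  | branch f p q ihp ihq =>
    intro v S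
    simp only [stepAux, pushCount]
    cases f v
    · exact (ihq _ _).trans (by omega)
    · exact (ihp _ _).trans (by omega)
  | goto f => intro v S; simp [pushCount]
  | halt => intro v S; simp [pushCount]

theorem length_le_of_iterate {K : Type} [DecidableEq K] {Γ : K → Type} {Λ σ : Type}
    (M : Λ → Stmt Γ Λ σ) (B : ℕ) (hB : ∀ l, pushCount (M l) ≤ B) (k : K) (n : ℕ) :
    ∀ c d : Cfg Γ Λ σ, (flip bind (step M))^[n] (some c) = some d →
      (d.stk k).length ≤ (c.stk k).length + n * B := by
  induction n with
  | zero => intro c d h; obtain rfl : c = d := by simpa using h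
            simp
  | succ n ih =>
    rintro ⟨_ | l, v, S⟩ d h
    · rw [Function.iterate_succ_apply] at h
      change (flip bind (step M))^[n] none = some d at h
      rw [iterate_bind_none] at h
      exact absurd h (by simp)
    · have h1 := ih _ d h
      have h2 := length_stepAux_le (M l) k v S
      have h3 := hB l
      rw [Nat.add_mul]
      simp only at *
      omega

/-- The stacks that are empty, except that the stack `i` contains `x`. -/
def single {K : Type} [DecidableEq K] {Γ : K → Type} (i : K) (x : List (Γ i)) :
    ∀ k, List (Γ k) :=
  Function.update (fun _ => []) i x

theorem single_self {K : Type} [DecidableEq K] {Γ : K → Type} (i : K) (x : List (Γ i)) :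
    single i x i = x :=
  Function.update_self ..

theorem single_of_ne {K : Type} [DecidableEq K] {Γ : K → Type} {i k : K} (h : k ≠ i)
    (x : List (Γ i)) : single i x k = [] :=
  Function.update_of_ne h ..

theorem initList_eq (tm : FinTM2) (s : List (tm.Γ tm.k₀)) :
    initList tm s = ⟨some tm.main, tm.initialState, single tm.k₀ s⟩ := by
  unfold initList
  congr 1
  funext k
  by_cases h : k = tm.k₀
  · subst h; simp [single_self]
  · simp [h, single_of_ne h]

theorem haltList_eq (tm : FinTM2) (s : List (tm.Γ tm.k₁)) :
    haltList tm s = ⟨none, tm.initialState, single tm.k₁ s⟩ := by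
  unfold haltList
  congr 1
  funext k
  by_cases h : k = tm.k₁
  · subst h; simp [single_self]
  · simp [h, single_of_ne h]

theorem eval_mono (p : Polynomial ℕ) {a b : ℕ} (h : a ≤ b) : p.eval a ≤ p.eval b := by
  rw [Polynomial.eval_eq_sum, Polynomial.eval_eq_sum]
  exact Finset.sum_le_sum fun i _ => Nat.mul_le_mul_left _ (Nat.pow_le_pow_left h i)

/-- A loop that pops the symbols of the stack `i` and pushes their images under `c` to the
stack `j`. -/
theorem reach_transfer {K Λ σ : Type} [DecidableEq K] {Γ : K → Type} {M : Λ → Stmt Γ Λ σ}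
    {i j : K} (hij : i ≠ j) {l l' : Λ} {c : Γ i → Γ j} {P : σ → Option (Γ i) → σ} {Q : σ → Bool}
    {W : σ → Γ j} (hM : M l = .pop i P (.branch Q (.push j W (.goto fun _ => l))
      (.goto fun _ => l'))) (hP : ∀ v a b, P (P v a) b = P v b)
    (hQ : ∀ v a, Q (P v a) = a.isSome) (hW : ∀ v a, W (P v (some a)) = c a) (x : List (Γ i)) :
    ∀ (v : σ) (S T : ∀ k, List (Γ k)), S i = x → T i = [] →
      T j = (x.map c).reverse ++ S j → (∀ k, k ≠ i → k ≠ j → T k = S k) →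
      Reach (step M) ⟨some l, v, S⟩ ⟨some l', P v none, T⟩ (x.length + 1) := by
  induction x with
  | nil =>
    intro v S T hS hTi hTj hT
    refine Reach.single ?_
    simp only [step, hM, stepAux, hS, hQ, List.head?_nil, Option.isSome_none, cond_false,
      List.tail_nil]
    congr 2
    funext k
    by_cases hi : k = i
    · subst hi; simp [hTi]
    · rw [Function.update_of_ne hi]
      by_cases hj : k = j
      · subst hj; simpa using hTj.symm
      · exact (hT k hi hj).symm
  | cons a x ih =>
    intro v S T hS hTi hTj hT
    have := ih (P v (some a)) (Function.update (Function.update S i x) j (c a :: S j)) T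
      (by simp [hij]) hTi (by simp [hTj]) (fun k hi hj => by simp [hi, hj, hT k hi hj])
    rw [hP] at this
    refine Reach.head ?_ this
    simp only [step, hM, stepAux, hS, hQ, List.head?_cons, Option.isSome_some, cond_true,
      List.tail_cons, hW, Function.update_of_ne hij.symm]

section Comp

variable (M₁ M₂ : FinTM2) {β : Type} (e₁ : M₁.Γ M₁.k₁ ≃ β)
  (e₂ : M₂.Γ M₂.k₀ ≃ β)

/-- The stack alphabets of the composition of two machines: the stacks of both, and an auxiliary
stack for the transfer of the intermediate result. -/
abbrev CompΓ (β : Type) : (M₁.K ⊕ M₂.K) ⊕ Unit → Type :=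
  Sum.elim (Sum.elim M₁.Γ M₂.Γ) fun _ => β

/-- The program of the composition of two machines: when the first one halts, its output is moved
to the auxiliary stack (which reverses it), from there to the input stack of the second one (which
restores the order), and then the second one runs. -/
def compProg [Inhabited β] : M₁.Λ ⊕ M₂.Λ ⊕ Bool →
    Stmt (CompΓ M₁ M₂ β) (M₁.Λ ⊕ M₂.Λ ⊕ Bool) (M₁.σ × M₂.σ × Option β)
  | .inl l => liftStmt (Γ' := CompΓ M₁ M₂ β) (fun k => .inl (.inl k)) (fun v => v.1)
      (fun v => (v, M₂.initialState, none)) .inl (some (.inr (.inr false))) (M₁.m l)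
  | .inr (.inl l) => liftStmt (Γ' := CompΓ M₁ M₂ β) (fun k => .inl (.inr k)) (fun v => v.2.1)
      (fun v => (M₁.initialState, v, none)) (fun l => .inr (.inl l)) none (M₂.m l)
  | .inr (.inr false) =>
      .pop (.inl (.inl M₁.k₁)) (fun v a => (v.1, v.2.1, Option.map e₁ a)) <|
      .branch (fun v => v.2.2.isSome)
        (.push (.inr ()) (fun v => v.2.2.getD default) <| .goto fun _ => .inr (.inr false))
        (.goto fun _ => .inr (.inr true))
  | .inr (.inr true) =>
      .pop (.inr ()) (fun v a => (v.1, v.2.1, a)) <|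
      .branch (fun v => v.2.2.isSome)
        (.push (.inl (.inr M₂.k₀)) (fun v => e₂.symm (v.2.2.getD default)) <|
          .goto fun _ => .inr (.inr true))
        (.goto fun _ => .inr (.inl M₂.main))

/-- The composition of two machines. -/
def compMachine [Fintype β] [Inhabited β] : FinTM2 :=
  letI := M₁.kFin
  letI := M₂.kFin
  letI := M₁.ΛFin
  letI := M₂.ΛFin
  letI := M₁.σFin
  letI := M₂.σFin
  { K := (M₁.K ⊕ M₂.K) ⊕ Unit
    k₀ := .inl (.inl M₁.k₀)
    k₁ := .inl (.inr M₂.k₁)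
    Γ := CompΓ M₁ M₂ β
    Λ := M₁.Λ ⊕ M₂.Λ ⊕ Bool
    main := .inl M₁.main
    σ := M₁.σ × M₂.σ × Option β
    initialState := (M₁.initialState, M₂.initialState, none)
    Γk₀Fin := M₁.Γk₀Fin
    m := compProg M₁ M₂ e₁ e₂ }

variable {M₁ M₂}

/-- The stacks of the composed machine, given by those of the two parts and the auxiliary one. -/
def joinStk (S₁ : ∀ k, List (M₁.Γ k)) (S₂ : ∀ k, List (M₂.Γ k)) (y : List β) :
    ∀ k, List (CompΓ M₁ M₂ β k)
  | .inl (.inl k) => S₁ k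
  | .inl (.inr k) => S₂ k
  | .inr _ => y

theorem single_left (i : M₁.K) (x : List (M₁.Γ i)) :
    single (Γ := CompΓ M₁ M₂ β) (.inl (.inl i)) x = joinStk (single i x) (fun _ => []) [] := by
  funext k
  rcases k with (k | k) | k
  · by_cases h : k = i
    · subst h; exact (single_self ..).trans (single_self (Γ := M₁.Γ) k x).symm
    · exact (single_of_ne (by simpa using h) _).trans (single_of_ne (Γ := M₁.Γ) h x).symm
  · exact single_of_ne (by intro h; cases h) _
  · exact single_of_ne (by intro h; cases h) _

theorem single_right (i : M₂.K) (x : List (M₂.Γ i)) :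
    single (Γ := CompΓ M₁ M₂ β) (.inl (.inr i)) x = joinStk (fun _ => []) (single i x) [] := by
  funext k
  rcases k with (k | k) | k
  · exact single_of_ne (by simp) _
  · by_cases h : k = i
    · subst h; exact (single_self ..).trans (single_self (Γ := M₂.Γ) k x).symm
    · exact (single_of_ne (by simpa using h) _).trans (single_of_ne (Γ := M₂.Γ) h x).symm
  · exact single_of_ne (by intro h; cases h) _

end Comp

/-- Functions that are computable in polynomial time are closed under composition. -/
theorem polyTime_comp {α β γ αΓ βΓ γΓ : Type} [Inhabited βΓ] {eα : α → List αΓ}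
    {eβ : β → List βΓ} {eγ : γ → List γΓ} {f : α → β} {g : β → γ}
    (h₁ : TM2ComputableInPolyTime eα eβ f) (h₂ : TM2ComputableInPolyTime eβ eγ g) :
    Nonempty (TM2ComputableInPolyTime eα eγ (g ∘ f)) := by
  classical
  obtain ⟨⟨M₁, i₁, o₁⟩, t₁, H₁⟩ := h₁
  obtain ⟨⟨M₂, i₂, o₂⟩, t₂, H₂⟩ := h₂
  simp only at i₁ o₁ i₂ o₂ H₁ H₂
  let : Fintype βΓ := @Fintype.ofEquiv _ _ M₂.Γk₀Fin i₂
  let := M₁.ΛFin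
  -- One step of the first machine writes at most `B` symbols; this bounds the length of its output.
  set B := ∑ l, pushCount (M₁.m l)
  set L : Polynomial ℕ := Polynomial.X + t₁ * Polynomial.C B
  refine ⟨⟨⟨compMachine M₁ M₂ o₁ i₂, i₁, o₂⟩, t₁ + (2 * L + 2) + t₂.comp L, fun a => ?_⟩⟩
  suffices h : Reach (step (compProg M₁ M₂ o₁ i₂))
      (initList (compMachine M₁ M₂ o₁ i₂) ((eα a).map i₁.invFun))
      (haltList (compMachine M₁ M₂ o₁ i₂) ((eγ (g (f a))).map o₂.invFun))
      ((t₁ + (2 * L + 2) + t₂.comp L).eval (eα a).length) by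
    exact ⟨⟨h.choose, h.choose_spec.2⟩, h.choose_spec.1⟩
  obtain ⟨⟨n₁, E₁⟩, hn₁⟩ := H₁ a
  obtain ⟨⟨n₂, E₂⟩, hn₂⟩ := H₂ (f a)
  simp only at hn₁ hn₂
  change _ = some (haltList _ _) at E₁ E₂
  change (flip bind (step M₁.m))^[n₁] (some _) = _ at E₁
  change (flip bind (step M₂.m))^[n₂] (some _) = _ at E₂
  have hlen : (eβ (f a)).length ≤ L.eval (eα a).length := by
    have := length_le_of_iterate M₁.m B
      (fun l => Finset.single_le_sum (f := fun l => pushCount (M₁.m l)) (fun _ _ => Nat.zero_le _)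
        (Finset.mem_univ l)) M₁.k₁ n₁ _ _ E₁
    rw [haltList_eq, initList_eq] at this
    simp only [single_self, List.length_map] at this
    have h2 : (single M₁.k₀ ((eα a).map i₁.invFun) M₁.k₁).length ≤ (eα a).length := by
      by_cases h : M₁.k₁ = M₁.k₀
      · rw [h]; simp [single_self]
      · simp [single_of_ne h]
    simp only [L, Polynomial.eval_add, Polynomial.eval_X, Polynomial.eval_mul, Polynomial.eval_C]
    have h3 := Nat.mul_le_mul_right B hn₁
    omega
  rw [initList_eq, haltList_eq] at E₁ E₂
  -- The run consists of the run of the first machine, two transfers of its output, and the run of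
  -- the second machine.
  have R₁ := Reach.lift (Γ' := CompΓ M₁ M₂ βΓ) (ι := fun k => .inl (.inl k))
    (get := fun v => v.1) (put := fun v => (v, M₂.initialState, none))
    (M' := compProg M₁ M₂ o₁ i₂) (lab := .inl) (exit := some (.inr (.inr false)))
    (S' := joinStk (single M₁.k₀ ((eα a).map i₁.invFun)) (fun _ => []) [])
    (T' := joinStk (single M₁.k₁ ((eβ (f a)).map o₁.invFun)) (fun _ => []) [])
    (fun _ _ h => by simpa using h) (fun _ => rfl) (fun _ => rfl) ⟨n₁, hn₁, E₁⟩
    (fun k => rfl) (fun k => rfl) (fun k hk => by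
      rcases k with (k | k) | k
      · exact absurd ⟨k, rfl⟩ hk
      · rfl
      · rfl)
  have R₂ := reach_transfer (M := compProg M₁ M₂ o₁ i₂) (i := .inl (.inl M₁.k₁)) (j := .inr ())
    (l := .inr (.inr false)) (l' := .inr (.inr true)) (c := o₁) (by simp) rfl
    (fun _ _ _ => rfl) (fun _ a => by cases a <;> rfl) (fun _ _ => rfl)
    ((eβ (f a)).map o₁.symm) (M₁.initialState, M₂.initialState, none)
    (joinStk (single M₁.k₁ ((eβ (f a)).map o₁.invFun)) (fun _ => []) [])
    (joinStk (fun _ => []) (fun _ => []) (eβ (f a)).reverse)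
    (single_self (Γ := M₁.Γ) ..) rfl
    (by simp [joinStk]; exact (List.append_nil _).symm)
    (fun k hi hj => by
      rcases k with (k | k) | k
      · exact (single_of_ne (Γ := M₁.Γ) (by simpa using hi) _).symm
      · rfl
      · exact absurd rfl hj)
  have R₃ := reach_transfer (M := compProg M₁ M₂ o₁ i₂) (i := .inr ()) (j := .inl (.inr M₂.k₀))
    (l := .inr (.inr true)) (l' := .inr (.inl M₂.main)) (c := i₂.symm) (by simp) rfl
    (fun _ _ _ => rfl) (fun _ a => by cases a <;> rfl) (fun _ _ => rfl)
    (eβ (f a)).reverse (M₁.initialState, M₂.initialState, none)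
    (joinStk (fun _ => []) (fun _ => []) (eβ (f a)).reverse)
    (joinStk (fun _ => []) (single M₂.k₀ ((eβ (f a)).map i₂.invFun)) [])
    rfl rfl (by simp [joinStk, single_self]; exact (List.append_nil _).symm)
    (fun k hi hj => by
      rcases k with (k | k) | k
      · rfl
      · exact single_of_ne (Γ := M₂.Γ) (by simpa using hj) _
      · exact absurd rfl hi)
  have R₄ := Reach.lift (Γ' := CompΓ M₁ M₂ βΓ) (ι := fun k => .inl (.inr k))
    (get := fun v => v.2.1) (put := fun v => (M₁.initialState, v, none))
    (M' := compProg M₁ M₂ o₁ i₂) (lab := fun l => .inr (.inl l)) (exit := none)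
    (S' := joinStk (fun _ => []) (single M₂.k₀ ((eβ (f a)).map i₂.invFun)) [])
    (T' := joinStk (fun _ => []) (single M₂.k₁ ((eγ (g (f a))).map o₂.invFun)) [])
    (fun _ _ h => by simpa using h) (fun _ => rfl) (fun _ => rfl) ⟨n₂, hn₂, E₂⟩
    (fun k => rfl) (fun k => rfl) (fun k hk => by
      rcases k with (k | k) | k
      · rfl
      · exact absurd ⟨k, rfl⟩ hk
      · rfl)
  replace R₂ := R₂.mono (t := (eβ (f a)).length + 1) (congrArg (· + 1) (List.length_map ..)).le
  replace R₃ := R₃.mono (t := (eβ (f a)).length + 1) (congrArg (· + 1) (List.length_reverse ..)).le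
  have hi : initList (compMachine M₁ M₂ o₁ i₂) ((eα a).map i₁.invFun) =
      ⟨some (.inl M₁.main), (M₁.initialState, M₂.initialState, none),
        joinStk (single M₁.k₀ ((eα a).map i₁.invFun)) (fun _ => []) []⟩ :=
    (initList_eq _ _).trans (congrArg (Cfg.mk _ _) (single_left ..))
  have ho : haltList (compMachine M₁ M₂ o₁ i₂) ((eγ (g (f a))).map o₂.invFun) =
      ⟨none, (M₁.initialState, M₂.initialState, none),
        joinStk (fun _ => []) (single M₂.k₁ ((eγ (g (f a))).map o₂.invFun)) []⟩ :=
    (haltList_eq _ _).trans (congrArg (Cfg.mk _ _) (single_right ..))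
  rw [hi, ho]
  have := eval_mono t₂ hlen
  simp only [Polynomial.eval_add, Polynomial.eval_mul, Polynomial.eval_comp,
    Polynomial.eval_ofNat]
  refine (((R₁.trans R₂).trans R₃).trans R₄).mono ?_
  omega

end StackMachine

namespace StackMachine

open Turing TM2

/-! ### A programming language with polynomially bounded running time -/

/-- Programs that act on finitely many registers, indexed by `K`; each register holds a list of
natural numbers. The only loop is `rep p`, which runs `p` as many times as a global constant says
(the length of the input); hence every program runs in polynomial time. -/
inductive Prog (K : Type) : Type
  | skip : Prog K
  | push0 (k : K) : Prog K
  | inc (k : K) : Prog K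
  | dec (k : K) : Prog K
  | clear (k : K) : Prog K
  | move (i j : K) (h : i ≠ j := by decide) : Prog K
  | dup (i j : K) (h : i ≠ j := by decide) : Prog K
  | sub (i j : K) (h : i ≠ j := by decide) : Prog K
  | seq (p q : Prog K) : Prog K
  | case (k : K) (p q r : Prog K) : Prog K
  | rep (p : Prog K) : Prog K

/-- Increment the first entry. -/
def incHead : List ℕ → List ℕ
  | [] => []
  | a :: l => (a + 1) :: l

/-- Decrement the first entry. -/
def decHead : List ℕ → List ℕ
  | [] => []
  | a :: l => (a - 1) :: l

/-- Subtract the first entry of the second list from the first entry of the first list. -/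
def subHead : List ℕ → List ℕ → List ℕ
  | a :: l, b :: _ => (a - b) :: l
  | l, _ => l

namespace Prog

variable {K : Type} [DecidableEq K]

/-- The effect of a program on the registers: `push0` puts a `0` in front, `inc`, `dec` and `sub`
act on the first entries, `clear` empties a register, `move` and `dup` move and copy the first entry
of `i` to the front of `j`, `case` distinguishes whether the register `k` is empty, starts with `0`,
or starts with a positive number, and `rep` repeats a program `N` times. -/
def eval : Prog K → (N : ℕ) → (K → List ℕ) → K → List ℕ
  | skip, _, s => s
  | push0 k, _, s => Function.update s k (0 :: s k)
  | inc k, _, s => Function.update s k (incHead (s k))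
  | dec k, _, s => Function.update s k (decHead (s k))
  | clear k, _, s => Function.update s k []
  | move i j _, _, s => Function.update (Function.update s i (s i).tail) j
      ((s i).head?.toList ++ s j)
  | dup i j _, _, s => Function.update s j ((s i).head?.toList ++ s j)
  | sub i j _, _, s => Function.update (Function.update s i (subHead (s i) (s j))) j
      (subHead (s j) (s i))
  | seq p q, N, s => eval q N (eval p N s)
  | case k p q r, N, s => match s k with
    | [] => eval p N s
    | 0 :: _ => eval q N s
    | (_ + 1) :: _ => eval r N s
  | rep p, N, s => (eval p N)^[N] s

end Prog

/-! ### Compilation of programs to stack machines -/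

/-- The auxiliary stacks: loop counters, the global constant in unary, and a stack for
temporary use. -/
inductive Aux : Type
  | ctr | cst | tmp
  deriving DecidableEq

instance : Fintype Aux := ⟨{.ctr, .cst, .tmp}, fun x => by cases x <;> simp⟩

/-- A fragment of machine code on binary stacks with two bits of state, to be entered at `main` and
left by halting. -/
structure Frag (K : Type) where
  Λ : Type
  fin : Fintype Λ
  main : Λ
  m : Λ → Stmt (fun _ : K ⊕ Aux => Bool) Λ (Option Bool × Option Bool)

/-- A fragment without jumps. -/
def Frag.ofStmt {K : Type} (q : Stmt (fun _ : K ⊕ Aux => Bool) Unit (Option Bool × Option Bool)) :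
    Frag K where
  Λ := Unit
  fin := inferInstance
  main := ()
  m _ := q

/-- Renames the labels of a statement, and replaces halting by a jump. -/
abbrev relabel {K Λ Λ' σ : Type} (lab : Λ → Λ') (exit : Option Λ')
    (q : Stmt (fun _ : K => Bool) Λ σ) : Stmt (fun _ : K => Bool) Λ' σ :=
  liftStmt (Γ' := fun _ => Bool) id id id lab exit q

theorem Reach.relabel {K Λ Λ' σ : Type} [DecidableEq K] {M : Λ → Stmt (fun _ : K => Bool) Λ σ}
    {M' : Λ' → Stmt (fun _ : K => Bool) Λ' σ} {lab : Λ → Λ'} {exit : Option Λ'}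
    (hM : ∀ l, M' (lab l) = relabel lab exit (M l)) {l : Λ} {v w : σ} {S T : K → List Bool} {t : ℕ}
    (h : Reach (step M) ⟨some l, v, S⟩ ⟨none, w, T⟩ t) :
    Reach (step M') ⟨some (lab l), v, S⟩ ⟨exit, w, T⟩ t :=
  Reach.lift (Γ' := fun _ => Bool) (ι := id) (get := id) (put := id) Function.injective_id
    (fun _ => rfl) hM h (fun _ => rfl) (fun _ => rfl) (fun k hk => absurd ⟨k, rfl⟩ hk)

/-- Pop a symbol, and branch on whether it was `true`. -/
abbrev popTrue {K Λ : Type} (i : K) (p q : Stmt (fun _ : K => Bool) Λ (Option Bool × Option Bool)) :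
    Stmt (fun _ : K => Bool) Λ (Option Bool × Option Bool) :=
  .pop i (fun _ a => (a, none)) (.branch (fun v => v.1 == some true) p q)

/-- Reset the state. -/
abbrev reset {K Λ : Type} (q : Stmt (fun _ : K => Bool) Λ (Option Bool × Option Bool)) :
    Stmt (fun _ : K => Bool) Λ (Option Bool × Option Bool) :=
  .load (fun _ => (none, none)) q

namespace Frag

/-- Runs two fragments one after the other. -/
def seq {K : Type} (p q : Frag K) : Frag K where
  Λ := p.Λ ⊕ q.Λ
  fin := letI := p.fin; letI := q.fin; inferInstance
  main := .inl p.main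
  m := fun
    | .inl l => relabel .inl (some (.inr q.main)) (p.m l)
    | .inr l => relabel .inr none (q.m l)

/-- Runs one of three fragments, according to the symbol on top of a register. -/
def case {K : Type} (k : K) (p q r : Frag K) : Frag K where
  Λ := Unit ⊕ p.Λ ⊕ q.Λ ⊕ r.Λ
  fin := letI := p.fin; letI := q.fin; letI := r.fin; inferInstance
  main := .inl ()
  m := fun
    | .inl _ => .peek (.inl k) (fun _ a => (a, none)) <|
        .branch (fun v => v.1.isSome)
          (.branch (fun v => v.1 == some true)
            (reset <| .goto fun _ => .inr (.inr (.inr r.main)))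
            (reset <| .goto fun _ => .inr (.inr (.inl q.main))))
          (reset <| .goto fun _ => .inr (.inl p.main))
    | .inr (.inl l) => relabel (fun l => .inr (.inl l)) none (p.m l)
    | .inr (.inr (.inl l)) => relabel (fun l => .inr (.inr (.inl l))) none (q.m l)
    | .inr (.inr (.inr l)) => relabel (fun l => .inr (.inr (.inr l))) none (r.m l)

/-- Runs a fragment as many times as the stack `cst` says. The counter of the loop is put on the
stack `ctr`, separated by `false` from the counters of the enclosing loops. -/
def rep {K : Type} (p : Frag K) : Frag K where
  Λ := (Option (Option Bool)) ⊕ p.Λ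
  fin := letI := p.fin; inferInstance
  main := .inl none
  m := fun
    | .inl none => .push (.inr .ctr) (fun _ => false) (.goto fun _ => .inl (some none))
    | .inl (some none) => popTrue (.inr .cst)
        (.push (.inr .tmp) (fun _ => true) (.goto fun _ => .inl (some none)))
        (.goto fun _ => .inl (some (some false)))
    | .inl (some (some false)) => popTrue (.inr .tmp)
        (.push (.inr .cst) (fun _ => true) <| .push (.inr .ctr) (fun _ => true) <|
          .goto fun _ => .inl (some (some false)))
        (.goto fun _ => .inl (some (some true)))
    | .inl (some (some true)) => popTrue (.inr .ctr)
        (reset <| .goto fun _ => .inr p.main) (reset .halt)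
    | .inr l => relabel .inr (some (.inl (some (some true)))) (p.m l)

end Frag

namespace Prog

variable {K : Type}

/-- The machine code of a program. -/
def compile : Prog K → Frag K
  | skip => .ofStmt .halt
  | push0 k => .ofStmt <| .push (.inl k) (fun _ => false) .halt
  | inc k => .ofStmt <| .peek (.inl k) (fun _ a => (a, none)) <|
      .branch (fun v => v.1.isSome) (.push (.inl k) (fun _ => true) (reset .halt)) (reset .halt)
  | dec k => .ofStmt <| .peek (.inl k) (fun _ a => (a, none)) <|
      .branch (fun v => v.1 == some true) (.pop (.inl k) (fun _ _ => (none, none)) .halt)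
        (reset .halt)
  | clear k => .ofStmt <| .pop (.inl k) (fun _ a => (a, none)) <|
      .branch (fun v => v.1.isSome) (.goto fun _ => ()) (reset .halt)
  | move i j _ =>
    { Λ := Bool
      fin := inferInstance
      main := false
      m := fun
        | false => .peek (.inl i) (fun _ a => (a, none)) <|
            .branch (fun v => v.1.isSome)
              (.push (.inl j) (fun _ => false) (.goto fun _ => true)) (reset .halt)
        | true => popTrue (.inl i) (.push (.inl j) (fun _ => true) (.goto fun _ => true))
            (reset .halt) }
  | dup i j _ =>
    { Λ := Option Bool
      fin := inferInstance
      main := none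
      m := fun
        | none => .peek (.inl i) (fun _ a => (a, none)) <|
            .branch (fun v => v.1.isSome) (.goto fun _ => some false) (reset .halt)
        | some false => popTrue (.inl i)
            (.push (.inr .tmp) (fun _ => true) (.goto fun _ => some false))
            (.push (.inl i) (fun _ => false) <| .push (.inl j) (fun _ => false) <|
              .goto fun _ => some true)
        | some true => popTrue (.inr .tmp)
            (.push (.inl i) (fun _ => true) <| .push (.inl j) (fun _ => true) <|
              .goto fun _ => some true)
            (reset .halt) }
  | sub i j _ => .ofStmt <| .peek (.inl i) (fun _ a => (a, none)) <|
      .peek (.inl j) (fun v a => (v.1, a)) <|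
      .branch (fun v => v.1 == some true && v.2 == some true)
        (.pop (.inl i) (fun v _ => v) <| .pop (.inl j) (fun v _ => v) <| .goto fun _ => ())
        (reset .halt)
  | seq p q => p.compile.seq q.compile
  | case k p q r => Frag.case k p.compile q.compile r.compile
  | rep p => p.compile.rep

/-- The contents of the stacks, given by those of the registers and of the auxiliary stacks. -/
def low (e : K → List Bool) (c n t : List Bool) : K ⊕ Aux → List Bool
  | .inl k => e k
  | .inr .ctr => c
  | .inr .cst => n
  | .inr .tmp => t

section low

variable (e : K → List Bool) (c n t x : List Bool) (k : K)

@[simp] theorem low_inl : low e c n t (.inl k) = e k := rfl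

@[simp] theorem low_ctr : low e c n t (.inr .ctr) = c := rfl

@[simp] theorem low_cst : low e c n t (.inr .cst) = n := rfl

@[simp] theorem low_tmp : low e c n t (.inr .tmp) = t := rfl

variable [DecidableEq K]

@[simp] theorem update_low_inl :
    Function.update (low e c n t) (.inl k) x = low (Function.update e k x) c n t := by
  funext r
  rcases r with r | r
  · by_cases h : r = k
    · subst h; simp
    · simp [h]
  · cases r <;> simp

@[simp] theorem update_low_ctr :
    Function.update (low e c n t) (.inr .ctr) x = low e x n t := by
  funext r
  rcases r with r | (_ | _ | _) <;> simp

@[simp] theorem update_low_cst :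
    Function.update (low e c n t) (.inr .cst) x = low e c x t := by
  funext r
  rcases r with r | (_ | _ | _) <;> simp

@[simp] theorem update_low_tmp :
    Function.update (low e c n t) (.inr .tmp) x = low e c n x := by
  funext r
  rcases r with r | (_ | _ | _) <;> simp

end low

/-- A loop that pops symbols `true` from the stack `i`; its effect is given by the family `st` of
stack contents, indexed by the number of symbols that remain. -/
theorem reach_popLoop {K Λ : Type} [DecidableEq K]
    {M : Λ → Stmt (fun _ : K => Bool) Λ (Option Bool × Option Bool)} {l : Λ} {i : K}
    {p q : Stmt (fun _ : K => Bool) Λ (Option Bool × Option Bool)} (hM : M l = popTrue i p q)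
    (st : ℕ → K → List Bool) (tl : ℕ → List Bool) (a : ℕ)
    (h : ∀ x < a, st (x + 1) i = true :: tl x ∧ stepAux p (some true, none)
      (Function.update (st (x + 1)) i (tl x)) = ⟨some l, (some true, none), st x⟩)
    (h₀ : (st 0 i).head? ≠ some true) (v : Option Bool × Option Bool) :
    Reach (step M) ⟨some l, v, st a⟩
      (stepAux q ((st 0 i).head?, none) (Function.update (st 0) i (st 0 i).tail)) (a + 1) := by
  induction a generalizing v with
  | zero =>
    refine Reach.single ?_
    have : ((st 0 i).head? == some true) = false := by simpa using h₀
    simp [step, hM, stepAux, this]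
  | succ a ih =>
    obtain ⟨h1, h2⟩ := h a (by omega)
    refine Reach.head ?_ (ih (fun x hx => h x (by omega)) (some true, none))
    simp only [step, hM, stepAux, h1, List.head?_cons, List.tail_cons, beq_self_eq_true, cond_true]
    rw [h2]

@[simp] theorem encodeNats_nil : encodeNats [] = [] := rfl

@[simp] theorem encodeNats_cons (a : ℕ) (l : List ℕ) :
    encodeNats (a :: l) = List.replicate a true ++ false :: encodeNats l := by
  simp [encodeNats]

theorem length_encodeNats_le {B : ℕ} {l : List ℕ} (h : ∀ a ∈ l, a ≤ B) :
    (encodeNats l).length ≤ l.length * (B + 1) := by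
  induction l with
  | nil => simp
  | cons a l ih =>
    have h1 := ih fun b hb => h b (by simp [hb])
    have h2 := h a (by simp)
    simp only [encodeNats_cons, List.length_append, List.length_replicate, List.length_cons,
      Nat.add_mul]
    omega

/-- All registers contain at most `B` numbers, and these are at most `B`. -/
def Bdd (B : ℕ) (s : K → List ℕ) : Prop :=
  ∀ k, (s k).length ≤ B ∧ ∀ a ∈ s k, a ≤ B

/-- The stacks that correspond to the registers `s`, for the global constant `N` and the loop
counters `c`. -/
abbrev stk (N : ℕ) (c : List Bool) (s : K → List ℕ) : K ⊕ Aux → List Bool :=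
  low (fun k => encodeNats (s k)) c (List.replicate N true) []

theorem encodeNats_update [DecidableEq K] (s : K → List ℕ) (k : K) (l : List ℕ) :
    (fun j => encodeNats (Function.update s k l j)) =
      Function.update (fun j => encodeNats (s j)) k (encodeNats l) := by
  funext j
  by_cases h : j = k
  · subst h; simp
  · simp [h]

theorem stk_update [DecidableEq K] (N : ℕ) (c : List Bool) (s : K → List ℕ) (k : K) (l : List ℕ) :
    stk N c (Function.update s k l) =
      low (Function.update (fun j => encodeNats (s j)) k (encodeNats l)) c
        (List.replicate N true) [] := by
  rw [← encodeNats_update]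

/-- The code of the program `p` computes `p.eval`, within time and space bounds that depend on
the size of the registers. -/
def Correct [DecidableEq K] (p : Prog K) (N B t g : ℕ) : Prop :=
  ∀ (s : K → List ℕ) (c : List Bool), Bdd B s →
    Reach (step p.compile.m) ⟨some p.compile.main, (none, none), stk N c s⟩
      ⟨none, (none, none), stk N c (p.eval N s)⟩ t ∧ Bdd (B + g) (p.eval N s)

theorem Bdd.mono {B C : ℕ} {s : K → List ℕ} (h : Bdd B s) (hBC : B ≤ C) : Bdd C s :=
  fun k => ⟨(h k).1.trans hBC, fun a ha => ((h k).2 a ha).trans hBC⟩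

theorem Bdd.update [DecidableEq K] {B : ℕ} {s : K → List ℕ} (h : Bdd B s) (k : K) {l : List ℕ}
    (h₁ : l.length ≤ B) (h₂ : ∀ a ∈ l, a ≤ B) : Bdd B (Function.update s k l) := by
  intro j
  by_cases hj : j = k
  · subst hj; simpa using ⟨h₁, h₂⟩
  · simpa [hj] using h j

theorem Bdd.cons {B : ℕ} {s : K → List ℕ} (h : Bdd B s) {k : K} {a : ℕ} {l : List ℕ}
    (hk : s k = a :: l) : l.length + 1 ≤ B ∧ a ≤ B ∧ ∀ b ∈ l, b ≤ B := by
  have := h k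
  rw [hk] at this
  exact ⟨this.1, this.2 a (by simp), fun b hb => this.2 b (by simp [hb])⟩

variable [DecidableEq K]

theorem Bdd.update_head {B : ℕ} {s : K → List ℕ} (h : Bdd B s) (k : K) {a b : ℕ} {l : List ℕ}
    (hk : s k = a :: l) (hb : b ≤ B) : Bdd B (Function.update s k (b :: l)) := by
  obtain ⟨h1, h2, h3⟩ := h.cons hk
  exact h.update k h1 (by simpa using ⟨hb, h3⟩)

theorem Bdd.update_push {B : ℕ} {s : K → List ℕ} (h : Bdd B s) (k : K) {b : ℕ} {l : List ℕ}
    (hl : l.length ≤ (s k).length) (hl' : ∀ a ∈ l, a ≤ B) (hb : b ≤ B) :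
    Bdd (B + 1) (Function.update s k (b :: l)) := by
  refine (h.mono (Nat.le_succ B)).update k (by simpa using hl.trans (h k).1) ?_
  simp only [List.mem_cons, forall_eq_or_imp]
  exact ⟨by omega, fun a ha => (hl' a ha).trans (Nat.le_succ B)⟩

theorem correct_skip (N B : ℕ) : Correct (skip : Prog K) N B 1 0 :=
  fun _ _ hs => ⟨Reach.single rfl, hs⟩

theorem correct_push0 (k : K) (N B : ℕ) : Correct (push0 k) N B 1 1 := by
  refine fun s c hs => ⟨Reach.single ?_, ?_⟩
  · simp [compile, Frag.ofStmt, eval, stk_update]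
  · exact hs.update_push k le_rfl (hs k).2 (Nat.zero_le _)

theorem correct_inc (k : K) (N B : ℕ) : Correct (inc k) N B 1 1 := by
  refine fun s c hs => ⟨Reach.single ?_, ?_⟩
  · rcases h : s k with _ | ⟨a, l⟩
    · have : Function.update s k [] = s := by rw [← h, Function.update_eq_self]
      simp [compile, Frag.ofStmt, eval, incHead, h, this]
    · have : (List.replicate a true ++ false :: encodeNats l).head?.isSome = true := by
        cases a <;> simp [List.replicate_succ]
      simp [compile, Frag.ofStmt, eval, stk_update, incHead, h, List.replicate_succ]
  · rcases h : s k with _ | ⟨a, l⟩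
    · have : Function.update s k [] = s := by rw [← h, Function.update_eq_self]
      simpa [eval, incHead, h, this] using hs.mono (Nat.le_succ B)
    · simp only [eval, incHead, h]
      exact (hs.mono (Nat.le_succ B)).update_head k h (Nat.succ_le_succ (hs.cons h).2.1)

theorem correct_dec (k : K) (N B : ℕ) : Correct (dec k) N B 1 0 := by
  refine fun s c hs => ⟨Reach.single ?_, ?_⟩
  · rcases h : s k with _ | ⟨_ | a, l⟩
    · have : Function.update s k [] = s := by rw [← h, Function.update_eq_self]
      simp [compile, Frag.ofStmt, eval, decHead, h, this]
    · have : Function.update s k (0 :: l) = s := by rw [← h, Function.update_eq_self]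
      simp [compile, Frag.ofStmt, eval, decHead, h, this]
    · simp [compile, Frag.ofStmt, eval, stk_update, decHead, h, List.replicate_succ]
  · rcases h : s k with _ | ⟨a, l⟩
    · have : Function.update s k [] = s := by rw [← h, Function.update_eq_self]
      simpa [eval, decHead, h, this] using hs
    · simp only [eval, decHead, h]
      exact hs.update_head k h ((Nat.sub_le a 1).trans (hs.cons h).2.1)

theorem correct_clear (k : K) (N B : ℕ) : Correct (clear k) N B ((B + 2) ^ 2) 0 := by
  have key : ∀ (x : List Bool) (v : Option Bool × Option Bool) (e : K → List Bool)
      (c n t : List Bool), e k = x → Reach (step (compile (clear k)).m) ⟨some (), v, low e c n t⟩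
        ⟨none, (none, none), low (Function.update e k []) c n t⟩ (x.length + 1) := by
    intro x
    induction x with
    | nil =>
      intro v e c n t he
      refine Reach.single ?_
      simp [compile, Frag.ofStmt, he]
    | cons b x ih =>
      intro v e c n t he
      have := ih (some b, none) (Function.update e k x) c n t (by simp)
      rw [Function.update_idem] at this
      refine Reach.head ?_ this
      simp [compile, Frag.ofStmt, he]
  refine fun s c hs => ⟨?_, hs.update k (Nat.zero_le _) (by simp)⟩
  have := key _ (none, none) (fun k => encodeNats (s k)) c (List.replicate N true) [] rfl
  simp only [eval, stk_update]
  refine this.mono ?_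
  have h1 := length_encodeNats_le (hs k).2
  have h2 := Nat.mul_le_mul_right (B + 1) (hs k).1
  nlinarith

theorem correct_move (i j : K) (hij : i ≠ j) (N B : ℕ) :
    Correct (move i j hij) N B ((B + 2) ^ 2) 1 := by
  intro s c hs
  rcases h : s i with _ | ⟨a, l⟩
  · have : Function.update s i [] = s := by rw [← h, Function.update_eq_self]
    simp only [eval, h, List.tail_nil, this, List.head?_nil, Option.toList_none, List.nil_append,
      Function.update_eq_self]
    refine ⟨(Reach.single ?_).mono (Nat.one_le_pow _ _ (by omega)), hs.mono (Nat.le_succ B)⟩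
    simp [compile, h]
  obtain ⟨h1, h2, h3⟩ := hs.cons h
  have hi : (List.replicate a true ++ false :: encodeNats l).head?.isSome = true := by
    cases a <;> simp [List.replicate_succ]
  constructor
  · set e := fun k => encodeNats (s k) with he
    have R₁ : Reach (step (compile (move i j hij)).m)
        ⟨some false, (none, none), low e c (List.replicate N true) []⟩
        ⟨some true, ((e i).head?, none),
          low (Function.update e j (false :: e j)) c (List.replicate N true) []⟩ 1 := by
      refine Reach.single ?_
      simp [compile, he, h]
    have R₂ := reach_popLoop (M := (compile (move i j hij)).m) (l := true) (i := .inl i) rfl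
      (fun x => low (Function.update (Function.update e i (List.replicate x true ++
        false :: encodeNats l)) j (List.replicate (a - x) true ++ false :: e j)) c
        (List.replicate N true) [])
      (fun x => List.replicate x true ++ false :: encodeNats l) a
      (fun x hx => by
        refine ⟨by simp [hij, List.replicate_succ], ?_⟩
        have h4 : a - x = a - (x + 1) + 1 := by omega
        simp only [stepAux]
        simp [h4, Function.update_comm hij, List.replicate_succ, hij.symm])
      (by simp [hij]) ((e i).head?, none)
    have hei : e i = List.replicate a true ++ false :: encodeNats l := by simp [he, h]
    have hcur : Function.update (Function.update e i (List.replicate a true ++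
        false :: encodeNats l)) j (List.replicate (a - a) true ++ false :: e j) =
        Function.update e j (false :: e j) := by
      rw [← hei, Function.update_eq_self, Nat.sub_self]; rfl
    rw [hcur] at R₂
    have R := (R₁.trans R₂).mono (t := (B + 2) ^ 2) (by nlinarith)
    refine Eq.mp (congrArg (fun d => Reach (step (compile (move i j hij)).m) _ d _) ?_) R
    simp [hij, eval, h, stk_update, he]
    rw [Function.update_comm hij.symm, Function.update_idem, encodeNats_update]
    rfl
  · simp only [eval, h, List.tail_cons, List.head?_cons, Option.toList_some, List.cons_append,
      List.nil_append]
    exact (hs.update i (by omega) h3).update_push j (by simp [hij.symm]) (hs j).2 h2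

theorem correct_dup (i j : K) (hij : i ≠ j) (N B : ℕ) :
    Correct (dup i j hij) N B ((B + 2) ^ 2) 1 := by
  intro s c hs
  rcases h : s i with _ | ⟨a, l⟩
  · simp only [eval, h, List.head?_nil, Option.toList_none, List.nil_append,
      Function.update_eq_self]
    refine ⟨(Reach.single ?_).mono (Nat.one_le_pow _ _ (by omega)), hs.mono (Nat.le_succ B)⟩
    simp [compile, h]
  obtain ⟨h1, h2, h3⟩ := hs.cons h
  constructor
  · set e := fun k => encodeNats (s k) with he
    have hei : e i = List.replicate a true ++ false :: encodeNats l := by simp [he, h]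
    have R₁ : Reach (step (compile (dup i j hij)).m)
        ⟨some none, (none, none), low e c (List.replicate N true) []⟩
        ⟨some (some false), ((e i).head?, none), low e c (List.replicate N true) []⟩ 1 := by
      refine Reach.single ?_
      simp [compile, he, h]
    have R₂ := reach_popLoop (M := (compile (dup i j hij)).m) (l := some false) (i := .inl i) rfl
      (fun x => low (Function.update e i (List.replicate x true ++ false :: encodeNats l)) c
        (List.replicate N true) (List.replicate (a - x) true))
      (fun x => List.replicate x true ++ false :: encodeNats l) a
      (fun x hx => by
        refine ⟨by simp [List.replicate_succ], ?_⟩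
        have h4 : a - x = a - (x + 1) + 1 := by omega
        simp only [stepAux]
        simp [h4, List.replicate_succ])
      (by simp) ((e i).head?, none)
    have R₃ := reach_popLoop (M := (compile (dup i j hij)).m) (l := some true) (i := .inr .tmp) rfl
      (fun x => low (Function.update (Function.update e i (List.replicate (a - x) true ++
        false :: encodeNats l)) j (List.replicate (a - x) true ++ false :: e j)) c
        (List.replicate N true) (List.replicate x true))
      (fun x => List.replicate x true) a
      (fun x hx => by
        refine ⟨by simp [List.replicate_succ], ?_⟩
        have h4 : a - x = a - (x + 1) + 1 := by omega
        simp only [stepAux]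
        simp [h4, Function.update_comm hij, List.replicate_succ, hij.symm])
      (by simp) (some false, none)
    rw [Nat.sub_self, List.replicate_zero, ← hei, Function.update_eq_self] at R₂
    rw [Nat.sub_self, List.replicate_zero, List.nil_append, List.nil_append] at R₃
    have hmid : stepAux ((Stmt.push (.inl i) (fun _ => false) <|
        .push (.inl j) (fun _ => false) <| .goto fun _ => some true) :
          Stmt (fun _ : K ⊕ Aux => Bool) (Option Bool) (Option Bool × Option Bool))
        (some false, none) (low (Function.update e i (encodeNats l)) c (List.replicate N true)
          (List.replicate a true)) = ⟨some (some true), (some false, none),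
        low (Function.update (Function.update e i (false :: encodeNats l)) j (false :: e j)) c
        (List.replicate N true) (List.replicate a true)⟩ := by
      simp only [stepAux]
      simp [hij.symm]
    simp only [low_inl, Function.update_self, Nat.sub_zero, List.nil_append,
      List.head?_cons, List.tail_cons, update_low_inl, Function.update_idem, low_tmp,
      List.head?_nil, List.tail_nil, update_low_tmp] at R₂ R₃
    replace R₂ := Eq.mp (congrArg (fun d => Reach (step (compile (dup i j hij)).m) _ d _) hmid) R₂
    have R := ((R₁.trans R₂).trans R₃).mono (t := (B + 2) ^ 2) (by nlinarith)
    refine Eq.mp (congrArg (fun d => Reach (step (compile (dup i j hij)).m) _ d _) ?_) R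
    rw [← hei, Function.update_eq_self]
    simp [eval, h, stk_update, he]
    rfl
  · simp only [eval, h, List.head?_cons, Option.toList_some, List.cons_append, List.nil_append]
    exact hs.update_push j le_rfl (hs j).2 h2

theorem correct_sub (i j : K) (hij : i ≠ j) (N B : ℕ) :
    Correct (sub i j hij) N B ((B + 2) ^ 2) 0 := by
  intro s c hs
  rcases h : s i with _ | ⟨a, l⟩
  · have h1 : subHead (s j) [] = s j := by cases s j <;> rfl
    have h2 : Function.update s i [] = s := by rw [← h, Function.update_eq_self]
    simp only [eval, h, h1, show subHead [] (s j) = [] from rfl, h2, Function.update_eq_self]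
    refine ⟨(Reach.single ?_).mono (Nat.one_le_pow _ _ (by omega)), hs⟩
    simp [compile, Frag.ofStmt, h]
  rcases h' : s j with _ | ⟨b, l'⟩
  · have h1 : Function.update s i (a :: l) = s := by rw [← h, Function.update_eq_self]
    have h2 : Function.update s j [] = s := by rw [← h', Function.update_eq_self]
    simp only [eval, h, h', show subHead (a :: l) [] = a :: l from rfl, h1,
      show subHead [] (a :: l) = [] from rfl, h2]
    refine ⟨(Reach.single ?_).mono (Nat.one_le_pow _ _ (by omega)), hs⟩
    simp [compile, Frag.ofStmt, h, h']
  obtain ⟨h1, h2, h3⟩ := hs.cons h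
  obtain ⟨h1', h2', h3'⟩ := hs.cons h'
  simp only [eval, h, h', subHead]
  constructor
  · have key : ∀ (a b : ℕ) (v : Option Bool × Option Bool) (e : K → List Bool),
        e i = List.replicate a true ++ false :: encodeNats l →
        e j = List.replicate b true ++ false :: encodeNats l' →
        Reach (step (compile (sub i j hij)).m) ⟨some (), v, low e c (List.replicate N true) []⟩
          ⟨none, (none, none), low (Function.update (Function.update e i
            (encodeNats ((a - b) :: l))) j (encodeNats ((b - a) :: l'))) c
            (List.replicate N true) []⟩ (a + 1) := by
      intro a
      induction a with
      | zero =>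
        intro b v e hi hj
        refine Reach.single ?_
        have h5 : Function.update (Function.update e i (encodeNats ((0 - b) :: l))) j
            (encodeNats ((b - 0) :: l')) = e := by
          rw [encodeNats_cons, encodeNats_cons, Nat.zero_sub, Nat.sub_zero, ← hi, ← hj,
            Function.update_eq_self, Function.update_eq_self]
        rw [h5]
        simp [compile, Frag.ofStmt, hi]
      | succ a ih =>
        intro b v e hi hj
        cases b with
        | zero =>
          refine (Reach.single ?_).mono (by omega)
          have h5 : Function.update (Function.update e i (encodeNats ((a + 1 - 0) :: l))) j
              (encodeNats ((0 - (a + 1)) :: l')) = e := by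
            rw [encodeNats_cons, encodeNats_cons, Nat.zero_sub, Nat.sub_zero, ← hi, ← hj,
              Function.update_eq_self, Function.update_eq_self]
          rw [h5]
          simp [compile, Frag.ofStmt, hj]
        | succ b =>
          have := ih b (some true, some true) (Function.update (Function.update e i
            (List.replicate a true ++ false :: encodeNats l)) j
            (List.replicate b true ++ false :: encodeNats l')) (by simp [hij]) (by simp)
          rw [Nat.succ_sub_succ, Nat.succ_sub_succ]
          rw [Function.update_comm hij.symm, Function.update_idem, Function.update_idem] at this
          refine Reach.head ?_ this
          simp [compile, Frag.ofStmt, hi, hj, List.replicate_succ, hij.symm,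
            Function.update_comm hij]
    have := key a b (none, none) (fun k => encodeNats (s k)) (by simp [h]) (by simp [h'])
    rw [stk_update, encodeNats_update]
    exact this.mono (by nlinarith)
  · have := hs.update_head i h ((Nat.sub_le a b).trans h2)
    exact this.update_head j (by simpa [hij.symm] using h') ((Nat.sub_le b a).trans h2')

theorem Correct.seq {p q : Prog K} {N B t₁ t₂ g₁ g₂ : ℕ} (hp : Correct p N B t₁ g₁)
    (hq : Correct q N (B + g₁) t₂ g₂) : Correct (p.seq q) N B (t₁ + t₂) (g₁ + g₂) := by
  intro s c hs
  obtain ⟨R₁, h₁⟩ := hp s c hs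
  obtain ⟨R₂, h₂⟩ := hq _ c h₁
  refine ⟨?_, by rw [← Nat.add_assoc]; exact h₂⟩
  exact (R₁.relabel (M' := (compile (p.seq q)).m) (lab := .inl)
    (exit := some (.inr q.compile.main)) (fun _ => rfl)).trans
    (R₂.relabel (M' := (compile (p.seq q)).m) (lab := .inr) (exit := none) (fun _ => rfl))

theorem Correct.case {k : K} {p q r : Prog K} {N B t₁ t₂ t₃ g₁ g₂ g₃ : ℕ}
    (hp : Correct p N B t₁ g₁) (hq : Correct q N B t₂ g₂) (hr : Correct r N B t₃ g₃) :
    Correct (.case k p q r) N B (1 + (t₁ + t₂ + t₃)) (g₁ + g₂ + g₃) := by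
  intro s c hs
  obtain ⟨R₁, h₁⟩ := hp s c hs
  obtain ⟨R₂, h₂⟩ := hq s c hs
  obtain ⟨R₃, h₃⟩ := hr s c hs
  rcases h : s k with _ | ⟨_ | a, l⟩
  · simp only [eval, h]
    refine ⟨((Reach.single ?_).trans (R₁.relabel (M' := (compile (.case k p q r)).m)
      (lab := fun l => .inr (.inl l)) (exit := none) (fun _ => rfl))).mono (by omega),
      h₁.mono (by omega)⟩
    simp [compile, Frag.case, h]
  · simp only [eval, h]
    refine ⟨((Reach.single ?_).trans (R₂.relabel (M' := (compile (.case k p q r)).m)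
      (lab := fun l => .inr (.inr (.inl l))) (exit := none) (fun _ => rfl))).mono (by omega),
      h₂.mono (by omega)⟩
    simp [compile, Frag.case, h]
  · simp only [eval, h]
    refine ⟨((Reach.single ?_).trans (R₃.relabel (M' := (compile (.case k p q r)).m)
      (lab := fun l => .inr (.inr (.inr l))) (exit := none) (fun _ => rfl))).mono (by omega),
      h₃.mono (by omega)⟩
    simp [compile, Frag.case, h, List.replicate_succ]

theorem Correct.rep {p : Prog K} {N B t g : ℕ} (hp : ∀ i < N, Correct p N (B + i * g) t g) :
    Correct p.rep N B (2 * N + 4 + N * (t + 1)) (N * g) := by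
  intro s c hs
  have loop : ∀ (x y : ℕ) (s : K → List ℕ) (v : Option Bool × Option Bool), x + y = N →
      Bdd (B + y * g) s →
      Reach (step p.rep.compile.m) ⟨some (.inl (some (some true))), v,
        low (fun k => encodeNats (s k)) (List.replicate x true ++ false :: c)
          (List.replicate N true) []⟩
        ⟨none, (none, none), stk N c ((p.eval N)^[x] s)⟩ (x * (t + 1) + 1) ∧
        Bdd (B + N * g) ((p.eval N)^[x] s) := by
    intro x
    induction x with
    | zero =>
      intro y s v hy hs
      obtain rfl : y = N := by omega
      refine ⟨(Reach.single ?_).mono (by omega), hs⟩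
      simp [compile, Frag.rep]
    | succ x ih =>
      intro y s v hy hs
      obtain ⟨R₁, h₁⟩ := hp y (by omega) s (List.replicate x true ++ false :: c) hs
      obtain ⟨R₂, h₂⟩ := ih (y + 1) (p.eval N s) (none, none) (by omega)
        (by rw [Nat.add_mul, Nat.one_mul, ← Nat.add_assoc]; exact h₁)
      rw [Function.iterate_succ_apply]
      refine ⟨(((Reach.single ?_).trans (R₁.relabel (M' := p.rep.compile.m) (lab := .inr)
        (exit := some (.inl (some (some true)))) (fun _ => rfl))).trans R₂).mono
        (by rw [Nat.add_mul]; omega), h₂⟩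
      simp [compile, Frag.rep, List.replicate_succ]
  obtain ⟨R₄, h₄⟩ := loop N 0 s (none, none) (by omega) (by simpa using hs)
  refine ⟨?_, h₄⟩
  set e := fun k => encodeNats (s k)
  have R₁ : Reach (step p.rep.compile.m)
      ⟨some (.inl none), (none, none), low e c (List.replicate N true) []⟩
      ⟨some (.inl (some none)), (none, none), low e (false :: c) (List.replicate N true) []⟩ 1 := by
    refine Reach.single ?_
    simp [compile, Frag.rep]
  -- The constant on `cst` is moved to `tmp`, and then back to `cst` and, as a counter, to `ctr`.
  have R₂ := reach_popLoop (M := p.rep.compile.m) (l := .inl (some none)) (i := .inr .cst) rfl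
    (fun x => low e (false :: c) (List.replicate x true) (List.replicate (N - x) true))
    (fun x => List.replicate x true) N
    (fun x hx => by
      refine ⟨by simp [List.replicate_succ], ?_⟩
      have h4 : N - x = N - (x + 1) + 1 := by omega
      simp only [stepAux]
      simp [h4, List.replicate_succ])
    (by simp) (none, none)
  have R₃ := reach_popLoop (M := p.rep.compile.m) (l := .inl (some (some false))) (i := .inr .tmp)
    rfl (fun x => low e (List.replicate (N - x) true ++ false :: c) (List.replicate (N - x) true)
      (List.replicate x true))
    (fun x => List.replicate x true) N
    (fun x hx => by
      refine ⟨by simp [List.replicate_succ], ?_⟩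
      have h4 : N - x = N - (x + 1) + 1 := by omega
      simp only [stepAux]
      simp [h4, List.replicate_succ])
    (by simp) (none, none)
  simp only [Nat.sub_self, List.replicate_zero, List.nil_append, Nat.sub_zero, low_cst,
    List.head?_nil, List.tail_nil, update_low_cst, low_tmp, update_low_tmp, stepAux] at R₂ R₃
  exact (((R₁.trans R₂).trans R₃).trans R₄).mono (by omega)

theorem Correct.mono {p : Prog K} {N B t t' g g' : ℕ} (h : Correct p N B t g) (ht : t ≤ t')
    (hg : g ≤ g') : Correct p N B t' g' := fun s c hs =>
  ⟨(h s c hs).1.mono ht, (h s c hs).2.mono (by omega)⟩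

/-- Every program runs in polynomial time. -/
theorem exists_correct (p : Prog K) : ∃ T G : Polynomial ℕ, ∀ N B, N ≤ B →
    Correct p N B (T.eval B) (G.eval N) := by
  have basic : ∀ p : Prog K, (∀ N B, ∃ t ≤ (B + 2) ^ 2, ∃ g ≤ 1, Correct p N B t g) →
      ∃ T G : Polynomial ℕ, ∀ N B, N ≤ B → Correct p N B (T.eval B) (G.eval N) := by
    intro p hp
    refine ⟨(Polynomial.X + 2) ^ 2, 1, fun N B _ => ?_⟩
    obtain ⟨t, ht, g, hg, h⟩ := hp N B
    exact h.mono (by simpa using ht) (by simpa using hg)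
  have one : ∀ B, 1 ≤ (B + 2) ^ 2 := fun B => Nat.one_le_pow _ _ (by omega)
  induction p with
  | skip => exact basic _ fun N B => ⟨1, one B, 0, by omega, correct_skip N B⟩
  | push0 k => exact basic _ fun N B => ⟨1, one B, 1, le_rfl, correct_push0 k N B⟩
  | inc k => exact basic _ fun N B => ⟨1, one B, 1, le_rfl, correct_inc k N B⟩
  | dec k => exact basic _ fun N B => ⟨1, one B, 0, by omega, correct_dec k N B⟩
  | clear k => exact basic _ fun N B => ⟨_, le_rfl, 0, by omega, correct_clear k N B⟩
  | move i j h => exact basic _ fun N B => ⟨_, le_rfl, 1, le_rfl, correct_move i j h N B⟩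
  | dup i j h => exact basic _ fun N B => ⟨_, le_rfl, 1, le_rfl, correct_dup i j h N B⟩
  | sub i j h => exact basic _ fun N B => ⟨_, le_rfl, 0, by omega, correct_sub i j h N B⟩
  | seq p q hp hq =>
    obtain ⟨T₁, G₁, h₁⟩ := hp
    obtain ⟨T₂, G₂, h₂⟩ := hq
    refine ⟨T₁ + T₂.comp (Polynomial.X + G₁), G₁ + G₂, fun N B hN => ?_⟩
    rw [Polynomial.eval_add, Polynomial.eval_add, Polynomial.eval_comp]
    refine (h₁ N B hN).seq ((h₂ N _ (by omega)).mono (eval_mono _ ?_) le_rfl)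
    have := eval_mono G₁ hN
    simp only [Polynomial.eval_add, Polynomial.eval_X]
    omega
  | case k p q r hp hq hr =>
    obtain ⟨T₁, G₁, h₁⟩ := hp
    obtain ⟨T₂, G₂, h₂⟩ := hq
    obtain ⟨T₃, G₃, h₃⟩ := hr
    refine ⟨1 + (T₁ + T₂ + T₃), G₁ + G₂ + G₃, fun N B hN => ?_⟩
    simp only [Polynomial.eval_add, Polynomial.eval_one]
    exact (h₁ N B hN).case (h₂ N B hN) (h₃ N B hN)
  | rep p hp =>
    obtain ⟨T, G, h⟩ := hp
    refine ⟨2 * Polynomial.X + 4 + Polynomial.X * (T.comp (Polynomial.X + Polynomial.X * G) + 1),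
      Polynomial.X * G, fun N B hN => ?_⟩
    have hG := eval_mono G hN
    have : Correct p.rep N B (2 * N + 4 + N * (T.eval (B + B * G.eval B) + 1))
        (N * G.eval N) := by
      refine Correct.rep fun i hi => (h N _ (by omega)).mono (eval_mono _ ?_) le_rfl
      exact Nat.add_le_add_left (Nat.mul_le_mul (by omega) hG) B
    refine this.mono ?_ (by simp)
    simp only [Polynomial.eval_add, Polynomial.eval_mul, Polynomial.eval_X, Polynomial.eval_ofNat,
      Polynomial.eval_comp, Polynomial.eval_one]
    have := Nat.mul_le_mul_right (T.eval (B + B * G.eval B) + 1) hN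
    omega

theorem length_le_length_encodeNats (l : List ℕ) :
    l.length ≤ (encodeNats l).length ∧ ∀ a ∈ l, a ≤ (encodeNats l).length := by
  induction l with
  | nil => simp
  | cons a l ih =>
    simp only [encodeNats_cons, List.length_append, List.length_replicate, List.length_cons,
      List.mem_cons, forall_eq_or_imp]
    refine ⟨by omega, by omega, fun b hb => ?_⟩
    have := ih.2 b hb
    omega

/-- Code that computes the length of the input (a copy in unary is kept on `cst`), runs a fragment,
and finally empties `cst`. -/
def wrapper (inp : K) (p : Frag K) :
    Fin 3 ⊕ p.Λ → Stmt (fun _ : K ⊕ Aux => Bool) (Fin 3 ⊕ p.Λ) (Option Bool × Option Bool)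
  | .inl 0 => .pop (.inl inp) (fun _ a => (a, none)) <| .branch (fun v => v.1.isSome)
      (.push (.inr .tmp) (fun v => v.1.getD false) <| .push (.inr .cst) (fun _ => true) <|
        .goto fun _ => .inl 0)
      (.goto fun _ => .inl 1)
  | .inl 1 => .pop (.inr .tmp) (fun _ a => (a, none)) <| .branch (fun v => v.1.isSome)
      (.push (.inl inp) (fun v => v.1.getD false) <| .goto fun _ => .inl 1)
      (.goto fun _ => .inr p.main)
  | .inl 2 => popTrue (.inr .cst) (.goto fun _ => .inl 2) (reset .halt)
  | .inr l => relabel .inr (some (.inl 2)) (p.m l)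

/-- The machine with input register `inp` and output register `out` that runs a fragment. -/
def machine [Fintype K] (inp out : K) (p : Frag K) : FinTM2 :=
  letI := p.fin
  { K := K ⊕ Aux
    k₀ := .inl inp
    k₁ := .inl out
    Γ := fun _ => Bool
    Λ := Fin 3 ⊕ p.Λ
    main := .inl 0
    σ := Option Bool × Option Bool
    initialState := (none, none)
    Γk₀Fin := inferInstanceAs (Fintype Bool)
    m := wrapper inp p }

/-- A function that is computed by a program is computable in polynomial time. -/
theorem polyTime [Fintype K] (p : Prog K) (inp out : K) {α β : Type} (ea : α → List ℕ)
    (eb : β → List ℕ) (f : α → β)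
    (h : ∀ a, p.eval (encodeNats (ea a)).length (Function.update (fun _ => []) inp (ea a)) =
      Function.update (fun _ => []) out (eb (f a))) :
    Nonempty (TM2ComputableInPolyTime (fun a => encodeNats (ea a)) (fun b => encodeNats (eb b))
      f) := by
  obtain ⟨T, G, hT⟩ := p.exists_correct
  refine ⟨⟨⟨machine inp out p.compile, Equiv.refl _, Equiv.refl _⟩, 3 * (Polynomial.X + 1) + T,
    fun a => ?_⟩⟩
  set N := (encodeNats (ea a)).length with hN
  suffices h : Reach (step (wrapper inp p.compile))
      (initList (machine inp out p.compile) (encodeNats (ea a)))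
      (haltList (machine inp out p.compile) (encodeNats (eb (f a))))
      ((3 * (Polynomial.X + 1) + T).eval N) by
    have e₁ : initList (machine inp out p.compile)
        ((encodeNats (ea a)).map (Equiv.refl Bool).invFun) = initList _ (encodeNats (ea a)) :=
      congrArg (initList (machine inp out p.compile)) (List.map_id _)
    have e₂ : haltList (machine inp out p.compile)
        ((encodeNats (eb (f a))).map (Equiv.refl Bool).invFun) =
          haltList _ (encodeNats (eb (f a))) :=
      congrArg (haltList (machine inp out p.compile)) (List.map_id _)
    rw [← e₁, ← e₂] at h
    exact ⟨⟨h.choose, h.choose_spec.2⟩, h.choose_spec.1⟩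
  set M := wrapper inp p.compile with hM
  have hsingle : ∀ (k : K) (x : List Bool), single (Γ := fun _ : K ⊕ Aux => Bool) (.inl k) x =
      low (Function.update (fun _ => []) k x) [] [] [] := by
    intro k x
    funext r
    rcases r with r | (_ | _ | _)
    · by_cases hr : r = k
      · subst hr; simp [single]
      · simp [single, hr]
    all_goals simp [single]
  have hi : initList (machine inp out p.compile) (encodeNats (ea a)) = ⟨some (.inl 0), (none, none),
      low (Function.update (fun _ => []) inp (encodeNats (ea a))) [] [] []⟩ :=
    (initList_eq _ _).trans (congrArg (Cfg.mk _ _) (hsingle ..))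
  have ho : haltList (machine inp out p.compile) (encodeNats (eb (f a))) = ⟨none, (none, none),
      low (Function.update (fun _ => []) out (encodeNats (eb (f a)))) [] [] []⟩ :=
    (haltList_eq _ _).trans (congrArg (Cfg.mk _ _) (hsingle ..))
  -- The input is moved to `tmp`, while its length is recorded on `cst`.
  have R₁ : ∀ (x : List Bool) (e : K → List Bool) (n t : List Bool) (v : Option Bool × Option Bool),
      e inp = x → Reach (step M) ⟨some (.inl 0), v, low e [] n t⟩
        ⟨some (.inl 1), (none, none), low (Function.update e inp []) []
          (List.replicate x.length true ++ n) (x.reverse ++ t)⟩ (x.length + 1) := by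
    intro x
    induction x with
    | nil =>
      intro e n t v he
      refine Reach.single ?_
      simp [M, wrapper, he]
    | cons b x ih =>
      intro e n t v he
      have := ih (Function.update e inp x) (true :: n) (b :: t) (some b, none) (by simp)
      rw [Function.update_idem] at this
      refine Reach.head ?_ (by simpa [List.replicate_succ'] using this)
      simp [M, wrapper, he]
  have R₁ := R₁ _ (Function.update (fun _ => []) inp (encodeNats (ea a))) [] [] (none, none)
    (Function.update_self ..)
  have hs : ∀ (k : K) (l : List ℕ), stk N [] (Function.update (fun _ => []) k l) =
      low (Function.update (fun _ => []) k (encodeNats l)) [] (List.replicate N true) [] :=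
    stk_update N [] (fun _ => [])
  -- The input is moved back; then the program runs, and `cst` is emptied.
  have R₂ := reach_transfer (M := M) (i := .inr .tmp) (j := .inl inp)
    (l := .inl 1) (l' := .inr p.compile.main) (c := id) (by simp) rfl
    (fun _ _ _ => rfl) (fun _ a => by cases a <;> rfl) (fun _ _ => rfl)
    (encodeNats (ea a)).reverse (none, none)
    (low (fun _ => []) [] (List.replicate N true) (encodeNats (ea a)).reverse)
    (stk N [] (Function.update (fun _ => []) inp (ea a)))
    rfl rfl (by simp)
    (fun k hi hj => by
      rw [hs]
      rcases k with k | (_ | _ | _)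
      · simpa using Function.update_of_ne (by simpa using hj) _ _
      · rfl
      · rfl
      · exact absurd rfl hi)
  obtain ⟨R₃, -⟩ := hT N N le_rfl (Function.update (fun _ => []) inp (ea a)) []
    (Bdd.update (fun _ => by simp) inp (length_le_length_encodeNats _).1
      (length_le_length_encodeNats _).2)
  rw [h] at R₃
  replace R₃ := R₃.relabel (M' := M) (lab := .inr) (exit := some (.inl 2)) (fun _ => rfl)
  rw [hs out] at R₃
  have R₄ := reach_popLoop (M := M) (l := .inl 2) (i := .inr .cst) rfl
    (fun x => low (Function.update (fun _ => []) out (encodeNats (eb (f a)))) []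
      (List.replicate x true) [])
    (fun x => List.replicate x true) N
    (fun x hx => by
      refine ⟨by simp [List.replicate_succ], ?_⟩
      simp only [stepAux]
      simp)
    (by simp) (none, none)
  simp only [Function.update_idem, Function.update_eq_self, List.append_nil, ← hN] at R₁
  simp only [List.replicate_zero, low_cst, List.tail_nil, update_low_cst, stepAux] at R₄
  rw [hi, ho]
  refine (((R₁.trans R₂).trans R₃).trans R₄).mono ?_
  simp only [Polynomial.eval_add, Polynomial.eval_mul, Polynomial.eval_X, Polynomial.eval_ofNat,
    Polynomial.eval_one, List.length_reverse]
  omega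

end Prog

end StackMachine

namespace StackMachine

/-! ### Programming idioms -/

/-- The registers of the programs below. -/
inductive Reg : Type
  | inp | nn | kk | T | T2 | R | x | y | z | w | I | J | out
  deriving DecidableEq

instance : Fintype Reg :=
  ⟨{.inp, .nn, .kk, .T, .T2, .R, .x, .y, .z, .w, .I, .J, .out}, fun r => by cases r <;> simp⟩

namespace Prog

local infixr:60 " ;; " => Prog.seq

section Idioms

variable {K : Type} [DecidableEq K]

theorem eval_seq (p q : Prog K) (N : ℕ) (s : K → List ℕ) :
    (p ;; q).eval N s = q.eval N (p.eval N s) := rfl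

theorem eval_rep (p : Prog K) (N : ℕ) (s : K → List ℕ) :
    (rep p).eval N s = (p.eval N)^[N] s := rfl

/-- Repeatedly moving the first entry reverses a register onto another one. -/
theorem eval_rep_move {i j : K} (h : i ≠ j) {N : ℕ} {s : K → List ℕ} (hn : (s i).length ≤ N) :
    (rep (move i j h)).eval N s =
      Function.update (Function.update s i []) j ((s i).reverse ++ s j) := by
  suffices ∀ n, (s i).length ≤ n → ((move i j h).eval N)^[n] s =
      Function.update (Function.update s i []) j ((s i).reverse ++ s j) from this N hn
  clear hn
  intro n hn
  induction n generalizing s with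
  | zero =>
    have h0 : s i = [] := List.length_eq_zero_iff.1 (by omega)
    funext k
    by_cases hj : k = j
    · subst hj; simp [h0]
    · by_cases hi : k = i
      · subst hi; simp [h0, hj]
      · simp [hi, hj]
  | succ n ih =>
    rw [Function.iterate_succ_apply, ih]
    · have h' := h.symm
      funext k
      simp only [eval]
      by_cases hj : k = j
      · subst hj
        cases s i <;> simp [h]
      · by_cases hi : k = i
        · subst hi; simp [hj]
        · simp [hi, hj]
    · simp only [eval, Function.update_of_ne h, Function.update_self, List.length_tail]
      omega

/-- The loop over `k = n - 1, …, 0`, where `n` is the first entry of `src`. -/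
def forDown (src k : K) (body : Prog K) (h : src ≠ k := by decide) : Prog K :=
  dup src k h ;; rep (case k skip skip (dec k ;; body)) ;; clear k

/-- If the body of a loop prepends `g i` to a register, then the loop prepends the concatenation
of these lists. -/
theorem eval_forDown {src k out : K} {body : Prog K} (h : src ≠ k) (hk : out ≠ k) {N n : ℕ}
    {s : K → List ℕ} {g : ℕ → List ℕ} (hn : n ≤ N) (hsrc : s src = [n]) (hs : s k = [])
    (hso : out ≠ src)
    (hbody : ∀ i < n, ∀ o, body.eval N (Function.update (Function.update s k [i]) out o) =
      Function.update (Function.update s k [i]) out (g i ++ o)) (o : List ℕ) :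
    (forDown src k body h).eval N (Function.update s out o) =
      Function.update s out ((List.range n).flatMap g ++ o) := by
  have hloop : ∀ m M, m ≤ n → m ≤ M → ∀ o,
      ((case k skip skip (dec k ;; body)).eval N)^[M]
        (Function.update (Function.update s k [m]) out o) =
      Function.update (Function.update s k [0]) out ((List.range m).flatMap g ++ o) := by
    intro m M hm hM
    induction M generalizing m with
    | zero =>
      obtain rfl : m = 0 := by omega
      simp
    | succ M ih =>
      intro o
      rw [Function.iterate_succ_apply]
      cases m with
      | zero =>
        have : (case k skip skip (dec k ;; body)).eval N
            (Function.update (Function.update s k [0]) out o) =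
              Function.update (Function.update s k [0]) out o := by
          simp [eval, hk.symm]
        rw [this]
        exact ih 0 (by omega) (by omega) o
      | succ m =>
        have : (case k skip skip (dec k ;; body)).eval N
            (Function.update (Function.update s k [m + 1]) out o) =
              Function.update (Function.update s k [m]) out (g m ++ o) := by
          rw [← hbody m (by omega)]
          simp only [eval, Function.update_of_ne hk.symm, Function.update_self, decHead,
            Nat.add_sub_cancel]
          congr 1
          rw [Function.update_comm hk, Function.update_idem]
        rw [this, ih m (by omega) (by omega), List.range_succ]
        simp
  have h1 : (dup src k h).eval N (Function.update s out o) =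
      Function.update (Function.update s k [n]) out o := by
    simp only [eval, Function.update_of_ne hso.symm, Function.update_of_ne hk.symm, hsrc, hs]
    rw [Function.update_comm hk]
    rfl
  rw [forDown, eval_seq, eval_seq, h1, eval_rep, hloop n N le_rfl hn, eval,
    Function.update_comm hk, Function.update_idem]
  congr 1
  rw [← hs, Function.update_eq_self]

end Idioms

/-- Runs `p` if the first entries of `i` and `j` are equal, and `q` otherwise; uses the registers
`x` and `y`. -/
def ifEq (i j : Reg) (p q : Prog Reg) (hi : i ≠ .x := by decide) (hj : j ≠ .y := by decide) :
    Prog Reg :=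
  dup i .x hi ;; dup j .y hj ;; sub .x .y ;;
    case .x skip
      (case .y skip (clear .x ;; clear .y ;; p) (clear .x ;; clear .y ;; q))
      (clear .x ;; clear .y ;; q)

theorem eval_ifEq {i j : Reg} {p q : Prog Reg} (hi : i ≠ .x) (hj : j ≠ .y) (hjx : j ≠ .x) {N : ℕ}
    {s : Reg → List ℕ} {a b : ℕ} {l l' : List ℕ} (hx : s .x = []) (hy : s .y = [])
    (ha : s i = a :: l) (hb : s j = b :: l') :
    (ifEq i j p q hi hj).eval N s = if a = b then p.eval N s else q.eval N s := by
  have h : (sub Reg.x .y).eval N ((dup j .y hj).eval N ((dup i .x hi).eval N s)) =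
      Function.update (Function.update s .x [a - b]) .y [b - a] := by
    simp only [eval, ha, hb, hx, hy, Function.update_of_ne hjx, Function.update_self,
      Function.update_of_ne (show Reg.x ≠ .y by decide),
      Function.update_of_ne (show Reg.y ≠ .x by decide)]
    funext k
    by_cases h1 : k = .y
    · subst h1; simp [subHead]
    · by_cases h2 : k = .x
      · subst h2; simp [subHead]
      · simp [h1, h2]
  have h' : ∀ c d, (clear Reg.y).eval N ((clear Reg.x).eval N
      (Function.update (Function.update s .x c) .y d)) = s := by
    intro c d
    funext k
    simp only [eval]
    by_cases h1 : k = .y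
    · subst h1; simp [hy]
    · by_cases h2 : k = .x
      · subst h2; simp [hx]
      · simp [h1, h2]
  simp only [ifEq, eval_seq, h]
  rcases lt_trichotomy a b with hab | hab | hab
  · rw [if_neg hab.ne, Nat.sub_eq_zero_of_le hab.le]
    obtain ⟨d, hd⟩ : ∃ d, b - a = d + 1 := ⟨b - a - 1, by omega⟩
    rw [hd]
    conv_rhs => rw [← h' [0] [d + 1]]
    simp [eval]
  · subst hab
    rw [if_pos rfl, Nat.sub_self]
    conv_rhs => rw [← h' [0] [0]]
    simp [eval]
  · rw [if_neg hab.ne', Nat.sub_eq_zero_of_le hab.le]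
    obtain ⟨d, hd⟩ : ∃ d, a - b = d + 1 := ⟨a - b - 1, by omega⟩
    rw [hd]
    conv_rhs => rw [← h' [d + 1] [0]]
    simp [eval]

/-- The contents of the registers. -/
structure Regs where
  inp : List ℕ := []
  nn : List ℕ := []
  kk : List ℕ := []
  T : List ℕ := []
  T2 : List ℕ := []
  R : List ℕ := []
  x : List ℕ := []
  y : List ℕ := []
  z : List ℕ := []
  w : List ℕ := []
  I : List ℕ := []
  J : List ℕ := []
  out : List ℕ := []

namespace Regs

/-- The contents of the registers, as a function. -/
def get (s : Regs) : Reg → List ℕ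
  | .inp => s.inp
  | .nn => s.nn
  | .kk => s.kk
  | .T => s.T
  | .T2 => s.T2
  | .R => s.R
  | .x => s.x
  | .y => s.y
  | .z => s.z
  | .w => s.w
  | .I => s.I
  | .J => s.J
  | .out => s.out

variable (s : Regs) (l : List ℕ)

@[simp] theorem get_inp : s.get .inp = s.inp := rfl
@[simp] theorem get_nn : s.get .nn = s.nn := rfl
@[simp] theorem get_kk : s.get .kk = s.kk := rfl
@[simp] theorem get_T : s.get .T = s.T := rfl
@[simp] theorem get_T2 : s.get .T2 = s.T2 := rfl
@[simp] theorem get_R : s.get .R = s.R := rfl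
@[simp] theorem get_x : s.get .x = s.x := rfl
@[simp] theorem get_z : s.get .z = s.z := rfl
@[simp] theorem get_w : s.get .w = s.w := rfl
@[simp] theorem get_I : s.get .I = s.I := rfl
@[simp] theorem get_J : s.get .J = s.J := rfl
@[simp] theorem get_out : s.get .out = s.out := rfl

@[simp] theorem update_inp : Function.update s.get .inp l = { s with inp := l }.get := by
  funext r; cases r <;> rfl
@[simp] theorem update_nn : Function.update s.get .nn l = { s with nn := l }.get := by
  funext r; cases r <;> rfl
@[simp] theorem update_kk : Function.update s.get .kk l = { s with kk := l }.get := by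
  funext r; cases r <;> rfl
@[simp] theorem update_T : Function.update s.get .T l = { s with T := l }.get := by
  funext r; cases r <;> rfl
@[simp] theorem update_T2 : Function.update s.get .T2 l = { s with T2 := l }.get := by
  funext r; cases r <;> rfl
@[simp] theorem update_R : Function.update s.get .R l = { s with R := l }.get := by
  funext r; cases r <;> rfl
@[simp] theorem update_x : Function.update s.get .x l = { s with x := l }.get := by
  funext r; cases r <;> rfl
@[simp] theorem update_z : Function.update s.get .z l = { s with z := l }.get := by
  funext r; cases r <;> rfl
@[simp] theorem update_w : Function.update s.get .w l = { s with w := l }.get := by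
  funext r; cases r <;> rfl
@[simp] theorem update_I : Function.update s.get .I l = { s with I := l }.get := by
  funext r; cases r <;> rfl
@[simp] theorem update_J : Function.update s.get .J l = { s with J := l }.get := by
  funext r; cases r <;> rfl
@[simp] theorem update_out : Function.update s.get .out l = { s with out := l }.get := by
  funext r; cases r <;> rfl

end Regs

end Prog

end StackMachine

namespace StackMachine

namespace Prog

local infixr:60 " ;; " => Prog.seq

/-! ### A program that constructs Eulerian tours -/

section Tour

/-- One step in the search for edges at the last vertex `T[0]` of the walk: the next edge of the
list `inp` is used to continue the walk if possible, and otherwise put aside to `R`. -/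
def edgeStep : Prog Reg :=
  let body := move .inp .w ;;
    ifEq .w .T (clear .w ;; move .inp .T)
      (ifEq .inp .T (move .inp .z ;; clear .z ;; move .w .T) (move .w .R ;; move .inp .R))
  case .inp skip body body

/-- One pass through the list of unused edges. -/
def pass : Prog Reg := rep edgeStep ;; rep (move .R .inp)

/-- Continue the walk as long as possible. -/
def extend : Prog Reg := rep pass

/-- Rotate a closed walk by one step. -/
def rotate : Prog Reg :=
  rep (move .T .T2) ;; move .T2 .x ;; rep (move .T2 .T) ;; move .x .T

/-- Insert closed walks at the vertices of a closed walk as long as possible. The inner loop rotates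
the walk once around, and each round that is not the last one decreases the number of unused
edges. -/
def tour : Prog Reg := extend ;; rep (rep (rotate ;; extend))

theorem eval_edgeStep {N a b c : ℕ} {p q l t r : List ℕ} :
    edgeStep.eval N
      (Regs.get { inp := a :: b :: l, nn := p, kk := q, T := c :: t, R := r }) =
      if a = c then Regs.get { inp := l, nn := p, kk := q, T := b :: c :: t, R := r }
      else if b = c then Regs.get { inp := l, nn := p, kk := q, T := a :: c :: t, R := r }
      else Regs.get { inp := l, nn := p, kk := q, T := c :: t, R := b :: a :: r } := by
  have h : ∀ s : Regs, s.inp = a :: b :: l → edgeStep.eval N s.get =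
      (ifEq .w .T (clear .w ;; move .inp .T)
      (ifEq .inp .T (move .inp .z ;; clear .z ;; move .w .T)
        (move .w .R ;; move .inp .R))).eval N ((move Reg.inp .w).eval N s.get) := by
    intro s hs
    cases a <;> simp only [edgeStep, eval, Regs.get_inp, hs]
  rw [h _ rfl]
  have h' : (move Reg.inp .w).eval N
      (Regs.get { inp := a :: b :: l, nn := p, kk := q, T := c :: t, R := r }) =
      Regs.get { inp := b :: l, nn := p, kk := q, T := c :: t, R := r, w := [a] } := by
    simp [eval]
  rw [h', eval_ifEq (by decide) (by decide) (by decide) rfl rfl rfl rfl,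
    eval_ifEq (by decide) (by decide) (by decide) rfl rfl rfl rfl]
  split_ifs <;> simp [eval]

theorem eval_rotate {N c : ℕ} {p q l t : List ℕ} (hN : t.length < N) :
    rotate.eval N (Regs.get { inp := l, nn := p, kk := q, T := t ++ [c] }) =
      Regs.get { inp := l, nn := p, kk := q, T := c :: t } := by
  rw [rotate, eval_seq, eval_seq, eval_seq,
    eval_rep_move (i := Reg.T) (j := Reg.T2) (by decide) (by simpa using hN)]
  have : (move Reg.T2 .x).eval N (Function.update (Function.update
      (Regs.get { inp := l, nn := p, kk := q, T := t ++ [c] }) .T []) .T2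
        ((Regs.get { inp := l, nn := p, kk := q, T := t ++ [c] } .T).reverse ++
          Regs.get { inp := l, nn := p, kk := q, T := t ++ [c] } .T2)) =
      Regs.get { inp := l, nn := p, kk := q, T2 := t.reverse, x := [c] } := by
    simp [eval]
  rw [this, eval_rep_move (by decide) (by simpa using hN.le)]
  simp [eval]

variable {n : ℕ}

/-- The end points of a list of edges. -/
def flat (es : List (Fin n × Fin n)) : List ℕ :=
  es.flatMap fun e => [e.1.val, e.2.val]

@[simp] theorem flat_nil : flat ([] : List (Fin n × Fin n)) = [] := rfl

@[simp] theorem flat_cons (e : Fin n × Fin n) (es : List (Fin n × Fin n)) :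
    flat (e :: es) = e.1.val :: e.2.val :: flat es := rfl

theorem length_flat (es : List (Fin n × Fin n)) : (flat es).length = 2 * es.length := by
  induction es with
  | nil => rfl
  | cons e es ih => simp [ih]; omega

/-- The edges of a list of pairs of end points. -/
def toEdges (es : List (Fin n × Fin n)) : List (Sym2 (Fin n)) := es.map fun e => s(e.1, e.2)

/-- The registers during the construction of a tour: `es` are the unused edges, and `T` is the
reversed word of a walk. -/
def conf (k : ℕ) (es : List (Fin n × Fin n)) (T : List (Fin n)) : Reg → List ℕ :=
  Regs.get { inp := flat es, nn := [n], kk := [k], T := T.map Fin.val }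

/-- All edges: those of the walk from `a` with reversed word `T`, and the unused edges. -/
def allEdges (a : Fin n) (es : List (Fin n × Fin n)) (T : List (Fin n)) : List (Sym2 (Fin n)) :=
  steps a T.reverse ++ toEdges es

theorem steps_reverse_cons (a b c : Fin n) (T : List (Fin n)) :
    steps a (b :: c :: T).reverse = steps a (c :: T).reverse ++ [s(c, b)] := by
  simp

/-- A scan of the list of unused edges, starting from the last vertex `c` of a walk: either no edge
meets `c` and nothing changes, or the walk is continued by some of the edges. -/
theorem eval_scan (N k : ℕ) (es : List (Fin n × Fin n)) (c : Fin n) (T : List (Fin n))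
    (r : List ℕ) {M : ℕ} (hM : es.length ≤ M) :
    ∃ es' B, (edgeStep.eval N)^[M]
        (Regs.get { inp := flat es, nn := [n], kk := [k], T := (c :: T).map Fin.val, R := r }) =
      Regs.get { nn := [n], kk := [k], R := (flat es').reverse ++ r
                 T := (B ++ c :: T).map Fin.val } ∧
      (∀ a, (allEdges a es' (B ++ c :: T)).Perm (allEdges a es (c :: T))) ∧
      ((es' = es ∧ B = [] ∧ ∀ e ∈ toEdges es, c ∉ e) ∨
        (∃ e ∈ toEdges es, c ∈ e) ∧ es'.length < es.length) := by
  induction es generalizing c T r M with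
  | nil =>
    refine ⟨[], [], ?_, fun a => .refl _, .inl ⟨rfl, rfl, by simp [toEdges]⟩⟩
    have : Function.IsFixedPt (edgeStep.eval N)
        (Regs.get { nn := [n], kk := [k], T := (c :: T).map Fin.val, R := r }) := by
      simp [Function.IsFixedPt, edgeStep, eval]
    exact this.iterate M
  | cons e es ih =>
    obtain ⟨x, y⟩ := e
    obtain ⟨M, rfl⟩ : ∃ M', M = M' + 1 := ⟨M - 1, by simp at hM; omega⟩
    have hM' : es.length ≤ M := by simpa using hM
    simp only [Function.iterate_succ_apply, flat_cons, List.map_cons]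
    rw [eval_edgeStep]
    by_cases h₁ : x = c
    · subst h₁
      obtain ⟨es', B, h, hp, hl⟩ := ih y (x :: T) r hM'
      refine ⟨es', B ++ [y], ?_, fun a => ?_, .inr ⟨⟨s(x, y), by simp [toEdges], by simp⟩, ?_⟩⟩
      · simpa using h
      · rw [List.append_assoc]
        refine (hp a).trans ?_
        rw [allEdges, steps_reverse_cons, List.append_assoc]
        exact .refl _
      · rcases hl with ⟨rfl, -⟩ | ⟨-, hl⟩
        · simp
        · simp; omega
    · rw [if_neg (by simpa [Fin.val_inj] using h₁)]
      by_cases h₂ : y = c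
      · subst h₂
        obtain ⟨es', B, h, hp, hl⟩ := ih x (y :: T) r hM'
        refine ⟨es', B ++ [x], ?_, fun a => ?_,
          .inr ⟨⟨s(x, y), by simp [toEdges], by simp⟩, ?_⟩⟩
        · simpa using h
        · rw [List.append_assoc]
          refine (hp a).trans ?_
          rw [allEdges, steps_reverse_cons, List.append_assoc, Sym2.eq_swap]
          exact .refl _
        · rcases hl with ⟨rfl, -⟩ | ⟨-, hl⟩
          · simp
          · simp; omega
      · rw [if_neg (by simpa [Fin.val_inj] using h₂)]
        obtain ⟨es', B, h, hp, hl⟩ := ih c T (y :: x :: r) hM'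
        refine ⟨(x, y) :: es', B, ?_, fun a => ?_, ?_⟩
        · simpa using h
        · exact List.perm_middle.trans (((hp a).cons _).trans List.perm_middle.symm)
        · rcases hl with ⟨rfl, rfl, hl⟩ | hl
          · refine .inl ⟨rfl, rfl, ?_⟩
            intro e he
            simp only [toEdges, List.map_cons, List.mem_cons] at he
            rcases he with rfl | he
            · simp [Ne.symm h₁, Ne.symm h₂]
            · exact hl e he
          · obtain ⟨⟨e, he, hc⟩, hl⟩ := hl
            exact .inr ⟨⟨e, List.mem_cons_of_mem _ he, hc⟩, by simpa using hl⟩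

/-- The effect of `pass`. -/
theorem eval_pass {N : ℕ} (k : ℕ) {es : List (Fin n × Fin n)} (c : Fin n) (T : List (Fin n))
    (hN : 2 * es.length ≤ N) :
    ∃ es' B, pass.eval N (conf k es (c :: T)) = conf k es' (B ++ c :: T) ∧
      (∀ a, (allEdges a es' (B ++ c :: T)).Perm (allEdges a es (c :: T))) ∧
      ((es' = es ∧ B = [] ∧ ∀ e ∈ toEdges es, c ∉ e) ∨
        (∃ e ∈ toEdges es, c ∈ e) ∧ es'.length < es.length) := by
  obtain ⟨es', B, h, hp, hl⟩ := eval_scan N k es c T [] (M := N) (by omega)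
  refine ⟨es', B, ?_, hp, hl⟩
  have hle : es'.length ≤ es.length := by
    rcases hl with ⟨rfl, -⟩ | ⟨-, hl⟩
    · rfl
    · exact hl.le
  rw [conf, pass, eval_seq, eval_rep edgeStep, h, eval_rep_move (by decide)]
  · simp [conf]
  · simp [length_flat]; omega

/-- An iteration that decreases a measure until the property `Q` holds. -/
theorem exists_iterate {α σ : Type*} {f : α → α} {c : σ → α} {P Q : σ → Prop} {μ : σ → ℕ}
    (h : ∀ a, P a → ∃ b, f (c a) = c b ∧ P b ∧ (Q b ∨ ¬ Q a ∧ μ b < μ a)) {a : σ} (ha : P a)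
    {N : ℕ} (hN : μ a < N) : ∃ b, f^[N] (c a) = c b ∧ P b ∧ Q b := by
  have hQ : ∀ N a, P a → Q a → ∃ b, f^[N] (c a) = c b ∧ P b ∧ Q b := by
    intro N
    induction N with
    | zero => exact fun a hP hQ => ⟨a, rfl, hP, hQ⟩
    | succ N ih =>
      intro a hP hQ
      obtain ⟨b, e, hb, hb'⟩ := h a hP
      rw [Function.iterate_succ_apply, e]
      exact ih b hb (hb'.resolve_right fun h => h.1 hQ)
  induction N generalizing a with
  | zero => omega
  | succ N ih =>
    obtain ⟨b, e, hb, hb'⟩ := h a ha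
    rw [Function.iterate_succ_apply, e]
    rcases hb' with hb' | ⟨-, hlt⟩
    · exact hQ N b hb hb'
    · exact ih hb (by omega)

/-- The effect of `extend`: afterwards, no unused edge meets the last vertex of the walk. -/
theorem eval_extend {N : ℕ} (k : ℕ) {es : List (Fin n × Fin n)} (c : Fin n) (T : List (Fin n))
    (hN : 2 * es.length < N) :
    ∃ es' c' T', extend.eval N (conf k es (c :: T)) = conf k es' (c' :: T') ∧
      (∀ a, (allEdges a es' (c' :: T')).Perm (allEdges a es (c :: T))) ∧
      (∀ e ∈ toEdges es', c' ∉ e) ∧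
      ((es' = es ∧ c' = c ∧ T' = T) ∨
        (∃ e ∈ toEdges es, c ∈ e) ∧ es'.length < es.length) := by
  obtain ⟨⟨es', c', T'⟩, h, ⟨hp, hl⟩, hQ⟩ := exists_iterate
    (σ := List (Fin n × Fin n) × Fin n × List (Fin n))
    (f := pass.eval N) (c := fun a => conf k a.1 (a.2.1 :: a.2.2))
    (P := fun b => (∀ a, (allEdges a b.1 (b.2.1 :: b.2.2)).Perm (allEdges a es (c :: T))) ∧
      ((b.1 = es ∧ b.2.1 = c ∧ b.2.2 = T) ∨
        (∃ e ∈ toEdges es, c ∈ e) ∧ b.1.length < es.length))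
    (Q := fun b => ∀ e ∈ toEdges b.1, b.2.1 ∉ e) (μ := fun b => b.1.length)
    (a := (es, c, T)) (N := N) (by
      rintro ⟨es₁, c₁, T₁⟩ ⟨hp, hl⟩
      have hle : es₁.length ≤ es.length := by
        rcases hl with ⟨h, -⟩ | ⟨-, hl⟩
        · exact (congrArg List.length h).le
        · exact hl.le
      obtain ⟨es', B, h, hp', hl'⟩ := eval_pass (N := N) k (es := es₁) c₁ T₁ (by omega)
      obtain ⟨c', T', hB⟩ : ∃ c' T', B ++ c₁ :: T₁ = c' :: T' := by cases B <;> simp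
      refine ⟨(es', c', T'), by simpa only [← hB] using h, ⟨fun a => ?_, ?_⟩, ?_⟩
      · simpa only [← hB] using (hp' a).trans (hp a)
      · rcases hl' with ⟨rfl, rfl, -⟩ | ⟨hc, hl'⟩
        · simp only [List.nil_append, List.cons.injEq] at hB
          obtain ⟨rfl, rfl⟩ := hB
          exact hl
        · refine .inr ⟨?_, by dsimp only; omega⟩
          rcases hl with ⟨rfl, rfl, rfl⟩ | ⟨hl, -⟩
          · exact hc
          · exact hl
      · rcases hl' with ⟨rfl, rfl, hQ⟩ | ⟨⟨e, he, hc⟩, hl'⟩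
        · simp only [List.nil_append, List.cons.injEq] at hB
          obtain ⟨rfl, rfl⟩ := hB
          exact .inl hQ
        · exact .inr ⟨fun h => h e he hc, hl'⟩)
    ⟨fun a => .refl _, .inl ⟨rfl, rfl, rfl⟩⟩ (by dsimp only; omega)
  exact ⟨es', c', T', h, hp, hQ, hl⟩

/-- A closed walk from `a`, with reversed word `T`, such that no unused edge meets `a`, and such
that `E` consists of the edges of the walk and the unused edges. -/
def ClosedAt (E : List (Sym2 (Fin n))) (a : Fin n) (es : List (Fin n × Fin n))
    (T : List (Fin n)) : Prop :=
  (∃ T', T = a :: T') ∧ (allEdges a es T).Perm E ∧ ∀ e ∈ toEdges es, a ∉ e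

/-- No unused edge meets the walk. -/
def Exhausted (es : List (Fin n × Fin n)) (T : List (Fin n)) : Prop :=
  ∀ e ∈ toEdges es, ∀ v ∈ T, v ∉ e

theorem ClosedAt.endpt_eq {E : List (Sym2 (Fin n))} {a : Fin n} {es : List (Fin n × Fin n)}
    {T : List (Fin n)} (h : ClosedAt E a es T) : endpt a T.reverse = a := by
  obtain ⟨⟨T', rfl⟩, -⟩ := h
  simp

theorem ClosedAt.length_add {E : List (Sym2 (Fin n))} {a : Fin n} {es : List (Fin n × Fin n)}
    {T : List (Fin n)} (h : ClosedAt E a es T) : T.length + es.length = E.length := by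
  rw [← h.2.1.length_eq, allEdges, List.length_append, length_steps, List.length_reverse, toEdges,
    List.length_map]

/-- If all degrees are even, then a walk can get stuck only at its start. -/
theorem eq_of_stuck {E : List (Sym2 (Fin n))} (hE : ∀ v, Even (E.map (incidence v)).sum)
    {a c : Fin n} {es : List (Fin n × Fin n)} {T : List (Fin n)}
    (hp : (allEdges a es (c :: T)).Perm E) (hs : ∀ e ∈ toEdges es, c ∉ e) : c = a := by
  have h0 : ((toEdges es).map (incidence c)).sum = 0 := by
    rw [List.sum_eq_zero_iff]
    intro x hx
    obtain ⟨e, he, rfl⟩ := List.mem_map.1 hx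
    have h1 := hs e he
    have h2 : e ≠ s(c, c) := by rintro rfl; simp at h1
    simp [incidence, h1, h2]
  have h1 := sum_incidence_steps c a (c :: T).reverse
  have h2 := hE c
  rw [← (hp.map _).sum_eq, allEdges, List.map_append, List.sum_append, h0, add_zero] at h2
  have h3 : endpt a (c :: T).reverse = c := by simp
  rw [if_pos h3] at h1
  by_contra hne
  rw [if_neg (Ne.symm hne)] at h1
  obtain ⟨r, hr⟩ := h2
  omega

theorem allEdges_rotate {a z : Fin n} {es : List (Fin n × Fin n)} {T : List (Fin n)}
    (h : endpt a (T ++ [z]).reverse = a) :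
    (allEdges z es (z :: T)).Perm (allEdges a es (T ++ [z])) := by
  unfold allEdges
  refine List.Perm.append_right _ ?_
  rw [List.reverse_append, List.reverse_singleton, List.singleton_append] at h ⊢
  rw [endpt_cons] at h
  rw [List.reverse_cons, steps_append, h, steps_cons]
  exact List.perm_append_comm

theorem eval_rotate_extend {N : ℕ} (k : ℕ) {E : List (Sym2 (Fin n))}
    (hE : ∀ v, Even (E.map (incidence v)).sum) (hN : 2 * E.length < N) {a z : Fin n}
    {es : List (Fin n × Fin n)} {T : List (Fin n)} (h : ClosedAt E a es (T ++ [z])) :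
    ∃ es' T', (rotate ;; extend).eval N (conf k es (T ++ [z])) = conf k es' (z :: T') ∧
      ClosedAt E z es' (z :: T') ∧
      ((es' = es ∧ T' = T) ∨ (∃ e ∈ toEdges es, z ∈ e) ∧ es'.length < es.length) := by
  have hl := h.length_add
  rw [List.length_append, List.length_singleton] at hl
  obtain ⟨es', c', T', he, hp, hs, hd⟩ := eval_extend (N := N) k (es := es) z T (by omega)
  have hp' := (hp z).trans ((allEdges_rotate h.endpt_eq).trans h.2.1)
  obtain rfl := eq_of_stuck hE hp' hs
  refine ⟨es', T', ?_, ⟨⟨T', rfl⟩, hp', hs⟩, ?_⟩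
  · rw [eval_seq, conf, List.map_append, List.map_singleton, eval_rotate (by simp; omega)]
    exact he
  · rcases hd with ⟨h1, -, h2⟩ | hd
    · exact .inl ⟨h1, h2⟩
    · exact .inr hd

/-- Rotating the walk once around, either some unused edges can be inserted, or no unused edge meets
the walk. -/
theorem eval_round {N : ℕ} (k : ℕ) {E : List (Sym2 (Fin n))}
    (hE : ∀ v, Even (E.map (incidence v)).sum) (hN : 2 * E.length < N) {a : Fin n}
    {es : List (Fin n × Fin n)} {T : List (Fin n)} (h : ClosedAt E a es T) :
    ∃ a' es' T', (rep (rotate ;; extend)).eval N (conf k es T) = conf k es' T' ∧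
      ClosedAt E a' es' T' ∧
      (Exhausted es' T' ∨ ¬ Exhausted es T ∧ es'.length < es.length) := by
  -- The reversed word of the walk is split as `Z ++ A`; the vertices in `Z` have been checked.
  obtain ⟨⟨es', Z, A⟩, he, ⟨⟨a', hc⟩, hd⟩, hQ⟩ := exists_iterate
    (σ := List (Fin n × Fin n) × List (Fin n) × List (Fin n))
    (f := (rotate ;; extend).eval N) (c := fun b => conf k b.1 (b.2.1 ++ b.2.2))
    (P := fun b => (∃ a, ClosedAt E a b.1 (b.2.1 ++ b.2.2)) ∧
      ((b.1 = es ∧ Exhausted es b.2.1 ∧ (b.2.1 ++ b.2.2).Perm T) ∨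
        ¬ Exhausted es T ∧ b.1.length < es.length))
    (Q := fun b => b.2.2 = [] ∨ b.1.length < es.length) (μ := fun b => b.2.2.length)
    (a := (es, [], T)) (N := N) (by
      rintro ⟨es₁, Z, A⟩ ⟨⟨a₁, hc⟩, hd⟩
      rcases List.eq_nil_or_concat A with rfl | ⟨A, z, rfl⟩
      · simp only [List.append_nil] at hc hd ⊢
        obtain ⟨Z, z, rfl⟩ : ∃ Z' z, Z = Z' ++ [z] := by
          rcases List.eq_nil_or_concat Z with rfl | ⟨Z', z, rfl⟩
          · obtain ⟨⟨T', h⟩, -⟩ := hc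
            simp at h
          · exact ⟨Z', z, by simp⟩
        obtain ⟨es', T', he, hc', hl'⟩ := eval_rotate_extend k hE hN hc
        refine ⟨(es', z :: T', []), by simpa using he, ⟨⟨z, by simpa using hc'⟩, ?_⟩,
          .inl (.inl rfl)⟩
        rcases hd with ⟨rfl, hx, hp⟩ | ⟨hx, hl⟩
        · rcases hl' with ⟨rfl, rfl⟩ | ⟨⟨e, he, hze⟩, hl'⟩
          · refine .inl ⟨rfl, fun e he v hv => hx e he v ?_, ?_⟩
            · simpa [or_comm] using hv
            · simpa using (List.perm_append_comm (l₁ := [z])).trans hp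
          · exact .inr ⟨fun h => h e he z (hp.mem_iff.1 (by simp)) hze, hl'⟩
        · refine .inr ⟨hx, ?_⟩
          rcases hl' with ⟨rfl, -⟩ | ⟨-, hl'⟩
          · exact hl
          · exact hl'.trans hl
      · simp only [List.concat_eq_append, ← List.append_assoc] at hc hd ⊢
        obtain ⟨es', T', he, hc', hl'⟩ := eval_rotate_extend k hE hN hc
        rcases hd with ⟨rfl, hx, hp⟩ | ⟨hx, hl⟩
        · rcases hl' with ⟨rfl, rfl⟩ | ⟨⟨e, he', hze⟩, hl'⟩
          · refine ⟨(es', z :: Z, A), he, ⟨⟨z, hc'⟩, .inl ⟨rfl, fun e he' v hv => ?_, ?_⟩⟩,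
              .inr ⟨by simp, by simp⟩⟩
            · rcases List.mem_cons.1 hv with rfl | hv
              · exact hc'.2.2 e he'
              · exact hx e he' v hv
            · exact (List.perm_append_comm (l₁ := [z])).trans hp
          · exact ⟨(es', z :: T', []), by simpa using he, ⟨⟨z, by simpa using hc'⟩,
              .inr ⟨fun h => h e he' z (hp.mem_iff.1 (by simp)) hze, hl'⟩⟩, .inl (.inl rfl)⟩
        · refine ⟨(es', z :: T', []), by simpa using he, ⟨⟨z, by simpa using hc'⟩,
              .inr ⟨hx, ?_⟩⟩, .inl (.inl rfl)⟩
          rcases hl' with ⟨rfl, -⟩ | ⟨-, hl'⟩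
          · exact hl
          · exact hl'.trans hl)
    ⟨⟨a, h⟩, .inl ⟨rfl, fun e _ v hv => by simp at hv, .refl _⟩⟩
    (by have := h.length_add; dsimp only; omega)
  refine ⟨a', es', Z ++ A, he, hc, ?_⟩
  rcases hd with ⟨rfl, hx, hp⟩ | hd
  · rcases hQ with rfl | hQ
    · rw [List.append_nil]
      exact .inl hx
    · simp at hQ
  · exact .inr hd

/-- The effect of `tour`: a closed walk that contains an edge and that no unused edge meets. -/
theorem eval_tour {N : ℕ} (k : ℕ) {E : List (Sym2 (Fin n))}
    (hE : ∀ v, Even (E.map (incidence v)).sum) (hN : 2 * E.length < N) {a b : Fin n}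
    {es : List (Fin n × Fin n)} (h : (allEdges a es [b]).Perm E) :
    ∃ a' es' T', tour.eval N (conf k es [b]) = conf k es' T' ∧ ClosedAt E a' es' T' ∧
      Exhausted es' T' := by
  have hl := h.length_eq
  rw [allEdges, List.length_append, length_steps, toEdges, List.length_map] at hl
  obtain ⟨es₁, c, T₁, he, hp, hs, -⟩ := eval_extend (N := N) k (es := es) b [] (by omega)
  have hp' := (hp a).trans h
  obtain rfl := eq_of_stuck hE hp' hs
  have hc : ClosedAt E c es₁ (c :: T₁) := ⟨⟨T₁, rfl⟩, hp', hs⟩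
  obtain ⟨⟨es', T'⟩, he', ⟨a', hc'⟩, hx⟩ := exists_iterate
    (f := (rep (rotate ;; extend)).eval N) (c := fun s => conf k s.1 s.2)
    (P := fun s : List (Fin n × Fin n) × List (Fin n) => ∃ a, ClosedAt E a s.1 s.2)
    (Q := fun s => Exhausted s.1 s.2) (μ := fun s => s.1.length) (a := (es₁, c :: T₁)) (N := N)
    (by
      rintro ⟨es₂, T₂⟩ ⟨a₂, h₂⟩
      obtain ⟨a₃, es₃, T₃, h₃, h₄, h₅⟩ := eval_round k hE hN h₂
      exact ⟨(es₃, T₃), h₃, ⟨a₃, h₄⟩, h₅⟩)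
    ⟨c, hc⟩ (by have := hc.length_add; dsimp only; omega)
  refine ⟨a', es', T', ?_, hc', hx⟩
  rw [tour, eval_seq, he]
  exact he'

end Tour

end Prog

end StackMachine

namespace StackMachine

namespace Prog

local infixr:60 " ;; " => Prog.seq

/-! ### Disconnected multigraphs -/

section Disconnected

variable {n m : ℕ} {F : MultiGraph (Fin n) (Fin m)} {a : Fin n} {es : List (Fin n × Fin n)}
  {T : List (Fin n)}

/-- If no unused edge meets a closed walk, then no edge leaves its set of vertices. -/
theorem ClosedAt.mem_iff_mem {E : List (Sym2 (Fin n))} (h : ClosedAt E a es T)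
    (hx : Exhausted es T) {e : Sym2 (Fin n)} (he : e ∈ E) {u v : Fin n} (hu : u ∈ e) (hv : v ∈ e)
    (huT : u ∈ T) : v ∈ T := by
  obtain ⟨⟨T', rfl⟩, hp, -⟩ := h
  rcases List.mem_append.1 (hp.mem_iff.2 he) with he | he
  · have := mem_of_mem_steps he hv
    simpa [or_comm, or_left_comm] using this
  · exact absurd hu (hx e he u huT)

theorem ClosedAt.not_connected (h : ClosedAt F.endsList a es T) (hx : Exhausted es T)
    (hes : es ≠ []) : ¬ F.Connected := by
  intro hF
  obtain ⟨e, es, rfl⟩ := List.exists_cons_of_ne_nil hes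
  have ha : a ∈ T := by
    obtain ⟨⟨T', rfl⟩, -⟩ := h
    simp
  have key : ∀ u v, (SimpleGraph.fromRel fun u v => ∃ e, F.ends e = s(u, v)).Walk u v →
      u ∈ T → v ∈ T := by
    intro u v p
    induction p with
    | nil => exact id
    | @cons u v w huv _ ih =>
      intro hu
      refine ih ?_
      have hmem : ∀ e, F.ends e ∈ F.endsList := fun e =>
        List.mem_map.2 ⟨e, List.mem_finRange e, rfl⟩
      rcases ((SimpleGraph.fromRel_adj _ _ _).1 huv).2 with ⟨e, he⟩ | ⟨e, he⟩
      · exact h.mem_iff_mem hx (hmem e) (by simp [he] : u ∈ F.ends e) (by simp [he]) hu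
      · exact h.mem_iff_mem hx (hmem e) (by simp [he] : u ∈ F.ends e) (by simp [he]) hu
  obtain ⟨p⟩ := hF.preconnected a e.1
  exact hx s(e.1, e.2) (by simp [toEdges]) e.1 (key _ _ p ha) (by simp)

theorem ClosedAt.not_isTourWord {E : List (Sym2 (Fin n))} (h : ClosedAt E a es T)
    (hx : Exhausted es T) (hes : es ≠ []) (X : List (Fin n)) : ¬ IsTourWord E X := by
  rintro ⟨b, -, hX⟩
  obtain ⟨e, es, rfl⟩ := List.exists_cons_of_ne_nil hes
  have he : s(e.1, e.2) ∈ E := h.2.1.mem_iff.1 (by simp [allEdges, toEdges])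
  have heT : e.1 ∉ T := fun h => hx s(e.1, e.2) (by simp [toEdges]) e.1 h (by simp)
  have heX : e.1 ∈ b :: X := mem_of_mem_steps (hX.mem_iff.2 he) (by simp)
  obtain ⟨f, hf, haf⟩ : ∃ f ∈ E, a ∈ f := by
    obtain ⟨⟨T', rfl⟩, hp, -⟩ := h
    obtain ⟨f, hf, haf⟩ := exists_mem_steps (a := a) (X := (a :: T').reverse) (by simp)
      List.mem_cons_self
    exact ⟨f, hp.mem_iff.1 (List.mem_append_left _ hf), haf⟩
  have haT : a ∈ T := by
    obtain ⟨⟨T', rfl⟩, -⟩ := h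
    simp
  have haX : a ∈ b :: X := mem_of_mem_steps (hX.mem_iff.2 hf) haf
  by_cases hb : b ∈ T
  · exact heT (mem_of_mem_walk {v | v ∈ T} hb
      (fun g hg u hu huT v hv => h.mem_iff_mem hx (hX.mem_iff.1 hg) hu hv huT) _ heX)
  · exact mem_of_mem_walk {v | v ∉ T} hb
      (fun g hg u hu huT v hv hvT => huT (h.mem_iff_mem hx (hX.mem_iff.1 hg) hv hu hvT)) _ haX haT

end Disconnected

/-! ### Programs that print adjacency matrices -/

section Output

/-- Prints a matrix; the size is the first entry of `src`, and `body` prints the entry with indices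
`I` and `J`. -/
def matrix (src : Reg) (body : Prog Reg) (hI : src ≠ .I := by decide)
    (hJ : src ≠ .J := by decide) : Prog Reg :=
  forDown src .I (forDown src .J body hJ) hI

theorem eval_matrix {src : Reg} {body : Prog Reg} (hI : src ≠ .I) (hJ : src ≠ .J)
    (ho : Reg.out ≠ src) {N n : ℕ} (hn : n ≤ N) (G : SimpleGraph (Fin n)) [DecidableRel G.Adj]
    {s : Reg → List ℕ} (hs : s src = [n]) (hsI : s .I = []) (hsJ : s .J = [])
    (hbody : ∀ (i j : Fin n) (o : List ℕ),
      body.eval N (Function.update (Function.update (Function.update s .I [i.val]) .J [j.val])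
        .out o) =
      Function.update (Function.update (Function.update s .I [i.val]) .J [j.val]) .out
        ((if G.Adj i j then 1 else 0) :: o)) (o : List ℕ) :
    (matrix src body hI hJ).eval N (Function.update s .out o) =
      Function.update s .out (adjacencyList G ++ o) := by
  let ent : ℕ → ℕ → List ℕ := fun i j =>
    if h : i < n ∧ j < n then [if G.Adj ⟨i, h.1⟩ ⟨j, h.2⟩ then 1 else 0] else []
  have hent : ∀ i j : Fin n, ent i j = [if G.Adj i j then 1 else 0] := by
    intro i j
    simp [ent]
  have hadj : adjacencyList G = (List.range n).flatMap fun i => (List.range n).flatMap (ent i) := by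
    rw [adjacencyList, ← List.map_coe_finRange_eq_range, List.flatMap_map]
    congr 1
    funext i
    rw [List.flatMap_map]
    simp only [hent, List.map_eq_flatMap]
    congr! 3 with j
    by_cases h : G.Adj i j <;> simp [h]
  rw [hadj]
  refine eval_forDown hI (by decide) hn hs hsI ho (fun i hi o => ?_) o
  refine eval_forDown hJ (by decide) hn ?_ ?_ ho (fun j hj o => ?_) o
  · rw [Function.update_of_ne hI, hs]
  · rw [Function.update_of_ne (by decide), hsJ]
  · rw [hbody ⟨i, hi⟩ ⟨j, hj⟩, hent ⟨i, hi⟩ ⟨j, hj⟩]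
    rfl

/-- Prints an entry of the adjacency matrix of the star with centre `0`. -/
def starEntry : Prog Reg :=
  case .I skip
    (case .J skip (push0 .out) (push0 .out ;; inc .out))
    (case .J skip (push0 .out ;; inc .out) (push0 .out))

/-- Copies to `z`, in reverse order, the letters of `T` that are equal to `I` or `J`. -/
def collect : Prog Reg :=
  let body := ifEq .T .I (dup .T .z) (ifEq .T .J (dup .T .z) skip) ;; move .T .T2
  rep (case .T skip body body) ;; rep (move .T2 .T)

/-- Prints an entry of the adjacency matrix of the alternance graph of the word in `T`. -/
def alternanceEntry : Prog Reg :=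
  collect ;;
    ifEq .I .J (clear .z ;; push0 .out)
      (move .z .w ;; move .z .x ;; clear .x ;;
        ifEq .w .z (clear .z ;; clear .w ;; push0 .out ;; inc .out)
          (clear .z ;; clear .w ;; push0 .out))

theorem eval_collect {N i j : ℕ} {p q t o : List ℕ} (hN : t.length ≤ N) :
    collect.eval N (Regs.get { nn := p, kk := q, T := t, I := [i], J := [j], out := o }) =
      Regs.get { nn := p, kk := q, T := t, I := [i], J := [j], out := o
                 z := (t.filter fun a => a = i ∨ a = j).reverse } := by
  have hloop : ∀ (M : ℕ) (t u v : List ℕ), t.length ≤ M →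
      ((case .T skip (ifEq .T .I (dup .T .z) (ifEq .T .J (dup .T .z) skip) ;; move .T .T2)
        (ifEq .T .I (dup .T .z) (ifEq .T .J (dup .T .z) skip) ;; move .T .T2)).eval N)^[M]
        (Regs.get { nn := p, kk := q, T := t, T2 := u, I := [i], J := [j], z := v, out := o }) =
      Regs.get { nn := p, kk := q, T2 := t.reverse ++ u, I := [i], J := [j], out := o
                 z := (t.filter fun a => a = i ∨ a = j).reverse ++ v } := by
    intro M
    induction M with
    | zero =>
      intro t u v ht
      obtain rfl : t = [] := List.length_eq_zero_iff.1 (by omega)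
      rfl
    | succ M ih =>
      intro t u v ht
      rw [Function.iterate_succ_apply]
      cases t with
      | nil =>
        rw [← ih [] u v (by simp)]
        rfl
      | cons a t =>
        have hcase : ∀ (b : Prog Reg) (s : Regs), s.T = a :: t →
            (case .T skip b b).eval N s.get = b.eval N s.get := by
          intro b s hs
          cases a <;> simp only [eval, Regs.get_T, hs]
        rw [hcase _ _ rfl, eval_seq, eval_ifEq (by decide) (by decide) (by decide) rfl rfl rfl rfl,
          eval_ifEq (by decide) (by decide) (by decide) rfl rfl rfl rfl]
        by_cases h₁ : a = i
        · rw [if_pos h₁, List.filter_cons_of_pos (by simp [h₁])]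
          have := ih t (a :: u) (a :: v) (by simpa using ht)
          simpa [eval] using this
        · rw [if_neg h₁]
          by_cases h₂ : a = j
          · rw [if_pos h₂, List.filter_cons_of_pos (by simp [h₂])]
            have := ih t (a :: u) (a :: v) (by simpa using ht)
            simpa [eval] using this
          · rw [if_neg h₂, List.filter_cons_of_neg (by simp [h₁, h₂])]
            have := ih t (a :: u) v (by simpa using ht)
            simpa [eval] using this
  have := hloop N t [] [] hN
  rw [collect, eval_seq, eval_rep _ _ (Regs.get _), this, eval_rep_move (by decide)]
  · simp
  · simpa using hN

theorem alternance_iff_getElem {α : Type*} {i j z₁ z₂ z₃ z₄ : α} [DecidableEq α] (hij : i ≠ j)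
    (hi : [z₁, z₂, z₃, z₄].count i = 2) (hj : [z₁, z₂, z₃, z₄].count j = 2) :
    ([z₁, z₂, z₃, z₄] = [i, j, i, j] ∨ [z₁, z₂, z₃, z₄] = [j, i, j, i]) ↔ z₁ = z₃ := by
  simp only [List.count_cons, List.count_nil, beq_iff_eq, List.cons.injEq] at *
  grind

theorem eval_alternanceEntry {N n : ℕ} {p q : List ℕ} {X : List (Fin n)}
    (hX : IsDoubleOccurrence X) (hN : X.length ≤ N) (i j : Fin n) (o : List ℕ)
    [Decidable ((alternanceGraph X).Adj i j)] :
    alternanceEntry.eval N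
      (Regs.get { nn := p, kk := q, T := X.reverse.map Fin.val, I := [i], J := [j], out := o }) =
      Regs.get { nn := p, kk := q, T := X.reverse.map Fin.val, I := [i], J := [j]
                 out := (if (alternanceGraph X).Adj i j then 1 else 0) :: o } := by
  have hz : ((X.reverse.map Fin.val).filter fun a => a = i.val ∨ a = j.val).reverse =
      (X.filter fun a => a = i ∨ a = j).map Fin.val := by
    rw [List.filter_map, ← List.map_reverse, ← List.filter_reverse, List.reverse_reverse]
    congr 2
    funext a
    simp [Fin.val_inj]
  rw [alternanceEntry, eval_seq, eval_collect (by simpa using hN), hz,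
    eval_ifEq (by decide) (by decide) (by decide) rfl rfl rfl rfl]
  by_cases hij : i = j
  · subst hij
    rw [if_pos rfl, if_neg (SimpleGraph.irrefl _)]
    simp [eval]
  · rw [if_neg (by simpa [Fin.val_inj] using hij)]
    have hl := length_filter_pair hij X
    have hci : (X.filter fun a => a = i ∨ a = j).count i = 2 := by
      rw [List.count_filter (by simp), hX i]
    have hcj : (X.filter fun a => a = i ∨ a = j).count j = 2 := by
      rw [List.count_filter (by simp), hX j]
    have hadj : (alternanceGraph X).Adj i j ↔ _ := isAlternance_iff (hX i) (hX j)
    rw [hX i, hX j] at hl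
    generalize X.filter (fun a => decide (a = i ∨ a = j)) = Z at *
    match Z, hl with
    | [z₁, z₂, z₃, z₄], _ =>
      rw [alternance_iff_getElem hij hci hcj, and_iff_right hij] at hadj
      have h' : ∀ P : Prog Reg, (move .z .w ;; move .z .x ;; clear .x ;; P).eval N
          (Regs.get { nn := p, kk := q, T := X.reverse.map Fin.val, I := [i.val], J := [j.val]
                      out := o, z := [z₁, z₂, z₃, z₄].map Fin.val }) = P.eval N
          (Regs.get { nn := p, kk := q, T := X.reverse.map Fin.val, I := [i.val], J := [j.val]
                      out := o, z := [z₃.val, z₄.val], w := [z₁.val] }) := by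
        intro P
        simp [eval]
      rw [h', eval_ifEq (by decide) (by decide) (by decide) rfl rfl rfl rfl]
      by_cases h : z₁ = z₃
      · rw [if_pos (hadj.2 h), if_pos (congrArg _ h)]
        simp [eval, incHead]
      · rw [if_neg (mt hadj.1 h), if_neg (by simpa [Fin.val_inj] using h)]
        simp [eval]

end Output

end Prog

end StackMachine

namespace StackMachine

namespace Prog

local infixr:60 " ;; " => Prog.seq

/-! ### The reductions as programs -/

section Reductions

/-- Reads an instance of ISO-SOET; the first edge becomes the initial walk. -/
def readInstance : Prog Reg :=
  move .inp .nn ;; move .inp .x ;; clear .x ;; move .inp .kk ;; move .inp .x ;; clear .x ;;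
    move .inp .T

/-- Reads an instance of ISO-SOET, and runs `p` with the reversed word of an Eulerian tour in `T`
if there is a tour, and `q` otherwise. -/
def withTour (p q : Prog Reg) : Prog Reg :=
  let find := tour ;; case .inp p q q
  readInstance ;; case .T q find find

/-- The edges of a multigraph, as pairs of numbers. -/
def edgePairs {n m : ℕ} (F : MultiGraph (Fin n) (Fin m)) : List (Fin n × Fin n) :=
  (List.finRange m).map fun e => ((F.ends e).inf, (F.ends e).sup)

theorem flat_edgePairs {n m : ℕ} (F : MultiGraph (Fin n) (Fin m)) :
    flat (edgePairs F) = edgeList F := by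
  rw [flat, edgePairs, List.flatMap_map]
  rfl

theorem toEdges_edgePairs {n m : ℕ} (F : MultiGraph (Fin n) (Fin m)) :
    toEdges (edgePairs F) = F.endsList := by
  rw [toEdges, edgePairs, List.map_map, MultiGraph.endsList]
  congr 1
  funext e
  simp only [Function.comp_apply]
  generalize F.ends e = a
  induction a with
  | h x y =>
    rcases le_total x y with h | h
    · simp [h]
    · simp [h, Sym2.eq_swap]

/-- The failure branch is taken only if the multigraph is not connected and has no Eulerian tour;
this includes the multigraph without vertices. -/
theorem eval_withTour {x : SoetInstance} {N : ℕ} (hN : 2 * x.m < N) :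
    (∃ U : EulerianTour x.F, ∀ p q : Prog Reg,
      (withTour p q).eval N (Regs.get { inp := [x.n, x.m, x.k] ++ edgeList x.F }) =
        p.eval N (Regs.get { nn := [x.n], kk := [x.k], T := U.word.reverse.map Fin.val })) ∨
    (¬ x.F.Connected ∧ IsEmpty (EulerianTour x.F) ∧ ∃ l t, ∀ p q : Prog Reg,
      (withTour p q).eval N (Regs.get { inp := [x.n, x.m, x.k] ++ edgeList x.F }) =
        q.eval N (Regs.get { inp := l, nn := [x.n], kk := [x.k], T := t })) := by
  obtain ⟨n, m, F, hF, k, hk⟩ := x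
  dsimp only at hN ⊢
  have hlen : (edgePairs F).length = m := by simp [edgePairs]
  have hE := toEdges_edgePairs F
  rw [← flat_edgePairs F]
  rcases hes : edgePairs F with _ | ⟨⟨a, b⟩, es⟩
  · right
    have hn : IsEmpty (Fin n) := ⟨fun v => by
      have := hF v
      rw [F.degree_eq_sum, ← hE, hes] at this
      simp [toEdges] at this⟩
    refine ⟨fun h => hn.elim h.nonempty.some, ⟨fun U => hn.elim (U.vert 0)⟩, [], [],
      fun p q => ?_⟩
    simp [withTour, readInstance, eval]
  · rw [hes] at hE
    have heven : ∀ v, Even (F.endsList.map (incidence v)).sum := by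
      intro v
      rw [← F.degree_eq_sum, hF v]
      decide
    obtain ⟨a', es', T', he, hc, hx⟩ := eval_tour (N := N) k heven
      (by rwa [F.length_endsList]) (a := a) (b := b) (es := es) (by rw [← hE]; exact .refl _)
    have hread : ∀ p q, (withTour p q).eval N
        (Regs.get { inp := [n, m, k] ++ flat ((a, b) :: es) }) =
        (case .inp p q q).eval N (conf k es' T') := by
      intro p q
      rw [← he, ← eval_seq]
      have h1 : readInstance.eval N (Regs.get { inp := [n, m, k] ++ flat ((a, b) :: es) }) =
          conf k es [b] := by
        simp [readInstance, eval, conf]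
      have h2 : ∀ p q : Prog Reg, (case .T q p p).eval N (conf k es [b]) =
          p.eval N (conf k es [b]) := by
        intro p q
        have h3 : conf k es [b] .T = [b.val] := rfl
        simp only [eval, h3]
        cases b.val <;> rfl
      rw [withTour, eval_seq, h1, h2]
    rcases es' with _ | ⟨⟨u, v⟩, es'⟩
    · left
      have hX : IsTourWord F.endsList T'.reverse := by
        refine ⟨a', hc.endpt_eq, ?_⟩
        simpa [allEdges, toEdges] using hc.2.1
      obtain ⟨U, hU⟩ := hX.exists_eulerianTour
      refine ⟨U, fun p q => ?_⟩
      rw [hread, hU, List.reverse_reverse]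
      rfl
    · right
      refine ⟨hc.not_connected hx (by simp),
        ⟨fun U => hc.not_isTourWord hx (by simp) _ U.isTourWord⟩,
        flat ((u, v) :: es'), T'.map Fin.val, fun p q => ?_⟩
      rw [hread]
      have h3 : conf k ((u, v) :: es') T' .inp = u.val :: v.val :: flat es' := rfl
      simp only [eval, h3]
      cases u.val <;> rfl

/-- Empties the registers that are in use when no tour has been found. -/
def clearAll : Prog Reg := clear .inp ;; clear .nn ;; clear .kk ;; clear .T

/-- Prints the alternance graph of the word in `T`, preceded by the numbers `nn` and `kk`. -/
def printAlternance : Prog Reg :=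
  matrix .nn alternanceEntry ;; clear .T ;; move .kk .out ;; move .nn .out

theorem eval_printAlternance {N n k : ℕ} {X : List (Fin n)} (hX : IsDoubleOccurrence X)
    (hN : X.length ≤ N) (hn : n ≤ N) (o : List ℕ) :
    printAlternance.eval N
      (Regs.get { nn := [n], kk := [k], T := X.reverse.map Fin.val, out := o }) =
      Regs.get { out := n :: k :: (adjacencyList (alternanceGraph X) ++ o) } := by
  classical
  have h := eval_matrix (src := .nn) (body := alternanceEntry) (by decide) (by decide) (by decide)
    hn (alternanceGraph X)
    (s := Regs.get { nn := [n], kk := [k], T := X.reverse.map Fin.val }) rfl rfl rfl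
    (fun i j o => by simpa using eval_alternanceEntry (p := [n]) (q := [k]) hX hN i j o) o
  rw [Regs.update_out, Regs.update_out] at h
  rw [printAlternance, eval_seq, h]
  simp [eval]

theorem eval_printStar {N n k : ℕ} {t : List ℕ} (hk : k ≤ N) :
    (matrix .kk starEntry).eval N (Regs.get { nn := [n], kk := [k], T := t }) =
      Regs.get { nn := [n], kk := [k], T := t, out := adjacencyList (starOn k) } := by
  classical
  have h := eval_matrix (src := .kk) (body := starEntry) (by decide) (by decide) (by decide)
    hk (starOn k) (s := Regs.get { nn := [n], kk := [k], T := t }) rfl rfl rfl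
    (fun i j o => by
      have hadj : (starOn k).Adj i j ↔ i ≠ j ∧ (i.val = 0 ∨ j.val = 0) := by
        cases k with
        | zero => exact i.elim0
        | succ k =>
          have h0 : ∀ i : Fin (k + 1), i = 0 ↔ i.val = 0 := fun i => Fin.ext_iff
          simp only [starOn, SimpleGraph.starGraph_adj, h0]
      obtain ⟨i, hi⟩ := i
      obtain ⟨j, hj⟩ := j
      simp only [hadj]
      cases i <;> cases j <;> simp [starEntry, eval, incHead]) []
  rw [Regs.update_out, Regs.update_out] at h
  simpa using h

end Reductions

end Prog

end StackMachine

/-! ### Instances that belong to tours -/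

/-- The instance of ISO-STARVERTEXMINOR that belongs to a tour. -/
noncomputable def starInstance (x : SoetInstance) (U : EulerianTour x.F) : StarInstance :=
  ⟨x.n, alternanceGraph U.word, x.k⟩

/-- The instance of ISO-VERTEXMINOR that belongs to a tour. -/
noncomputable def vertexMinorInstance (x : SoetInstance) (U : EulerianTour x.F) :
    VertexMinorInstance :=
  ⟨x.n, alternanceGraph U.word, x.k, starOn x.k⟩

theorem isoSoet_yes_iff_star (x : SoetInstance) (U : EulerianTour x.F) :
    isoSoet.yes x ↔ isoStarVertexMinor.yes (starInstance x U) :=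
  exists_congr fun W => and_congr_right fun _ => exists_isSoet_iff x.regular U W

theorem isoSoet_yes_iff_vertexMinor (x : SoetInstance) (U : EulerianTour x.F) :
    isoSoet.yes x ↔ isoVertexMinor.yes (vertexMinorInstance x U) :=
  (isoSoet_yes_iff_star x U).trans (exists_iso_starOn_vertexMinor_iff _ _).symm

theorem not_isoSoet_yes {x : SoetInstance} (h : IsEmpty (EulerianTour x.F)) : ¬ isoSoet.yes x :=
  fun ⟨_, _, U, _⟩ => h.elim U

theorem not_isoStarVertexMinor_yes : ¬ isoStarVertexMinor.yes (⟨0, ⊥, 1⟩ : StarInstance) := by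
  rintro ⟨W, hW, -⟩
  rw [Finset.eq_empty_of_isEmpty W] at hW
  simp at hW

theorem not_isoVertexMinor_yes :
    ¬ isoVertexMinor.yes (⟨0, ⊥, 1, starOn 1⟩ : VertexMinorInstance) := by
  intro h
  exact not_isoStarVertexMinor_yes ((exists_iso_starOn_vertexMinor_iff _ _).1 h)

/-! ### The reductions -/

namespace DecisionProblem

theorem IsReduction.comp {P Q R : DecisionProblem} {f : P.Instance → Q.Instance}
    {g : Q.Instance → R.Instance} (hf : P.IsReduction Q f) (hg : Q.IsReduction R g) :
    P.IsReduction R (g ∘ f) := by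
  obtain ⟨⟨h₁⟩, hf⟩ := hf
  obtain ⟨⟨h₂⟩, hg⟩ := hg
  exact ⟨StackMachine.polyTime_comp h₁ h₂, fun x => (hf x).trans (hg (f x))⟩

theorem IsReduction.npHard {P Q : DecisionProblem} {f : P.Instance → Q.Instance}
    (hf : P.IsReduction Q f) (hP : NPHard P) : NPHard Q := by
  intro L hL
  obtain ⟨g, hg⟩ := hP L hL
  exact ⟨_, hg.comp hf⟩

end DecisionProblem

section Programs

open StackMachine StackMachine.Prog

local infixr:60 " ;; " => Prog.seq

/-- The reduction to ISO-STARVERTEXMINOR; multigraphs without Eulerian tours are mapped to the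
instance `(∅, 1)`. -/
def starProgram : Prog Reg :=
  withTour printAlternance (clearAll ;; push0 .out ;; inc .out ;; push0 .out)

/-- The reduction to ISO-VERTEXMINOR; multigraphs without Eulerian tours are mapped to the instance
`(∅, S₁)`. -/
def vertexMinorProgram : Prog Reg :=
  withTour (matrix .kk starEntry ;; printAlternance)
    (clearAll ;; push0 .out ;; push0 .out ;; inc .out ;; push0 .out)

/-- The list of numbers that encodes an instance of ISO-SOET. -/
def soetList (x : SoetInstance) : List ℕ := [x.n, x.m, x.k] ++ edgeList x.F

/-- The list of numbers that encodes an instance of ISO-STARVERTEXMINOR. -/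
noncomputable def starList (y : StarInstance) : List ℕ := [y.n, y.k] ++ adjacencyList y.G

/-- The list of numbers that encodes an instance of ISO-VERTEXMINOR. -/
noncomputable def vertexMinorList (y : VertexMinorInstance) : List ℕ :=
  [y.n, y.k] ++ (adjacencyList y.G ++ adjacencyList y.H)

theorem bounds_encodeNats (x : SoetInstance) :
    x.n ≤ (encodeNats (soetList x)).length ∧ x.k ≤ (encodeNats (soetList x)).length ∧
      2 * x.m < (encodeNats (soetList x)).length := by
  obtain ⟨h1, h2⟩ := length_le_length_encodeNats (soetList x)
  refine ⟨h2 _ (by simp [soetList]), h2 _ (by simp [soetList]), lt_of_lt_of_le ?_ h1⟩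
  have : (edgeList x.F).length = 2 * x.m := by
    rw [← flat_edgePairs, length_flat]
    simp [edgePairs]
  rw [soetList, List.length_append, this]
  simp

theorem update_nil_inp (l : List ℕ) :
    Function.update (fun _ => []) Reg.inp l = Regs.get { inp := l } := by
  funext r
  cases r <;> rfl

theorem update_nil_out (l : List ℕ) :
    Function.update (fun _ => []) Reg.out l = Regs.get { out := l } := by
  funext r
  cases r <;> rfl

theorem EulerianTour.length_word {V : Type*} {m : ℕ} {F : MultiGraph V (Fin m)}
    (U : EulerianTour F) : U.word.length = m := by
  obtain ⟨a, -, h⟩ := U.isTourWord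
  rw [← length_steps a, h.length_eq, F.length_endsList]

theorem adjacencyList_zero (G : SimpleGraph (Fin 0)) : adjacencyList G = [] := rfl

/-- Correctness of the program `starProgram`. -/
theorem exists_starInstance (x : SoetInstance) : ∃ y : StarInstance,
    starProgram.eval (encodeNats (soetList x)).length
        (Function.update (fun _ => []) .inp (soetList x)) =
      Function.update (fun _ => []) .out (starList y) ∧
    ((∃ U, y = starInstance x U) ∨
      ¬ x.F.Connected ∧ IsEmpty (EulerianTour x.F) ∧ y = ⟨0, ⊥, 1⟩) := by
  obtain ⟨hn, -, hm⟩ := bounds_encodeNats x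
  rw [update_nil_inp]
  rcases eval_withTour hm with ⟨U, h⟩ | ⟨h1, h2, l, t, h⟩
  · refine ⟨starInstance x U, ?_, .inl ⟨U, rfl⟩⟩
    refine (h _ _).trans ?_
    have hl : U.word.length ≤ (encodeNats (soetList x)).length := by
      rw [U.length_word]; omega
    have := eval_printAlternance (k := x.k) (x.regular.isDoubleOccurrence U.isTourWord) hl hn []
    rw [update_nil_out, starList]
    simpa [starInstance] using this
  · refine ⟨⟨0, ⊥, 1⟩, ?_, .inr ⟨h1, h2, rfl⟩⟩
    refine (h _ _).trans ?_
    rw [update_nil_out, starList, adjacencyList_zero]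
    simp [eval, clearAll, incHead]

/-- Correctness of the program `vertexMinorProgram`. -/
theorem exists_vertexMinorInstance (x : SoetInstance) : ∃ y : VertexMinorInstance,
    vertexMinorProgram.eval (encodeNats (soetList x)).length
        (Function.update (fun _ => []) .inp (soetList x)) =
      Function.update (fun _ => []) .out (vertexMinorList y) ∧
    ((∃ U, y = vertexMinorInstance x U) ∨
      ¬ x.F.Connected ∧ IsEmpty (EulerianTour x.F) ∧ y = ⟨0, ⊥, 1, starOn 1⟩) := by
  obtain ⟨hn, hk, hm⟩ := bounds_encodeNats x
  rw [update_nil_inp]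
  rcases eval_withTour hm with ⟨U, h⟩ | ⟨h1, h2, l, t, h⟩
  · refine ⟨vertexMinorInstance x U, ?_, .inl ⟨U, rfl⟩⟩
    refine (h _ _).trans ?_
    have hl : U.word.length ≤ (encodeNats (soetList x)).length := by
      rw [U.length_word]; omega
    have := eval_printAlternance (k := x.k) (x.regular.isDoubleOccurrence U.isTourWord) hl hn
      (adjacencyList (starOn x.k))
    rw [update_nil_out, vertexMinorList, eval_seq, eval_printStar hk]
    simpa [vertexMinorInstance] using this
  · refine ⟨⟨0, ⊥, 1, starOn 1⟩, ?_, .inr ⟨h1, h2, rfl⟩⟩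
    refine (h _ _).trans ?_
    have hadj : adjacencyList (starOn 1) = [0] := by
      simp [adjacencyList, starOn, List.finRange_succ]
    rw [update_nil_out, vertexMinorList, adjacencyList_zero, hadj]
    simp [eval, clearAll, incHead]

end Programs

theorem isCircleGraph_zero (G : SimpleGraph (Fin 0)) : IsCircleGraph G :=
  ⟨[], fun v => v.elim0, by ext v; exact v.elim0⟩

theorem exists_reduction_star : ∃ f : SoetInstance → StarInstance,
    isoSoet.IsReduction isoStarVertexMinor f ∧
      ∀ x : SoetInstance, x.F.Connected → ∃ U : EulerianTour x.F, f x = starInstance x U := by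
  choose f hf hf' using exists_starInstance
  refine ⟨f, ⟨StackMachine.Prog.polyTime starProgram .inp .out soetList starList f hf, fun x => ?_⟩,
    fun x hx => (hf' x).resolve_right fun h => h.1 hx⟩
  rcases hf' x with ⟨U, hU⟩ | ⟨-, h, hU⟩
  · rw [hU]
    exact isoSoet_yes_iff_star x U
  · rw [hU]
    exact iff_of_false (not_isoSoet_yes h) not_isoStarVertexMinor_yes

theorem exists_reduction_vertexMinor :
    ∃ g : isoSoet.Instance → isoVertexMinorCircleStar.Instance,
      isoSoet.IsReduction isoVertexMinorCircleStar g ∧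
        ∀ x : SoetInstance, x.F.Connected →
          ∃ U : EulerianTour x.F, (g x).1 = vertexMinorInstance x U := by
  choose f hf hf' using exists_vertexMinorInstance
  have hp : ∀ x, IsCircleGraph (f x).G ∧ IsStar (f x).H := by
    intro x
    rcases hf' x with ⟨U, hU⟩ | ⟨-, -, hU⟩
    · rw [hU]
      exact ⟨⟨_, x.regular.isDoubleOccurrence U.isTourWord, rfl⟩, isStar_starOn _⟩
    · rw [hU]
      exact ⟨isCircleGraph_zero _, isStar_starOn 1⟩
  refine ⟨fun x => ⟨f x, hp x⟩, ⟨StackMachine.Prog.polyTime vertexMinorProgram .inp .out soetList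
    (fun y : isoVertexMinorCircleStar.Instance => vertexMinorList y.1) _ hf, fun x => ?_⟩,
    fun x hx => (hf' x).resolve_right fun h => h.1 hx⟩
  change isoSoet.yes x ↔ isoVertexMinor.yes (f x)
  rcases hf' x with ⟨U, hU⟩ | ⟨-, h, hU⟩
  · rw [hU]
    exact isoSoet_yes_iff_vertexMinor x U
  · rw [hU]
    exact iff_of_false (not_isoSoet_yes h) not_isoVertexMinor_yes

theorem mainTheorem2 :
    (∃ f : SoetInstance → StarInstance,
      isoSoet.IsReduction isoStarVertexMinor f ∧
        ∀ x : SoetInstance, x.F.Connected →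
          ∃ U : EulerianTour x.F, f x = ⟨x.n, alternanceGraph U.word, x.k⟩) ∧
    (∃ g : isoSoet.Instance → isoVertexMinorCircleStar.Instance,
      isoSoet.IsReduction isoVertexMinorCircleStar g ∧
        ∀ x : SoetInstance, x.F.Connected →
          ∃ U : EulerianTour x.F, (g x).1 =
            (⟨x.n, alternanceGraph U.word, x.k, starOn x.k⟩ : VertexMinorInstance)) ∧
    (∃ h : isoSoet.Instance → isoVertexMinor.Instance, isoSoet.IsReduction isoVertexMinor h) ∧
    (NPHard isoSoet →
      NPHard isoStarVertexMinor ∧ NPHard isoVertexMinorCircleStar ∧ NPHard isoVertexMinor) := by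
  obtain ⟨f, hf, hf'⟩ := exists_reduction_star
  obtain ⟨g, hg, hg'⟩ := exists_reduction_vertexMinor
  -- An instance of the restricted problem is encoded as an instance of the whole problem.
  have hh : isoSoet.IsReduction isoVertexMinor fun x => (g x).1 := by
    obtain ⟨⟨h₁⟩, h₂⟩ := hg
    exact ⟨⟨⟨h₁.toTM2ComputableAux, h₁.time, h₁.outputsFun⟩⟩, h₂⟩
  exact ⟨⟨f, hf, hf'⟩, ⟨g, hg, hg'⟩, ⟨_, hh⟩, fun h => ⟨hf.npHard h, hg.npHard h, hh.npHard h⟩⟩
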